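/- **Proposition 2.6.** Let $n\ge 2$, let $(M,g)$ be a smooth, complete, connected $n$-dimensional Riemannian manifold, and let $o\in M$. An open neighborhood $\Omega$ of $o$ is a *normal neighborhood* of $o$ if there is an open neighborhood $S$ of $0$ in $T_oM$ that $\exp_o$ maps diffeomorphically onto $\Omega$; it is *regular* if moreover $\exp_o$ is injective on $\overline S$ and the interior of $\overline S$ equals $S$; it is a *starshaped neighborhood* of $o$ if such an $S$ can be chosen starshaped about $0$ (that is, $tv\in S$ for all $v\in S$ and $t\in[0,1]$). Let $\Omega$ be a regular normal neighborhood of $o$, given by $S$, whose boundary $\partial\Omega$ is nonempty and smooth (near each of its points, $\Omega=\{\rho<0\}$ for a smooth function $\rho$ with $d\rho\ne0$ at that point). Then for each $p\in\partial\Omega$ there are exactly one $v\in\overline S$ with $\exp_o v=p$, denoted $\log_o(p)$, and exactly one outward unit normal vector $\nu(p)$, that is, a unit vector $\nu\in T_pM$ orthogonal to $T_p(\partial\Omega)$ with $\exp_p(-\varepsilon\nu)\in\Omega$ and $\exp_p(\varepsilon\nu)\notin\Omega$ for all sufficiently small $\varepsilon>0$. With $\gamma_p(t)=\exp_o(t\log_o(p))$,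 the set $\Omega$ is a starshaped neighborhood of $o$ if and only if $$g(\nu(p),\dot\gamma_p(1))\ge 0\qquad\text{for every } p\in\partial\Omega .$$ -/

import Mathlib

open Set Filter Topology Bundle
open scoped Manifold ContDiff

noncomputable section

namespace Starshaped

variable {n : ℕ} {M : Type*} [TopologicalSpace M] [ChartedSpace (EuclideanSpace ℝ (Fin n)) M]
  [IsManifold (𝓡 n) ∞ M]

/-- A smooth Riemannian metric on the `n`-dimensional smooth manifold `M`. -/
abbrev Metric (n : ℕ) (M : Type*) [TopologicalSpace M]
    [ChartedSpace (EuclideanSpace ℝ (Fin n)) M] [IsManifold (𝓡 n) ∞ M] :=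
  ContMDiffRiemannianMetric (𝓡 n) ∞ (EuclideanSpace ℝ (Fin n))
    (fun x : M => TangentSpace (𝓡 n) x)

/-- The velocity vector of the curve `γ` at time `t`. -/
def velocity (γ : ℝ → M) (t : ℝ) : TangentSpace (𝓡 n) (γ t) :=
  (mfderiv 𝓘(ℝ, ℝ) (𝓡 n) γ t : ℝ →L[ℝ] TangentSpace (𝓡 n) (γ t)) 1

/-- The curve `γ` is at the point `p` with velocity `v` at time `t`, i.e. `γ t = p` and
`γ' t = v`. (This is an equality in the tangent bundle, since a priori `γ' t` lives in the
tangent space at `γ t`.) -/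
def PassesWith (γ : ℝ → M) (t : ℝ) (p : M) (v : TangentSpace (𝓡 n) p) : Prop :=
  (⟨γ t, velocity (n := n) γ t⟩ : TangentBundle (𝓡 n) M) = ⟨p, v⟩

/-- The metric coefficients in the preferred chart at `x₀`: for constant vectors `u`, `w` of the
model space, the function `y ↦ g(dφ⁻¹ u, dφ⁻¹ w)` of the coordinate `y`, where `φ` is the chart.
For `u = e_i`, `w = e_j` this is `g_{ij}`. -/
def metricCoeff (g : Metric n M) (x₀ : M) (u w y : EuclideanSpace ℝ (Fin n)) : ℝ :=
  g.inner ((extChartAt (𝓡 n) x₀).symm y)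
    (mfderiv 𝓘(ℝ, EuclideanSpace ℝ (Fin n)) (𝓡 n) (extChartAt (𝓡 n) x₀).symm y u)
    (mfderiv 𝓘(ℝ, EuclideanSpace ℝ (Fin n)) (𝓡 n) (extChartAt (𝓡 n) x₀).symm y w)

/-- The Christoffel symbols of the first kind in the preferred chart at `x₀`, as a trilinear
expression: `Γ(u, v, w) = (∂_u g(v, w) + ∂_v g(u, w) - ∂_w g(u, v)) / 2`. -/
def christoffel (g : Metric n M) (x₀ : M) (y u v w : EuclideanSpace ℝ (Fin n)) : ℝ :=
  (fderiv ℝ (metricCoeff g x₀ v w) y u + fderiv ℝ (metricCoeff g x₀ u w) y v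
    - fderiv ℝ (metricCoeff g x₀ u v) y w) / 2

/-- `γ : ℝ → M` is a geodesic (defined on all of `ℝ`): it is smooth and, in every preferred chart,
its coordinate expression `c` solves the geodesic equation `g(c'', w) + Γ(c', c', w) = 0` for all
`w`, that is, `∇_{γ'} γ' = 0` for the Levi-Civita connection of `g`. -/
structure IsGeodesic (g : Metric n M) (γ : ℝ → M) : Prop where
  smooth : ContMDiff 𝓘(ℝ, ℝ) (𝓡 n) ∞ γ
  equation : ∀ (x₀ : M) (t : ℝ), γ t ∈ (extChartAt (𝓡 n) x₀).source →
    ∀ w : EuclideanSpace ℝ (Fin n),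
      let c : ℝ → EuclideanSpace ℝ (Fin n) := fun s => extChartAt (𝓡 n) x₀ (γ s)
      metricCoeff g x₀ (deriv (deriv c) t) w (c t)
        + christoffel g x₀ (c t) (deriv c t) (deriv c t) w = 0

/-- `(M, g)` is (geodesically) complete: for every initial point and initial velocity there is a
geodesic with these data which is defined on the whole real line. -/
def IsComplete (g : Metric n M) : Prop :=
  ∀ (p : M) (v : TangentSpace (𝓡 n) p), ∃ γ : ℝ → M, IsGeodesic g γ ∧ PassesWith γ 0 p v

open Classical in
/-- The exponential map `exp_p : T_p M → M`, `exp_p v = γ 1` where `γ` is the geodesic with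
`γ 0 = p` and `γ' 0 = v`. The tangent space `T_p M` is, by its definition in Mathlib, the model
vector space `EuclideanSpace ℝ (Fin n)`; only its structure of a finite-dimensional
topological vector space is used. -/
def expMap (g : Metric n M) (p : M) (v : EuclideanSpace ℝ (Fin n)) : M :=
  if h : ∃ γ : ℝ → M, IsGeodesic g γ ∧ PassesWith γ 0 p v then h.choose 1 else p

/-- `Ω` is an open neighborhood of `o`, `S` is an open neighborhood of `0` in `T_o M`, and `exp_o`
restricts to a diffeomorphism from `S` onto `Ω`. -/
structure IsNormalNhdVia (g : Metric n M) (o : M) (Ω : Set M)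
    (S : Set (EuclideanSpace ℝ (Fin n))) : Prop where
  isOpen : IsOpen Ω
  mem : o ∈ Ω
  isOpen_source : IsOpen S
  zero_mem : (0 : EuclideanSpace ℝ (Fin n)) ∈ S
  bijOn : BijOn (expMap g o) S Ω
  smoothOn : ContMDiffOn 𝓘(ℝ, EuclideanSpace ℝ (Fin n)) (𝓡 n) ∞ (expMap g o) S
  smoothOn_inv : ContMDiffOn (𝓡 n) 𝓘(ℝ, EuclideanSpace ℝ (Fin n)) ∞
    (Function.invFunOn (expMap g o) S) Ω

/-- `Ω` is a starshaped neighborhood of `o`: it is the diffeomorphic image under `exp_o` of an open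
neighborhood of `0` in `T_o M` that is starshaped about `0`. -/
def IsStarshapedNhd (g : Metric n M) (o : M) (Ω : Set M) : Prop :=
  ∃ S : Set (EuclideanSpace ℝ (Fin n)), IsNormalNhdVia g o Ω S ∧ StarConvex ℝ 0 S

/-- `Ω` is a regular normal neighborhood of `o`, the image under `exp_o` of `S`. -/
structure IsRegularNormalNhdVia (g : Metric n M) (o : M) (Ω : Set M)
    (S : Set (EuclideanSpace ℝ (Fin n))) : Prop extends IsNormalNhdVia g o Ω S where
  injOn_closure : InjOn (expMap g o) (closure S)
  interior_closure : interior (closure S) = S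

/-- `log_o`, the inverse of the injective map `exp_o : closure S → M`. On `Ω` it is the inverse
of `exp_o : S → Ω`; it is also defined at the boundary points of `Ω`. -/
def logMap (g : Metric n M) (o : M) (S : Set (EuclideanSpace ℝ (Fin n))) (p : M) :
    EuclideanSpace ℝ (Fin n) :=
  Function.invFunOn (expMap g o) (closure S) p

/-- The radial geodesic `γ_p t = exp_o (t log_o p)`. -/
def radial (g : Metric n M) (o : M) (S : Set (EuclideanSpace ℝ (Fin n))) (p : M) (t : ℝ) : M :=
  expMap g o (t • logMap g o S p)

/-- The open set `Ω` has smooth boundary: near each boundary point it is the sublevel set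
`{ρ < 0}` of a smooth function `ρ` with nonvanishing differential at that point. -/
def HasSmoothBoundary (n : ℕ) {M : Type*} [TopologicalSpace M]
    [ChartedSpace (EuclideanSpace ℝ (Fin n)) M] (Ω : Set M) : Prop :=
  ∀ p ∈ frontier Ω, ∃ (U : Set M) (ρ : M → ℝ), IsOpen U ∧ p ∈ U ∧
    ContMDiffOn (𝓡 n) 𝓘(ℝ, ℝ) ∞ ρ U ∧ mfderiv (𝓡 n) 𝓘(ℝ, ℝ) ρ p ≠ 0 ∧
    ∀ q ∈ U, q ∈ Ω ↔ ρ q < 0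

/-- `w` is tangent to `∂Ω` at `p`: it is the velocity at time `0` of a smooth curve that lies in
`∂Ω` near time `0` and is at `p` at time `0`. -/
def IsTangentToFrontier (Ω : Set M) (p : M) (w : TangentSpace (𝓡 n) p) : Prop :=
  ∃ c : ℝ → M, ContMDiffAt 𝓘(ℝ, ℝ) (𝓡 n) ∞ c 0 ∧ (∀ᶠ t in 𝓝 (0 : ℝ), c t ∈ frontier Ω) ∧
    PassesWith c 0 p w

/-- `ν` is an outward unit normal vector to `∂Ω` at `p`. -/
structure IsOutwardUnitNormal (g : Metric n M) (Ω : Set M) (p : M)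
    (ν : TangentSpace (𝓡 n) p) : Prop where
  unit : g.inner p ν ν = 1
  normal : ∀ w : TangentSpace (𝓡 n) p, IsTangentToFrontier Ω p w → g.inner p ν w = 0
  outward : ∀ᶠ ε in 𝓝[>] (0 : ℝ), expMap g p (-(ε • ν)) ∈ Ω ∧ expMap g p (ε • ν) ∉ Ω

end Starshaped

end

/-! ### Calculus and ordinary differential equations: mixed derivatives and `C¹` flows. -/

noncomputable section

namespace Starshaped

/-! Near a boundary point `p`, write `Ω = {r < 0}` in a chart. The outward unit normal is the
positive multiple of the gradient of `r` of length one (`isOutwardUnitNormal_iff`), so the condition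
of the theorem says that `dr ≥ 0` on the terminal velocities of the radial geodesics. Since `S` may
be unbounded, the logarithm at the boundary needs an argument. Push a point of `Ω` near `p` a fixed
amount into `Ω`. By the Gauss lemma, half the squared length `h` of the logarithm changes along this
segment at a rate at most `h + C / 2`, so Grönwall bounds the logarithm near `p`
(`exists_norm_log_le`). Compactness then gives existence and, with injectivity of `exp_o` on
`closure S`, continuity of the logarithm at `p`.

If `Ω` is starshaped, then `S` itself is starshaped, because a connectedness argument shows that
every starshaped normal domain of `Ω` equals `S`. A radial geodesic that ends at `p` therefore runs
in `closure Ω` before it reaches `p`, which forces `dr ≥ 0` on its velocity.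

Conversely, assume the boundary condition and let `starPart S` be the set of `u` whose segment `[0,
u]` lies in `S`. It is open; two facts make it all of `S`.

It is relatively closed in `S` (`mem_starPart_of_mem_closure`). Let `v ∈ S` be a limit of its points
and suppose that `[0, v]` is not contained in `S`. Let `w = τ v` be the last point of the segment
outside `S`. Then `exp_o w` is a boundary point and the radial geodesic enters `Ω` just after `w`.
The vector `w` is not conjugate: it is interior to a limit of segments free of conjugate vectors
(`nonConj_of_mem_closure`). Hence `exp_o` is a `C¹` local diffeomorphism at `w`, the radial
velocities form a `C¹` vector field near the boundary point, and its pairing with `dr`, being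
nonnegative on `{r = 0}`, is at least `-C |r|`. So `-r` grows at most exponentially along the
geodesic, starting from zero, and cannot become positive: a contradiction.

The complement `A = S \ starPart S` is then relatively clopen in `S`. If it is nonempty, take a
point `w` of `closure A` nearest to `0`. It lies outside `S`, so it maps to a boundary point, with
radial velocity `X` satisfying `dr X ≥ 0`. Each direction `z` with `dr z < 0` leads into `Ω` along a
path whose logarithm stays in `A`, so minimality and the Gauss lemma give `g(X, z) ≥ 0`. Letting `z`
tend to `-X` yields `|w|² ≤ 0`, although `w ≠ 0` (`subset_starPart`).

The conjugate point statement rests on a Riccati equation. The second fundamental form of the wave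
fronts is symmetric, because the momentum form is exact by the Gauss lemma, and its derivative is
bounded above. This gives `|J(t)c|² ≤ exp (L (t - s)) |J(s)c|²` for the differential `J` of the
geodesic family, with `L` uniform over nearby geodesics without conjugate points. In the limit, a
Jacobi field that vanishes at the first conjugate time vanishes afterwards, hence also before that
time by uniqueness, which is absurd. -/

/-- Mixed partial derivatives: if `h = ∂ₜ f` is strictly differentiable, then
`∂ₜ (D_v f) = D_v h`. -/
theorem hasDerivAt_fderiv_of_hasDerivAt {V F : Type*} [NormedAddCommGroup V] [NormedSpace ℝ V]
    [NormedAddCommGroup F] [NormedSpace ℝ F] {f h : V × ℝ → F} {v₀ : V} {t₀ : ℝ}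
    (hf : ∀ᶠ z in 𝓝 (v₀, t₀), DifferentiableAt ℝ f z)
    (hfh : ∀ᶠ z in 𝓝 (v₀, t₀), HasDerivAt (fun s => f (z.1, s)) (h z) z.2)
    {H : V × ℝ →L[ℝ] F} (hh : HasStrictFDerivAt h H (v₀, t₀)) :
    HasDerivAt (fun t => fderiv ℝ (fun v => f (v, t)) v₀)
      (H.comp (ContinuousLinearMap.inl ℝ V ℝ)) t₀ := by
  rw [hasDerivAt_iff_isLittleO, Asymptotics.isLittleO_iff]
  intro ε hε
  have h1 := hh.isLittleO.def hε
  rw [nhds_prod_eq] at h1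
  have h2 : ∀ᶠ q : (V × ℝ) × (V × ℝ) in 𝓝 (v₀, t₀) ×ˢ 𝓝 (v₀, t₀),
      ‖h q.1 - h q.2 - H (q.1 - q.2)‖ ≤ ε * ‖q.1 - q.2‖ := h1
  obtain ⟨p, hp, q, hq, hpq⟩ := Filter.eventually_prod_iff.1 h2
  obtain ⟨δ, hδ, hball⟩ := Metric.eventually_nhds_iff_ball.1 ((hp.and hq).and (hf.and hfh))
  have hB : ∀ v ∈ Metric.ball v₀ δ, ∀ s ∈ Metric.ball t₀ δ, (v, s) ∈ Metric.ball (v₀, t₀) δ := by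
    intro v hv s hs
    rw [← ball_prod_same]; exact ⟨hv, hs⟩
  filter_upwards [Metric.ball_mem_nhds t₀ hδ] with t ht
  have ht0 : t₀ ∈ Metric.ball t₀ δ := Metric.mem_ball_self hδ
  have hv0 : v₀ ∈ Metric.ball v₀ δ := Metric.mem_ball_self hδ
  have hd : ∀ s ∈ Metric.ball t₀ δ, DifferentiableAt ℝ (fun v => f (v, s)) v₀ := by
    intro s hs
    have := (hball _ (hB v₀ hv0 s hs)).2.1
    exact this.comp v₀ (f := fun v => (v, s)) (differentiableAt_id.prodMk (differentiableAt_const _))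
  -- The mean value inequality in time makes `φ` Lipschitz with constant `ε |t - t₀|` near `v₀`.
  -- This bounds its derivative at `v₀`, which is exactly the error in the difference quotient. No
  -- second derivative of `f` is needed.
  set φ : V → F := fun v => f (v, t) - f (v, t₀) - (t - t₀) • H (v, 0) with hφ
  have hφd : HasFDerivAt φ (fderiv ℝ (fun v => f (v, t)) v₀ - fderiv ℝ (fun v => f (v, t₀)) v₀
      - (t - t₀) • (H.comp (ContinuousLinearMap.inl ℝ V ℝ))) v₀ := by
    refine ((hd t ht).hasFDerivAt.sub (hd t₀ ht0).hasFDerivAt).sub ?_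
    exact ((H.comp (ContinuousLinearMap.inl ℝ V ℝ)).hasFDerivAt (x := v₀)).const_smul (t - t₀)
  have hLip : LipschitzOnWith (Real.toNNReal (ε * ‖t - t₀‖)) φ (Metric.ball v₀ δ) := by
    refine LipschitzOnWith.of_dist_le_mul fun v hv v' hv' => ?_
    rw [Real.coe_toNNReal _ (by positivity), dist_eq_norm, dist_eq_norm]
    set ψ : ℝ → F := fun s => f (v, s) - f (v', s) - (s - t₀) • H (v - v', 0) with hψ
    have hψd : ∀ s ∈ Metric.ball t₀ δ, HasDerivWithinAt ψ (h (v, s) - h (v', s) - H (v - v', 0))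
        (Metric.ball t₀ δ) s := by
      intro s hs
      have a1 := (hball _ (hB v hv s hs)).2.2
      have a2 := (hball _ (hB v' hv' s hs)).2.2
      have a3 : HasDerivAt (fun s => (s - t₀) • H (v - v', 0)) ((1 : ℝ) • H (v - v', 0)) s :=
        ((hasDerivAt_id s).sub_const t₀).smul_const _
      rw [one_smul] at a3
      exact ((a1.sub a2).sub a3).hasDerivWithinAt
    have hbd : ∀ s ∈ Metric.ball t₀ δ, ‖h (v, s) - h (v', s) - H (v - v', 0)‖ ≤ ε * ‖v - v'‖ := by
      intro s hs
      have := hpq (hball _ (hB v hv s hs)).1.1 (hball _ (hB v' hv' s hs)).1.2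
      simpa [Prod.norm_def] using this
    have := Convex.norm_image_sub_le_of_norm_hasDerivWithin_le hψd hbd (convex_ball t₀ δ) ht0 ht
    have e : φ v - φ v' = ψ t - ψ t₀ := by
      have : H (v - v', 0) = H (v, 0) - H (v', 0) := by
        rw [← map_sub]; simp
      simp only [hφ, hψ, this, smul_sub, sub_self, zero_smul]
      abel
    rw [e]
    calc _ ≤ _ := this
      _ = _ := by ring
  have := hφd.le_of_lipschitzOn (Metric.ball_mem_nhds v₀ hδ) hLip
  rwa [Real.coe_toNNReal _ (by positivity)] at this

/-- A second order Taylor estimate on a convex set where the derivative is Lipschitz. -/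
theorem norm_sub_sub_le_of_lipschitz_fderiv {V F : Type*} [NormedAddCommGroup V] [NormedSpace ℝ V]
    [NormedAddCommGroup F] [NormedSpace ℝ F] {f : V → F} {s : Set V} (hs : Convex ℝ s)
    (hf : ∀ x ∈ s, DifferentiableAt ℝ f x) {K : NNReal} (hK : LipschitzOnWith K (fderiv ℝ f) s)
    {x y : V} (hx : x ∈ s) (hy : y ∈ s) :
    ‖f y - f x - fderiv ℝ f x (y - x)‖ ≤ K * ‖y - x‖ ^ 2 := by
  have hseg := hs.segment_subset hx hy
  have := Convex.norm_image_sub_le_of_norm_hasFDerivWithin_le' (f := f) (s := segment ℝ x y)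
    (f' := fderiv ℝ f) (φ := fderiv ℝ f x) (C := K * ‖y - x‖)
    (fun z hz => (hf z (hseg hz)).hasFDerivAt.hasFDerivWithinAt)
    (fun z hz => by
      have h1 := hK.norm_sub_le (hseg hz) hx
      refine h1.trans ?_
      gcongr
      exact norm_sub_le_of_mem_segment hz)
    (convex_segment x y) (left_mem_segment ℝ x y) (right_mem_segment ℝ x y)
  calc _ ≤ _ := this
    _ = _ := by ring

/-- A two-sided Grönwall estimate for functions vanishing at `0`. -/
theorem norm_le_mul_of_norm_deriv_le {F : Type*} [NormedAddCommGroup F] [NormedSpace ℝ F]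
    {e e' : ℝ → F} {K c δ : ℝ} (hK : 0 < K) (hc : 0 ≤ c)
    (he : ∀ t ∈ Ioo (-δ) δ, HasDerivAt e (e' t) t) (h0 : e 0 = 0)
    (hb : ∀ t ∈ Ioo (-δ) δ, ‖e' t‖ ≤ K * ‖e t‖ + c) {t : ℝ} (ht : t ∈ Ioo (-δ) δ) :
    ‖e t‖ ≤ c * (K⁻¹ * Real.exp (K * δ)) := by
  have key : ∀ (e e' : ℝ → F), (∀ t ∈ Ioo (-δ) δ, HasDerivAt e (e' t) t) → e 0 = 0 →
      (∀ t ∈ Ioo (-δ) δ, ‖e' t‖ ≤ K * ‖e t‖ + c) → ∀ t, 0 ≤ t → t < δ →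
      ‖e t‖ ≤ c * (K⁻¹ * Real.exp (K * δ)) := by
    intro e e' he h0 hb t ht0 ht
    have hsub : Icc 0 t ⊆ Ioo (-δ) δ := fun s hs => ⟨by linarith [hs.1], by linarith [hs.2]⟩
    have := norm_le_gronwallBound_of_norm_deriv_right_le (f := e) (f' := e') (δ := 0) (K := K)
      (ε := c) (a := 0) (b := t)
      (fun s hs => (he s (hsub hs)).continuousAt.continuousWithinAt)
      (fun s hs => (he s (hsub (Ico_subset_Icc_self hs))).hasDerivWithinAt) (by simp [h0])
      (fun s hs => hb s (hsub (Ico_subset_Icc_self hs))) t ⟨ht0, le_rfl⟩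
    rw [gronwallBound_of_K_ne_0 hK.ne'] at this
    refine this.trans ?_
    have h1 : Real.exp (K * (t - 0)) ≤ Real.exp (K * δ) := by
      apply Real.exp_le_exp.2; nlinarith
    have h2 : 0 ≤ c / K := by positivity
    simp only [zero_mul, zero_add]
    calc c / K * (Real.exp (K * (t - 0)) - 1) ≤ c / K * Real.exp (K * δ) := by
          gcongr; linarith
      _ = _ := by field_simp
  rcases le_total 0 t with h | h
  · exact key e e' he h0 hb t h ht.2
  · have := key (fun s => e (-s)) (fun s => - e' (-s)) (fun s hs => by
        have := (he (-s) ⟨by linarith [hs.2], by linarith [hs.1]⟩).scomp s (hasDerivAt_neg s)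
        simpa [Function.comp_def] using this) (by simpa using h0)
      (fun s hs => by
        simpa using hb (-s) ⟨by linarith [hs.2], by linarith [hs.1]⟩) (-t) (by linarith)
        (by linarith [ht.1])
    simpa using this

/-- A `C²` vector field has a `C¹` local flow. -/
theorem exists_contDiffAt_flow {W : Type*} [NormedAddCommGroup W] [NormedSpace ℝ W]
    [CompleteSpace W] {f : W → W} {z₀ : W} (hf : ContDiffAt ℝ 2 f z₀) {N : Set W}
    (hN : N ∈ 𝓝 z₀) :
    ∃ (Ψ : W × ℝ → W) (δ : ℝ), 0 < δ ∧
      (∀ z ∈ Metric.ball z₀ δ, Ψ (z, 0) = z) ∧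
      (∀ z ∈ Metric.ball z₀ δ, ∀ t ∈ Ioo (-δ) δ, Ψ (z, t) ∈ N ∧
        HasDerivAt (fun s => Ψ (z, s)) (f (Ψ (z, t))) t ∧ ContDiffAt ℝ 1 Ψ (z, t)) := by
  have hf' : ContDiffAt ℝ 1 (fderiv ℝ f) z₀ := hf.fderiv_right (by norm_num)
  -- The field is coupled with its variational equation. The coupled field is `C¹` because `f` is
  -- `C²`, so Picard–Lindelöf yields the flow and a candidate for its derivative together.
  set g : W × (W →L[ℝ] W) → W × (W →L[ℝ] W) := fun q => (f q.1, (fderiv ℝ f q.1).comp q.2) with hg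
  have hgd : ContDiffAt ℝ 1 g (z₀, ContinuousLinearMap.id ℝ W) := by
    refine ContDiffAt.prodMk ?_ ?_
    · exact (hf.of_le (by norm_num)).comp (z₀, ContinuousLinearMap.id ℝ W) contDiffAt_fst
    · exact ContDiffAt.clm_comp
        (hf'.comp (z₀, ContinuousLinearMap.id ℝ W) contDiffAt_fst) contDiffAt_snd
  obtain ⟨ε, hε, a, r, L, K, hr, hpl⟩ := IsPicardLindelof.of_contDiffAt_one hgd
  obtain ⟨α, hα, L', hL'⟩ :=
    (hpl 0).exists_forall_mem_closedBall_eq_hasDerivWithinAt_lipschitzOnWith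
  simp only [zero_sub, zero_add] at hα hL'
  set c₀ : W × (W →L[ℝ] W) := (z₀, ContinuousLinearMap.id ℝ W)
  have hcont : ContinuousOn (Function.uncurry α) (Metric.closedBall c₀ r ×ˢ Icc (-ε) ε) := by
    refine continuousOn_prod_of_continuousOn_lipschitzOnWith _ L' ?_ hL'
    exact fun x hx => HasDerivWithinAt.continuousOn (hα x hx).2
  obtain ⟨M, s₁, hs₁, hM⟩ := hf'.exists_lipschitzOnWith
  have hK1 : ∀ᶠ z in 𝓝 z₀, ‖fderiv ℝ f z‖ < ‖fderiv ℝ f z₀‖ + 1 :=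
    hf'.continuousAt.norm.eventually (gt_mem_nhds (lt_add_one _))
  obtain ⟨ρ, hρ, hρs⟩ := Metric.mem_nhds_iff.1 (inter_mem (inter_mem hs₁ hN) (inter_mem hK1
    (((hf.of_le (by norm_num : (1 : WithTop ℕ∞) ≤ 2)).eventually (by simp)))))
  have hc₀ : ContinuousAt (Function.uncurry α) (c₀, 0) :=
    hcont.continuousAt (prod_mem_nhds (Metric.closedBall_mem_nhds _ hr)
      (Icc_mem_nhds (by linarith) hε))
  have hval : Function.uncurry α (c₀, 0) = c₀ := (hα c₀ (Metric.mem_closedBall_self r.2)).1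
  have hpre : ∀ᶠ q in 𝓝 (c₀, (0 : ℝ)), (Function.uncurry α q).1 ∈ Metric.ball z₀ ρ := by
    have : ContinuousAt (fun q => (Function.uncurry α q).1) (c₀, 0) := continuousAt_fst.comp hc₀
    refine this.eventually (Metric.isOpen_ball.mem_nhds ?_)
    change (Function.uncurry α (c₀, 0)).1 ∈ _
    rw [hval]; exact Metric.mem_ball_self hρ
  obtain ⟨δ₁, hδ₁, hδ₁s⟩ := Metric.eventually_nhds_iff_ball.1 hpre
  have hC1 : ∀ x ∈ Metric.ball z₀ ρ, ContDiffAt ℝ 1 f x := fun x hx => (hρs hx).2.2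
  set δ : ℝ := min δ₁ (min r ε)
  have hδ : 0 < δ := lt_min hδ₁ (lt_min hr hε)
  have hδr : δ ≤ r := (min_le_right _ _).trans (min_le_left _ _)
  have hδε : δ ≤ ε := (min_le_right _ _).trans (min_le_right _ _)
  set ι : W → W × (W →L[ℝ] W) := fun z => (z, ContinuousLinearMap.id ℝ W) with hι
  have hιd : ∀ z, dist (ι z) c₀ = dist z z₀ := by
    intro z; simp [hι, c₀, Prod.dist_eq]
  have hιm : ∀ z ∈ Metric.ball z₀ δ, ι z ∈ Metric.closedBall c₀ r := by
    intro z hz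
    rw [Metric.mem_closedBall, hιd]; exact (Metric.mem_ball.1 hz).le.trans hδr
  set Ψ : W × ℝ → W := fun q => (α (ι q.1) q.2).1 with hΨ
  set A : W × ℝ → (W →L[ℝ] W) := fun q => (α (ι q.1) q.2).2 with hA
  have hder : ∀ z ∈ Metric.ball z₀ δ, ∀ t ∈ Ioo (-δ) δ,
      HasDerivAt (α (ι z)) (g (α (ι z) t)) t := by
    intro z hz t ht
    exact ((hα _ (hιm z hz)).2 t ⟨by linarith [ht.1], by linarith [ht.2]⟩).hasDerivAt
      (Icc_mem_nhds (by linarith [ht.1]) (by linarith [ht.2]))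
  have hΨd : ∀ z ∈ Metric.ball z₀ δ, ∀ t ∈ Ioo (-δ) δ,
      HasDerivAt (fun s => Ψ (z, s)) (f (Ψ (z, t))) t := fun z hz t ht =>
    (hder z hz t ht).fst
  have hAd : ∀ z ∈ Metric.ball z₀ δ, ∀ t ∈ Ioo (-δ) δ,
      HasDerivAt (fun s => A (z, s)) ((fderiv ℝ f (Ψ (z, t))).comp (A (z, t))) t :=
    fun z hz t ht => (hder z hz t ht).snd
  have hmem : ∀ z ∈ Metric.ball z₀ δ, ∀ t ∈ Ioo (-δ) δ, Ψ (z, t) ∈ Metric.ball z₀ ρ := by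
    intro z hz t ht
    refine hδ₁s (ι z, t) ?_
    rw [← ball_prod_same]
    refine ⟨?_, ?_⟩
    · rw [Metric.mem_ball, hιd]; exact (Metric.mem_ball.1 hz).trans_le (min_le_left _ _)
    · rw [Metric.mem_ball, Real.dist_eq, sub_zero]
      exact (abs_lt.2 ht).trans_le (min_le_left _ _)
  have hΨ0 : ∀ z ∈ Metric.ball z₀ δ, α (ι z) 0 = ι z := fun z hz => (hα _ (hιm z hz)).1
  set Kc : ℝ := ‖fderiv ℝ f z₀‖ + 1
  have hKc : 0 < Kc := by positivity
  -- the derivative in the initial point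
  have hΨz : ∀ z ∈ Metric.ball z₀ δ, ∀ t ∈ Ioo (-δ) δ,
      HasFDerivAt (fun z' => Ψ (z', t)) (A (z, t)) z := by
    intro z hz t ht
    -- The candidate `A` is the derivative because the error solves the linearized equation up to a
    -- second order Taylor remainder; Grönwall then makes the error quadratic in `z' - z`.
    have hO : (fun z' => Ψ (z', t) - Ψ (z, t) - A (z, t) (z' - z)) =O[𝓝 z]
        fun z' => ‖z' - z‖ ^ 2 := by
      refine Asymptotics.IsBigO.of_bound (M * L' ^ 2 * (Kc⁻¹ * Real.exp (Kc * δ))) ?_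
      filter_upwards [Metric.isOpen_ball.mem_nhds hz] with z' hz'
      have := norm_le_mul_of_norm_deriv_le (δ := δ) (K := Kc) (c := M * (L' * ‖z' - z‖) ^ 2)
        (e := fun s => Ψ (z', s) - Ψ (z, s) - A (z, s) (z' - z))
        (e' := fun s => f (Ψ (z', s)) - f (Ψ (z, s)) -
          (fderiv ℝ f (Ψ (z, s))) (A (z, s) (z' - z))) hKc (by positivity)
        (fun s hs => ((hΨd z' hz' s hs).sub (hΨd z hz s hs)).sub
          ((hAd z hz s hs).clm_apply (hasDerivAt_const s (z' - z)) |>.congr_deriv (by simp)))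
        (by
          change (α (ι z') 0).1 - (α (ι z) 0).1 - (α (ι z) 0).2 (z' - z) = 0
          rw [hΨ0 z hz, hΨ0 z' hz']; simp [hι])
        (fun s hs => ?_) ht
      · rw [norm_pow, norm_norm]
        calc _ ≤ _ := this
          _ = _ := by ring
      · have hT := norm_sub_sub_le_of_lipschitz_fderiv (convex_ball z₀ ρ)
          (fun x hx => (hC1 x hx).differentiableAt (by simp))
          (hM.mono fun x hx => (hρs hx).1.1) (hmem z hz s hs) (hmem z' hz' s hs)
        have hLi : ‖Ψ (z', s) - Ψ (z, s)‖ ≤ L' * ‖z' - z‖ := by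
          have h1 := (hL' s ⟨by linarith [hs.1], by linarith [hs.2]⟩).norm_sub_le
            (hιm z' hz') (hιm z hz)
          have h2 : ‖ι z' - ι z‖ = ‖z' - z‖ := by simp [hι, Prod.norm_def]
          rw [h2] at h1
          exact (norm_fst_le _).trans h1
        have hdec : f (Ψ (z', s)) - f (Ψ (z, s)) - (fderiv ℝ f (Ψ (z, s))) (A (z, s) (z' - z))
            = (fderiv ℝ f (Ψ (z, s))) (Ψ (z', s) - Ψ (z, s) - A (z, s) (z' - z)) +
              (f (Ψ (z', s)) - f (Ψ (z, s)) - (fderiv ℝ f (Ψ (z, s))) (Ψ (z', s) - Ψ (z, s))) := by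
          rw [map_sub (fderiv ℝ f (Ψ (z, s))) _ (A (z, s) (z' - z))]; abel
        rw [hdec]
        refine (norm_add_le _ _).trans (add_le_add ?_ (hT.trans (by gcongr)))
        refine (ContinuousLinearMap.le_opNorm _ _).trans ?_
        gcongr
        exact (hρs (hmem z hz s hs)).2.1.le
    have h0 := hO.hasFDerivAt (𝕜 := ℝ) (by norm_num)
    have h1 := (h0.add ((A (z, t)).hasFDerivAt (x := z))).add_const (Ψ (z, t) - A (z, t) z)
    refine (h1.congr_fderiv (by simp)).congr_of_eventuallyEq (Eventually.of_forall fun z' => ?_)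
    simp only [map_sub, Pi.add_apply]; abel
  have hAcont : ∀ z ∈ Metric.ball z₀ δ, ∀ t ∈ Ioo (-δ) δ,
      ContinuousAt (fun q : W × ℝ => α (ι q.1) q.2) (z, t) := by
    intro z hz t ht
    have hz2 : ι z ∈ Metric.ball c₀ r := by
      rw [Metric.mem_ball, hιd]; exact (Metric.mem_ball.1 hz).trans_le hδr
    have : ContinuousAt (Function.uncurry α) (ι z, t) :=
      hcont.continuousAt (prod_mem_nhds (mem_of_superset (Metric.isOpen_ball.mem_nhds hz2)
        Metric.ball_subset_closedBall)
        (Icc_mem_nhds (by linarith [ht.1]) (by linarith [ht.2])))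
    refine ContinuousAt.comp (f := fun q : W × ℝ => (ι q.1, q.2)) (g := Function.uncurry α) this ?_
    exact (Continuous.prodMk (by fun_prop) continuous_snd).continuousAt
  refine ⟨Ψ, δ, hδ, fun z hz => congrArg Prod.fst (hΨ0 z hz), fun z hz t ht =>
    ⟨(hρs (hmem z hz t ht)).1.2, hΨd z hz t ht, ?_⟩⟩
  have hopen : Metric.ball z₀ δ ×ˢ Ioo (-δ) δ ∈ 𝓝 (z, t) :=
    prod_mem_nhds (Metric.isOpen_ball.mem_nhds hz) (isOpen_Ioo.mem_nhds ht)
  have hfd : ∀ q ∈ Metric.ball z₀ δ ×ˢ Ioo (-δ) δ, HasFDerivAt Ψ ((A q).coprod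
      (ContinuousLinearMap.toSpanSingleton ℝ (f (Ψ q)))) q := by
    rintro ⟨z, t⟩ ⟨hz, ht⟩
    have hop : Metric.ball z₀ δ ×ˢ Ioo (-δ) δ ∈ 𝓝 (z, t) :=
      prod_mem_nhds (Metric.isOpen_ball.mem_nhds hz) (isOpen_Ioo.mem_nhds ht)
    -- Two continuous partial derivatives give the total derivative.
    have := hasStrictFDerivAt_uncurry_coprod (u := (z, t)) (f := fun z t => Ψ (z, t))
      (f₁ := fun z t => A (z, t))
      (f₂ := fun z t => ContinuousLinearMap.toSpanSingleton ℝ (f (Ψ (z, t))))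
      (by filter_upwards [hop] with q hq using hΨz q.1 hq.1 q.2 hq.2)
      (by filter_upwards [hop] with q hq using (hΨd q.1 hq.1 q.2 hq.2).hasFDerivAt)
      (continuousAt_snd.comp (hAcont z hz t ht)) ?_
    · exact this.hasFDerivAt
    · have h1 : ContinuousAt f (Ψ (z, t)) := (hC1 _ (hmem z hz t ht)).continuousAt
      have h2 : ContinuousAt (fun q => f (Ψ q)) (z, t) :=
        ContinuousAt.comp (f := Ψ) h1 (continuousAt_fst.comp (hAcont z hz t ht))
      exact ((ContinuousLinearMap.toSpanSingletonCLE (𝕜 := ℝ) (E := W)).continuous.continuousAt).comp h2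
  refine contDiffAt_one_iff.2 ⟨_, _, hopen, ?_, hfd⟩
  rintro ⟨z, t⟩ ⟨hz, ht⟩
  have h1 : ContinuousAt f (Ψ (z, t)) := (hC1 _ (hmem z hz t ht)).continuousAt
  have h2 : ContinuousAt (fun q => f (Ψ q)) (z, t) :=
    ContinuousAt.comp (f := Ψ) h1 (continuousAt_fst.comp (hAcont z hz t ht))
  have h3 : ContinuousAt (fun q => ContinuousLinearMap.toSpanSingleton ℝ (f (Ψ q))) (z, t) :=
    ((ContinuousLinearMap.toSpanSingletonCLE (𝕜 := ℝ) (E := W)).continuous.continuousAt).comp h2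
  have h4 : ContinuousAt A (z, t) := continuousAt_snd.comp (hAcont z hz t ht)
  refine ContinuousAt.continuousWithinAt ?_
  exact (ContinuousLinearMap.coprodEquivL (S := ℝ) (𝕜 := ℝ) (E := W) (F := ℝ)
    (G := W)).continuous.continuousAt.comp (f := fun q => (A q,
      ContinuousLinearMap.toSpanSingleton ℝ (f (Ψ q)))) (h4.prodMk h3)

/-- Local uniqueness for autonomous differential equations. -/
theorem eventuallyEq_of_hasDerivAt {W : Type*} [NormedAddCommGroup W] [NormedSpace ℝ W] {f : W → W}
    {Z₁ Z₂ : ℝ → W} {t : ℝ} (hf : ContDiffAt ℝ 1 f (Z₁ t))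
    (h₁ : ∀ᶠ s in 𝓝 t, HasDerivAt Z₁ (f (Z₁ s)) s) (h₂ : ∀ᶠ s in 𝓝 t, HasDerivAt Z₂ (f (Z₂ s)) s)
    (h : Z₁ t = Z₂ t) : Z₁ =ᶠ[𝓝 t] Z₂ := by
  obtain ⟨K, U, hU, hK⟩ := hf.exists_lipschitzOnWith
  refine ODE_solution_unique_of_eventually (v := fun _ => f) (s := fun _ => U)
    (Eventually.of_forall fun _ => hK) ?_ ?_ h
  · exact h₁.and (h₁.self_of_nhds.continuousAt.eventually hU)
  · exact h₂.and (h₂.self_of_nhds.continuousAt.eventually (h ▸ hU))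

end Starshaped

end

/-! ### Riemannian metrics on open subsets of a vector space. -/

noncomputable section

namespace Starshaped

section Instances

variable {E : Type*} [NormedAddCommGroup E] [NormedSpace ℝ E]

/-- A shortcut for instance search. -/
scoped instance normedAddCommGroupDual : NormedAddCommGroup (E →L[ℝ] ℝ) := inferInstance

/-- A shortcut for instance search. -/
scoped instance normedSpaceDual : NormedSpace ℝ (E →L[ℝ] ℝ) := inferInstance

/-- A shortcut for instance search. -/
scoped instance normedAddCommGroupForm : NormedAddCommGroup (E →L[ℝ] E →L[ℝ] ℝ) := inferInstance

/-- A shortcut for instance search. -/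
scoped instance normedSpaceForm : NormedSpace ℝ (E →L[ℝ] E →L[ℝ] ℝ) := inferInstance

/-- A shortcut for instance search. -/
scoped instance normedAddCommGroupFormDeriv : NormedAddCommGroup (E →L[ℝ] E →L[ℝ] E →L[ℝ] ℝ) := inferInstance

/-- A shortcut for instance search. -/
scoped instance normedSpaceFormDeriv : NormedSpace ℝ (E →L[ℝ] E →L[ℝ] E →L[ℝ] ℝ) := inferInstance

end Instances

section LocalMetric

variable {E : Type*} [NormedAddCommGroup E] [NormedSpace ℝ E]

/-- `G` is a smooth Riemannian metric on the open subset `V` of a vector space. -/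
structure IsLocalMetric (V : Set E) (G : E → E →L[ℝ] E →L[ℝ] ℝ) : Prop where
  isOpen : IsOpen V
  contDiffOn : ContDiffOn ℝ ∞ G V
  symm : ∀ y ∈ V, ∀ u w, G y u w = G y w u
  pos : ∀ y ∈ V, ∀ u, u ≠ 0 → 0 < G y u u

/-- The covector `w ↦ D_w G (ξ, ξ) / 2`. -/
def forceForm (G : E → E →L[ℝ] E →L[ℝ] ℝ) (x ξ : E) : E →L[ℝ] ℝ :=
  (1 / 2 : ℝ) • ((fderiv ℝ G x).flip ξ).flip ξ

/-- The covector `w ↦ Γ(ξ, ξ, w)`. -/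
def sprayForm (G : E → E →L[ℝ] E →L[ℝ] ℝ) (x ξ : E) : E →L[ℝ] ℝ :=
  fderiv ℝ G x ξ ξ - forceForm G x ξ

/-- The acceleration of the geodesic through `x` with velocity `ξ`. -/
def spray (G : E → E →L[ℝ] E →L[ℝ] ℝ) (x ξ : E) : E :=
  (G x).inverse (-sprayForm G x ξ)

theorem forceForm_apply (G : E → E →L[ℝ] E →L[ℝ] ℝ) (x ξ w : E) :
    forceForm G x ξ w = fderiv ℝ G x w ξ ξ / 2 := by
  simp [forceForm]; ring

theorem sprayForm_apply (G : E → E →L[ℝ] E →L[ℝ] ℝ) (x ξ w : E) :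
    sprayForm G x ξ w = fderiv ℝ G x ξ ξ w - fderiv ℝ G x w ξ ξ / 2 := by
  simp [sprayForm, forceForm_apply]

theorem contDiffOn_form [FiniteDimensional ℝ E] {B : E → E →L[ℝ] E →L[ℝ] ℝ} {V : Set E}
    (h : ∀ u w, ContDiffOn ℝ ∞ (fun y => B y u w) V) : ContDiffOn ℝ ∞ B V := by
  rw [contDiffOn_clm_apply]
  intro u
  rw [contDiffOn_clm_apply]
  exact h u

namespace IsLocalMetric

variable {V : Set E} {G : E → E →L[ℝ] E →L[ℝ] ℝ} (hG : IsLocalMetric V G)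
include hG

theorem contDiffAt {y : E} (hy : y ∈ V) : ContDiffAt ℝ ∞ G y :=
  hG.contDiffOn.contDiffAt (hG.isOpen.mem_nhds hy)

theorem contDiffAt_fderiv {y : E} (hy : y ∈ V) : ContDiffAt ℝ ∞ (fderiv ℝ G) y :=
  (hG.contDiffAt hy).fderiv_right (by simp)

theorem differentiableAt {y : E} (hy : y ∈ V) : DifferentiableAt ℝ G y :=
  (hG.contDiffAt hy).differentiableAt (by simp)

theorem nonneg {y : E} (hy : y ∈ V) (u : E) : 0 ≤ G y u u := by
  by_cases h : u = 0
  · simp [h]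
  · exact (hG.pos y hy u h).le

theorem eq_zero {y : E} (hy : y ∈ V) {u : E} (h : ∀ w, G y u w = 0) : u = 0 := by
  by_contra hu
  exact (hG.pos y hy u hu).ne' (h u)

/-- The derivative of the metric is symmetric. -/
theorem fderiv_symm {y : E} (hy : y ∈ V) (a u w : E) :
    fderiv ℝ G y a u w = fderiv ℝ G y a w u := by
  have h1 : HasFDerivAt (fun z => G z u w) (((fderiv ℝ G y).flip u).flip w) y := by
    have := ((hG.differentiableAt hy).hasFDerivAt.clm_apply (hasFDerivAt_const u y)).clm_apply
      (hasFDerivAt_const w y)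
    refine this.congr_fderiv ?_
    ext; simp
  have h2 : HasFDerivAt (fun z => G z w u) (((fderiv ℝ G y).flip w).flip u) y := by
    have := ((hG.differentiableAt hy).hasFDerivAt.clm_apply (hasFDerivAt_const w y)).clm_apply
      (hasFDerivAt_const u y)
    refine this.congr_fderiv ?_
    ext; simp
  have h3 : (fun z => G z u w) =ᶠ[𝓝 y] fun z => G z w u := by
    filter_upwards [hG.isOpen.mem_nhds hy] with z hz using hG.symm z hz u w
  have := (h1.congr_of_eventuallyEq h3.symm).unique h2
  simpa using DFunLike.congr_fun this a

theorem contDiffAt_forceForm {z : E × E} (hz : z.1 ∈ V) :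
    ContDiffAt ℝ ∞ (fun q : E × E => forceForm G q.1 q.2) z := by
  have h : ContDiffAt ℝ ∞ (fun q : E × E => fderiv ℝ G q.1) z :=
    (hG.contDiffAt_fderiv hz).comp z contDiffAt_fst
  have h1 : ContDiffAt ℝ ∞ (fun q : E × E => (fderiv ℝ G q.1).flip q.2) z :=
    ((ContinuousLinearMap.flipₗᵢ ℝ E E (E →L[ℝ] ℝ)).toContinuousLinearEquiv.contDiff.contDiffAt.comp
      z h).clm_apply contDiffAt_snd
  exact (((ContinuousLinearMap.flipₗᵢ ℝ E E ℝ).toContinuousLinearEquiv.contDiff.contDiffAt.comp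
      z h1).clm_apply contDiffAt_snd).const_smul _

theorem contDiffAt_sprayForm {z : E × E} (hz : z.1 ∈ V) :
    ContDiffAt ℝ ∞ (fun q : E × E => sprayForm G q.1 q.2) z := by
  have h : ContDiffAt ℝ ∞ (fun q : E × E => fderiv ℝ G q.1) z :=
    (hG.contDiffAt_fderiv hz).comp z contDiffAt_fst
  exact ((h.clm_apply contDiffAt_snd).clm_apply contDiffAt_snd).sub (hG.contDiffAt_forceForm hz)

variable [FiniteDimensional ℝ E]

theorem isInvertible {y : E} (hy : y ∈ V) : (G y).IsInvertible := by
  have hinj : Function.Injective (G y) := by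
    rw [injective_iff_map_eq_zero]
    intro u hu
    exact hG.eq_zero hy fun w => by rw [hu]; rfl
  have hfr : Module.finrank ℝ E = Module.finrank ℝ (E →L[ℝ] ℝ) := by
    have h1 : Module.finrank ℝ (E →L[ℝ] ℝ) = Module.finrank ℝ (E →ₗ[ℝ] ℝ) :=
      (LinearMap.toContinuousLinearMap (𝕜 := ℝ) (E := E) (F' := ℝ)).finrank_eq.symm
    rw [h1, Module.finrank_linearMap]; simp
  let e := (LinearEquiv.ofInjectiveOfFinrankEq (G y : E →ₗ[ℝ] (E →L[ℝ] ℝ)) hinj hfr).toContinuousLinearEquiv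
  exact ⟨e, by ext; rfl⟩

theorem spray_spec {x : E} (hx : x ∈ V) (ξ w : E) :
    G x (spray G x ξ) w = -sprayForm G x ξ w := by
  rw [spray, (hG.isInvertible hx).self_apply_inverse]; rfl

theorem eq_spray {x : E} (hx : x ∈ V) {ξ a : E} (h : ∀ w, G x a w = -sprayForm G x ξ w) :
    a = spray G x ξ := by
  have : a - spray G x ξ = 0 := hG.eq_zero hx fun w => by
    simp [h, hG.spray_spec hx]
  exact sub_eq_zero.1 this

theorem contDiffAt_spray {z : E × E} (hz : z.1 ∈ V) :
    ContDiffAt ℝ ∞ (fun q : E × E => spray G q.1 q.2) z := by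
  have h1 : ContDiffAt ℝ ∞ (fun q : E × E => (G q.1).inverse) z := by
    have := (hG.isInvertible hz).contDiffAt_map_inverse (n := ∞)
    exact this.comp z ((hG.contDiffAt hz).comp z contDiffAt_fst)
  exact h1.clm_apply (hG.contDiffAt_sprayForm hz).neg

theorem contDiffAt_field {z : E × E} (hz : z.1 ∈ V) :
    ContDiffAt ℝ ∞ (fun q : E × E => (q.2, spray G q.1 q.2)) z :=
  contDiffAt_snd.prodMk (hG.contDiffAt_spray hz)

/-- The metric dominates a multiple of the norm, locally uniformly. -/
theorem eventually_le {y : E} (hy : y ∈ V) :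
    ∃ κ > 0, ∀ᶠ z in 𝓝 y, ∀ u, κ * ‖u‖ ^ 2 ≤ G z u u := by
  -- Compactness of the unit sphere gives a positive lower bound at `y`; half of it survives a small
  -- perturbation of the form.
  have hS : IsCompact (Metric.sphere (0 : E) 1) := isCompact_sphere 0 1
  rcases (Metric.sphere (0 : E) 1).eq_empty_or_nonempty with he | hne
  · refine ⟨1, one_pos, Eventually.of_forall fun z u => ?_⟩
    have : u = 0 := by
      by_contra hu
      have : ‖u‖⁻¹ • u ∈ Metric.sphere (0 : E) 1 := by
        simp [norm_smul, hu]
      rw [he] at this; exact this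
    simp [this]
  have hc : Continuous fun u => G y u u := by fun_prop
  obtain ⟨u₀, hu₀, hmin⟩ := hS.exists_isMinOn hne hc.continuousOn
  have hu0 : u₀ ≠ 0 := by
    rintro rfl; simp at hu₀
  set κ := G y u₀ u₀ with hκ
  have hκ0 : 0 < κ := hG.pos y hy u₀ hu0
  have hmin' : ∀ u, κ * ‖u‖ ^ 2 ≤ G y u u := by
    intro u
    by_cases hu : u = 0
    · simp [hu]
    have h1 : ‖u‖⁻¹ • u ∈ Metric.sphere (0 : E) 1 := by simp [norm_smul, hu]
    have h2 : κ ≤ G y (‖u‖⁻¹ • u) (‖u‖⁻¹ • u) := hmin h1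
    have h3 : G y (‖u‖⁻¹ • u) (‖u‖⁻¹ • u) = (‖u‖ ^ 2)⁻¹ * G y u u := by
      simp; ring
    rw [h3] at h2
    have h4 : 0 < ‖u‖ ^ 2 := by positivity
    rw [← div_eq_inv_mul, le_div_iff₀ h4] at h2
    exact h2
  refine ⟨κ / 2, by positivity, ?_⟩
  have hcont : ∀ᶠ z in 𝓝 y, ‖G z - G y‖ < κ / 2 := by
    have := (hG.differentiableAt hy).continuousAt
    have h2 := this.eventually (Metric.ball_mem_nhds (G y) (half_pos hκ0))
    filter_upwards [h2] with z hz
    rwa [dist_eq_norm] at hz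
  filter_upwards [hcont] with z hz u
  have h1 : |(G z - G y) u u| ≤ κ / 2 * ‖u‖ ^ 2 := by
    calc |(G z - G y) u u| ≤ ‖G z - G y‖ * ‖u‖ * ‖u‖ := (G z - G y).le_opNorm₂ u u
      _ ≤ κ / 2 * ‖u‖ * ‖u‖ := by gcongr
      _ = _ := by ring
  have h2 := hmin' u
  have h3 : (G z - G y) u u = G z u u - G y u u := by simp
  rw [h3] at h1
  have := (abs_le.1 h1).1
  nlinarith

end IsLocalMetric

/-! ### Families of geodesics: energy, momentum and linearization. -/

/-- Near `z₀ = (v₀, t₀)`, the curves `t ↦ X (v, t)` form a `C¹` family of geodesics of `G`, with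
velocities `Ξ (v, t)`. -/
structure IsGeodesicFamilyAt {U : Type*} [NormedAddCommGroup U] [NormedSpace ℝ U] (V : Set E)
    (G : E → E →L[ℝ] E →L[ℝ] ℝ) (X Ξ : U × ℝ → E) (z₀ : U × ℝ) : Prop where
  mem : X z₀ ∈ V
  contDiffAt : ContDiffAt ℝ 1 X z₀
  contDiffAt_vel : ContDiffAt ℝ 1 Ξ z₀
  hasDerivAt : ∀ᶠ z in 𝓝 z₀, HasDerivAt (fun s => X (z.1, s)) (Ξ z) z.2
  hasDerivAt_vel : ∀ᶠ z in 𝓝 z₀, HasDerivAt (fun s => Ξ (z.1, s)) (spray G (X z) (Ξ z)) z.2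

namespace IsGeodesicFamilyAt

variable {U : Type*} [NormedAddCommGroup U] [NormedSpace ℝ U] {V : Set E}
  {G : E → E →L[ℝ] E →L[ℝ] ℝ} {X Ξ : U × ℝ → E} {v₀ : U} {t₀ : ℝ}

theorem eventually {z₀ : U × ℝ} (hG : IsLocalMetric V G) (h : IsGeodesicFamilyAt V G X Ξ z₀) :
    ∀ᶠ z in 𝓝 z₀, IsGeodesicFamilyAt V G X Ξ z := by
  filter_upwards [h.contDiffAt.continuousAt.eventually (hG.isOpen.mem_nhds h.mem),
    h.contDiffAt.eventually (by simp), h.contDiffAt_vel.eventually (by simp),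
    h.hasDerivAt.eventually_nhds, h.hasDerivAt_vel.eventually_nhds] with z h1 h2 h3 h4 h5
  exact ⟨h1, h2, h3, h4, h5⟩

/-- The derivative of a function of `(v, t)` in the direction of `v`. -/
theorem hasFDerivAt_left {F : Type*} [NormedAddCommGroup F] [NormedSpace ℝ F] {f : U × ℝ → F}
    {f' : U × ℝ →L[ℝ] F} (hf : HasFDerivAt f f' (v₀, t₀)) :
    HasFDerivAt (fun v => f (v, t₀)) (f'.comp (ContinuousLinearMap.inl ℝ U ℝ)) v₀ :=
  hf.comp v₀ (f := fun v => (v, t₀)) (hasFDerivAt_prodMk_left v₀ t₀)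

/-- Mixed partial derivatives for a function whose time derivative is `C¹`. -/
theorem hasDerivAt_fderiv {F : Type*} [NormedAddCommGroup F] [NormedSpace ℝ F]
    {f h : U × ℝ → F} (hf : ContDiffAt ℝ 1 f (v₀, t₀)) (hh : ContDiffAt ℝ 1 h (v₀, t₀))
    (hfh : ∀ᶠ z in 𝓝 (v₀, t₀), HasDerivAt (fun s => f (z.1, s)) (h z) z.2) :
    HasDerivAt (fun t => fderiv ℝ (fun v => f (v, t)) v₀)
      (fderiv ℝ (fun v => h (v, t₀)) v₀) t₀ := by
  have h1 := hh.hasStrictFDerivAt (by simp)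
  rw [(hasFDerivAt_left h1.hasFDerivAt).fderiv]
  refine hasDerivAt_fderiv_of_hasDerivAt ?_ hfh h1
  exact (hf.eventually (by simp)).mono fun z hz => hz.differentiableAt (by simp)

section

variable (h : IsGeodesicFamilyAt V G X Ξ (v₀, t₀))
include h

theorem hasFDerivAt_pos :
    HasFDerivAt (fun v => X (v, t₀)) (fderiv ℝ (fun v => X (v, t₀)) v₀) v₀ :=
  (hasFDerivAt_left (h.contDiffAt.differentiableAt (by simp)).hasFDerivAt).differentiableAt.hasFDerivAt

theorem hasFDerivAt_vel :
    HasFDerivAt (fun v => Ξ (v, t₀)) (fderiv ℝ (fun v => Ξ (v, t₀)) v₀) v₀ :=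
  (hasFDerivAt_left (h.contDiffAt_vel.differentiableAt
    (by simp)).hasFDerivAt).differentiableAt.hasFDerivAt

/-- `∂ₜ (D_v X) = D_v Ξ`. -/
theorem hasDerivAt_jacobi : HasDerivAt (fun t => fderiv ℝ (fun v => X (v, t)) v₀)
    (fderiv ℝ (fun v => Ξ (v, t₀)) v₀) t₀ :=
  hasDerivAt_fderiv h.contDiffAt h.contDiffAt_vel h.hasDerivAt

theorem hasDerivAt_apply (hG : IsLocalMetric V G) {a b : ℝ → E} {a' b' : E}
    (ha : HasDerivAt a a' t₀) (hb : HasDerivAt b b' t₀) :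
    HasDerivAt (fun t => G (X (v₀, t)) (a t) (b t))
      (fderiv ℝ G (X (v₀, t₀)) (Ξ (v₀, t₀)) (a t₀) (b t₀) + G (X (v₀, t₀)) a' (b t₀)
        + G (X (v₀, t₀)) (a t₀) b') t₀ := by
  have h1 : HasDerivAt (fun t => G (X (v₀, t))) (fderiv ℝ G (X (v₀, t₀)) (Ξ (v₀, t₀))) t₀ :=
    (hG.differentiableAt h.mem).hasFDerivAt.comp_hasDerivAt t₀ h.hasDerivAt.self_of_nhds
  refine ((h1.clm_apply ha).clm_apply hb).congr_deriv ?_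
  simp

theorem hasFDerivAt_apply (hG : IsLocalMetric V G) {α β : U → E} {α' β' : U →L[ℝ] E}
    (hα : HasFDerivAt α α' v₀) (hβ : HasFDerivAt β β' v₀) (a : U) :
    fderiv ℝ (fun v => G (X (v, t₀)) (α v) (β v)) v₀ a =
      fderiv ℝ G (X (v₀, t₀)) (fderiv ℝ (fun v => X (v, t₀)) v₀ a) (α v₀) (β v₀)
        + G (X (v₀, t₀)) (α' a) (β v₀) + G (X (v₀, t₀)) (α v₀) (β' a) := by
  have h1 : HasFDerivAt (fun v => G (X (v, t₀)))
      ((fderiv ℝ G (X (v₀, t₀))).comp (fderiv ℝ (fun v => X (v, t₀)) v₀)) v₀ :=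
    HasFDerivAt.comp (f := fun v => X (v, t₀)) v₀
      (hG.differentiableAt h.mem).hasFDerivAt h.hasFDerivAt_pos
  rw [((h1.clm_apply hα).clm_apply hβ).fderiv]
  simp; ring

variable [FiniteDimensional ℝ E]

/-- Conservation of energy. -/
theorem hasDerivAt_energy (hG : IsLocalMetric V G) :
    HasDerivAt (fun t => G (X (v₀, t)) (Ξ (v₀, t)) (Ξ (v₀, t))) 0 t₀ := by
  have h2 := h.hasDerivAt_vel.self_of_nhds
  refine (h.hasDerivAt_apply hG h2 h2).congr_deriv ?_
  simp only
  -- The geodesic equation turns both acceleration terms into derivatives of the metric that cancel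
  -- the remaining one.
  rw [hG.symm _ h.mem (Ξ (v₀, t₀)), hG.spray_spec h.mem, sprayForm_apply]
  ring

/-- The Euler–Lagrange equation for the momentum `G(Ξ, ·)`. -/
theorem hasDerivAt_momentum (hG : IsLocalMetric V G) :
    HasDerivAt (fun t => G (X (v₀, t)) (Ξ (v₀, t))) (forceForm G (X (v₀, t₀)) (Ξ (v₀, t₀))) t₀ := by
  have h1 : HasDerivAt (fun t => G (X (v₀, t))) (fderiv ℝ G (X (v₀, t₀)) (Ξ (v₀, t₀))) t₀ :=
    (hG.differentiableAt h.mem).hasFDerivAt.comp_hasDerivAt t₀ h.hasDerivAt.self_of_nhds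
  refine (h1.clm_apply h.hasDerivAt_vel.self_of_nhds).congr_deriv ?_
  ext w
  simp only [ContinuousLinearMap.add_apply, forceForm_apply]
  rw [hG.spray_spec h.mem, sprayForm_apply]
  ring

/-- The first variation: the derivative of `G(Ξ, D_v X a)` is the derivative of the energy in the
direction of `a`. -/
theorem hasDerivAt_momentum_jacobi (hG : IsLocalMetric V G) (a : U) :
    HasDerivAt (fun t => G (X (v₀, t)) (Ξ (v₀, t)) (fderiv ℝ (fun v => X (v, t)) v₀ a))
      (fderiv ℝ (fun v => G (X (v, t₀)) (Ξ (v, t₀)) (Ξ (v, t₀))) v₀ a / 2) t₀ := by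
  have h1 : HasDerivAt (fun t => fderiv ℝ (fun v => X (v, t)) v₀ a)
      (fderiv ℝ (fun v => Ξ (v, t₀)) v₀ a) t₀ := by
    simpa using h.hasDerivAt_jacobi.clm_apply (hasDerivAt_const t₀ a)
  refine ((h.hasDerivAt_momentum hG).clm_apply h1).congr_deriv ?_
  rw [h.hasFDerivAt_apply hG h.hasFDerivAt_vel h.hasFDerivAt_vel, forceForm_apply,
    hG.symm _ h.mem (fderiv ℝ (fun v => Ξ (v, t₀)) v₀ a)]
  ring

theorem contDiffAt_momentum (hG : IsLocalMetric V G) :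
    ContDiffAt ℝ 1 (fun z => G (X z) (Ξ z)) (v₀, t₀) :=
  (((hG.contDiffAt h.mem).of_le (by simp)).comp (v₀, t₀) h.contDiffAt).clm_apply h.contDiffAt_vel

theorem contDiffAt_force (hG : IsLocalMetric V G) :
    ContDiffAt ℝ 1 (fun z => forceForm G (X z) (Ξ z)) (v₀, t₀) :=
  ContDiffAt.comp (f := fun z => (X z, Ξ z)) (v₀, t₀)
    ((hG.contDiffAt_forceForm (z := (X (v₀, t₀), Ξ (v₀, t₀))) h.mem).of_le (by simp))
    (h.contDiffAt.prodMk h.contDiffAt_vel)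

/-- The linearized Euler–Lagrange equation. -/
theorem hasDerivAt_fderiv_momentum (hG : IsLocalMetric V G) :
    HasDerivAt (fun t => fderiv ℝ (fun v => G (X (v, t)) (Ξ (v, t))) v₀)
      (fderiv ℝ (fun v => forceForm G (X (v, t₀)) (Ξ (v, t₀))) v₀) t₀ := by
  refine hasDerivAt_fderiv (f := fun z => G (X z) (Ξ z)) (h := fun z => forceForm G (X z) (Ξ z))
    (h.contDiffAt_momentum hG) (h.contDiffAt_force hG) ?_
  filter_upwards [h.eventually hG] with z hz
  exact hz.hasDerivAt_momentum hG

theorem fderiv_momentum_apply (hG : IsLocalMetric V G) (a : U) (w : E) :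
    fderiv ℝ (fun v => G (X (v, t₀)) (Ξ (v, t₀))) v₀ a w =
      fderiv ℝ G (X (v₀, t₀)) (fderiv ℝ (fun v => X (v, t₀)) v₀ a) (Ξ (v₀, t₀)) w
        + G (X (v₀, t₀)) (fderiv ℝ (fun v => Ξ (v, t₀)) v₀ a) w := by
  have h1 : HasFDerivAt (fun v => G (X (v, t₀)))
      ((fderiv ℝ G (X (v₀, t₀))).comp (fderiv ℝ (fun v => X (v, t₀)) v₀)) v₀ :=
    HasFDerivAt.comp (f := fun v => X (v, t₀)) v₀
      (hG.differentiableAt h.mem).hasFDerivAt h.hasFDerivAt_pos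
  rw [(h1.clm_apply h.hasFDerivAt_vel).fderiv]
  simp; ring

/-- Together with `fderiv_momentum_apply`, this expresses the linearized Euler–Lagrange equation
through position and velocity variations; the second derivative of `G` here becomes the source term
of the Riccati equation. -/
theorem fderiv_force_apply (hG : IsLocalMetric V G) (a : U) (w : E) :
    fderiv ℝ (fun v => forceForm G (X (v, t₀)) (Ξ (v, t₀))) v₀ a w =
      fderiv ℝ (fderiv ℝ G) (X (v₀, t₀)) (fderiv ℝ (fun v => X (v, t₀)) v₀ a) w
          (Ξ (v₀, t₀)) (Ξ (v₀, t₀)) / 2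
        + fderiv ℝ G (X (v₀, t₀)) w (Ξ (v₀, t₀)) (fderiv ℝ (fun v => Ξ (v, t₀)) v₀ a) := by
  have h0 : DifferentiableAt ℝ (fun v => forceForm G (X (v, t₀)) (Ξ (v, t₀))) v₀ :=
    (hasFDerivAt_left ((h.contDiffAt_force hG).differentiableAt
      (by simp)).hasFDerivAt).differentiableAt
  have h1 : HasFDerivAt (fun v => fderiv ℝ G (X (v, t₀)))
      ((fderiv ℝ (fderiv ℝ G) (X (v₀, t₀))).comp (fderiv ℝ (fun v => X (v, t₀)) v₀)) v₀ :=
    HasFDerivAt.comp (f := fun v => X (v, t₀)) v₀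
      (((hG.contDiffAt_fderiv h.mem).differentiableAt (by simp))).hasFDerivAt h.hasFDerivAt_pos
  have h2 := ((((h1.clm_apply (hasFDerivAt_const w v₀)).clm_apply h.hasFDerivAt_vel).clm_apply
    h.hasFDerivAt_vel).const_mul (1 / 2 : ℝ)).fderiv
  have h3 : HasFDerivAt (fun v => forceForm G (X (v, t₀)) (Ξ (v, t₀)) w) _ v₀ :=
    (h0.hasFDerivAt.clm_apply (hasFDerivAt_const w v₀))
  have h4 : (fun v => forceForm G (X (v, t₀)) (Ξ (v, t₀)) w) =
      fun v => 1 / 2 * fderiv ℝ G (X (v, t₀)) w (Ξ (v, t₀)) (Ξ (v, t₀)) := by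
    ext v; rw [forceForm_apply]; ring
  rw [h4] at h3
  have h5 := DFunLike.congr_fun (h3.fderiv.symm.trans h2) a
  simp at h5
  rw [h5, hG.fderiv_symm h.mem w (fderiv ℝ (fun v => Ξ (v, t₀)) v₀ a)]
  ring

/-- The linearized geodesic equation. -/
theorem hasDerivAt_fderiv_vel (hG : IsLocalMetric V G) :
    HasDerivAt (fun t => fderiv ℝ (fun v => Ξ (v, t)) v₀)
      (fderiv ℝ (fun v => spray G (X (v, t₀)) (Ξ (v, t₀))) v₀) t₀ := by
  refine hasDerivAt_fderiv (h := fun z => spray G (X z) (Ξ z)) h.contDiffAt_vel ?_ h.hasDerivAt_vel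
  exact ContDiffAt.comp (f := fun z => (X z, Ξ z)) (v₀, t₀)
    ((hG.contDiffAt_spray (z := (X (v₀, t₀), Ξ (v₀, t₀))) h.mem).of_le (by simp))
    (h.contDiffAt.prodMk h.contDiffAt_vel)

theorem fderiv_spray_apply (hG : IsLocalMetric V G) (a : U) :
    fderiv ℝ (fun v => spray G (X (v, t₀)) (Ξ (v, t₀))) v₀ a =
      fderiv ℝ (fun q : E × E => spray G q.1 q.2) (X (v₀, t₀), Ξ (v₀, t₀))
        (fderiv ℝ (fun v => X (v, t₀)) v₀ a, fderiv ℝ (fun v => Ξ (v, t₀)) v₀ a) := by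
  have h1 := (hG.contDiffAt_spray (z := (X (v₀, t₀), Ξ (v₀, t₀))) h.mem).differentiableAt (by simp)
  have := HasFDerivAt.comp (f := fun v => (X (v, t₀), Ξ (v, t₀))) v₀ h1.hasFDerivAt
    (h.hasFDerivAt_pos.prodMk h.hasFDerivAt_vel)
  have h2 := this.fderiv
  simp only [Function.comp_def] at h2
  rw [h2]; rfl

end

end IsGeodesicFamilyAt

end LocalMetric

end Starshaped

end

/-! ### The manifold metric and its geodesics in charts. -/

noncomputable section

namespace Starshaped

variable {n : ℕ} {M : Type*} [TopologicalSpace M] [ChartedSpace (EuclideanSpace ℝ (Fin n)) M]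

/-- The derivative at `p` of the preferred chart at `x₀`, on the model space. -/
def chartDeriv (n : ℕ) {M : Type*} [TopologicalSpace M] [ChartedSpace (EuclideanSpace ℝ (Fin n)) M]
    (x₀ p : M) : EuclideanSpace ℝ (Fin n) →L[ℝ] EuclideanSpace ℝ (Fin n) :=
  mfderiv (𝓡 n) 𝓘(ℝ, EuclideanSpace ℝ (Fin n)) (extChartAt (𝓡 n) x₀) p

/-- The derivative at `y` of the inverse of the preferred chart at `x₀`, on the model space. -/
def chartSymmDeriv (n : ℕ) {M : Type*} [TopologicalSpace M]
    [ChartedSpace (EuclideanSpace ℝ (Fin n)) M] (x₀ : M) (y : EuclideanSpace ℝ (Fin n)) :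
    EuclideanSpace ℝ (Fin n) →L[ℝ] EuclideanSpace ℝ (Fin n) :=
  mfderiv 𝓘(ℝ, EuclideanSpace ℝ (Fin n)) (𝓡 n) (extChartAt (𝓡 n) x₀).symm y

/-- The velocity of a curve, as an element of the model space. -/
def velocityVec (n : ℕ) {M : Type*} [TopologicalSpace M]
    [ChartedSpace (EuclideanSpace ℝ (Fin n)) M] (γ : ℝ → M) (t : ℝ) : EuclideanSpace ℝ (Fin n) :=
  velocity (n := n) γ t

/-- All tangent spaces are definitionally the model space, so the heterogeneous equality of
velocities is an ordinary one. -/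
theorem passesWith_iff {γ : ℝ → M} {t : ℝ} {p : M} {v : TangentSpace (𝓡 n) p} :
    PassesWith (n := n) γ t p v ↔ γ t = p ∧ velocityVec n γ t = v := by
  unfold PassesWith
  constructor
  · intro h
    have h' := (TotalSpace.ext_iff.1 h)
    exact ⟨h'.1, eq_of_heq h'.2⟩
  · rintro ⟨h1, h2⟩
    exact TotalSpace.ext h1 (heq_of_eq h2)

theorem hasDerivAt_chart_comp [IsManifold (𝓡 n) ∞ M] {γ : ℝ → M} {t : ℝ} {x₀ : M}
    (hγ : MDifferentiableAt 𝓘(ℝ, ℝ) (𝓡 n) γ t) (hs : γ t ∈ (extChartAt (𝓡 n) x₀).source) :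
    HasDerivAt (fun s => extChartAt (𝓡 n) x₀ (γ s))
      (chartDeriv n x₀ (γ t) (velocityVec n γ t)) t := by
  have h1 : MDifferentiableAt (𝓡 n) 𝓘(ℝ, EuclideanSpace ℝ (Fin n)) (extChartAt (𝓡 n) x₀) (γ t) :=
    mdifferentiableAt_extChartAt (by simpa using hs)
  have h2 : HasFDerivAt (fun s => extChartAt (𝓡 n) x₀ (γ s))
      ((chartDeriv n x₀ (γ t)).comp (mfderiv 𝓘(ℝ, ℝ) (𝓡 n) γ t :
        ℝ →L[ℝ] EuclideanSpace ℝ (Fin n))) t :=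
    (h1.hasMFDerivAt.comp t hγ.hasMFDerivAt).hasFDerivAt
  exact h2.hasDerivAt

variable [IsManifold (𝓡 n) ∞ M]

theorem chartDeriv_chartSymmDeriv {x₀ p : M} (hp : p ∈ (extChartAt (𝓡 n) x₀).source)
    (u : EuclideanSpace ℝ (Fin n)) :
    chartDeriv n x₀ p (chartSymmDeriv n x₀ (extChartAt (𝓡 n) x₀ p) u) = u := by
  have := mfderiv_extChartAt_comp_mfderivWithin_extChartAt_symm' (I := 𝓡 n) hp
  have h2 := DFunLike.congr_fun this u
  simp only [ModelWithCorners.range_eq_univ, mfderivWithin_univ] at h2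
  exact h2

theorem chartSymmDeriv_chartDeriv {x₀ p : M} (hp : p ∈ (extChartAt (𝓡 n) x₀).source)
    (u : EuclideanSpace ℝ (Fin n)) :
    chartSymmDeriv n x₀ (extChartAt (𝓡 n) x₀ p) (chartDeriv n x₀ p u) = u := by
  have := mfderivWithin_extChartAt_symm_comp_mfderiv_extChartAt' (I := 𝓡 n) hp
  have h2 := DFunLike.congr_fun this u
  simp only [ModelWithCorners.range_eq_univ, mfderivWithin_univ] at h2
  exact h2

/-- The identification of `T_p M` with the model space is the one made by the preferred chart at
`p`. This lets vectors at `p` be used as coordinate vectors in that chart. -/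
theorem chartDeriv_self (p : M) (u : EuclideanSpace ℝ (Fin n)) : chartDeriv n p p u = u := by
  have := mfderiv_extChartAt_self (I := 𝓡 n) (x := p)
  exact DFunLike.congr_fun this u

variable (g : Metric n M)

/-- The scalar product at `p`, on the model space. -/
def innerForm (p : M) :
    EuclideanSpace ℝ (Fin n) →L[ℝ] EuclideanSpace ℝ (Fin n) →L[ℝ] ℝ :=
  g.inner p

/-- The metric in the preferred chart at `x₀`. -/
def metricForm (x₀ : M) (y : EuclideanSpace ℝ (Fin n)) :
    EuclideanSpace ℝ (Fin n) →L[ℝ] EuclideanSpace ℝ (Fin n) →L[ℝ] ℝ :=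
  (innerForm g ((extChartAt (𝓡 n) x₀).symm y)).bilinearComp (chartSymmDeriv n x₀ y)
    (chartSymmDeriv n x₀ y)

theorem metricForm_apply (x₀ : M) (y u w : EuclideanSpace ℝ (Fin n)) :
    metricForm g x₀ y u w = metricCoeff g x₀ u w y := rfl

theorem innerForm_eq {x₀ p : M} (hp : p ∈ (extChartAt (𝓡 n) x₀).source)
    (u w : EuclideanSpace ℝ (Fin n)) :
    innerForm g p u w =
      metricForm g x₀ (extChartAt (𝓡 n) x₀ p) (chartDeriv n x₀ p u) (chartDeriv n x₀ p w) := by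
  change _ = innerForm g _ (chartSymmDeriv n x₀ _ (chartDeriv n x₀ p u))
    (chartSymmDeriv n x₀ _ (chartDeriv n x₀ p w))
  rw [chartSymmDeriv_chartDeriv hp, chartSymmDeriv_chartDeriv hp, (extChartAt (𝓡 n) x₀).left_inv hp]

/-- In the trivialization of the tangent bundle over the chart at `x₀`, a coordinate vector field is
the constant `u`. Its smoothness turns that of `g` into smoothness of the metric coefficients. -/
theorem contMDiffAt_chartSymmDeriv {x₀ : M} {y : EuclideanSpace ℝ (Fin n)}
    (hy : y ∈ (extChartAt (𝓡 n) x₀).target) (u : EuclideanSpace ℝ (Fin n)) :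
    ContMDiffAt 𝓘(ℝ, EuclideanSpace ℝ (Fin n)) (𝓡 n).tangent ∞
      (fun z => (⟨(extChartAt (𝓡 n) x₀).symm z, chartSymmDeriv n x₀ z u⟩ :
        TangentBundle (𝓡 n) M)) y := by
  have hopen := isOpen_extChartAt_target (I := 𝓡 n) x₀
  have hsrc : ∀ z ∈ (extChartAt (𝓡 n) x₀).target, (extChartAt (𝓡 n) x₀).symm z ∈
      (chartAt (EuclideanSpace ℝ (Fin n)) x₀).source := fun z hz => by
    simpa using (extChartAt (𝓡 n) x₀).map_target hz
  set e := trivializationAt (EuclideanSpace ℝ (Fin n)) (TangentSpace (𝓡 n) : M → Type _) x₀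
  have hb : ∀ z ∈ (extChartAt (𝓡 n) x₀).target, (extChartAt (𝓡 n) x₀).symm z ∈ e.baseSet :=
    fun z hz => by simpa [e] using hsrc z hz
  rw [e.contMDiffAt_iff (n := ∞) (by
    rw [e.mem_source]; exact hb y hy)]
  refine ⟨(contMDiffOn_extChartAt_symm x₀).contMDiffAt (hopen.mem_nhds hy), ?_⟩
  refine (contMDiffAt_const (c := u)).congr_of_eventuallyEq ?_
  filter_upwards [hopen.mem_nhds hy] with z hz
  have h1 := TangentBundle.symmL_trivializationAt (𝕜 := ℝ) (I := 𝓡 n) (hsrc z hz)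
  rw [(extChartAt (𝓡 n) x₀).right_inv hz] at h1
  simp only [ModelWithCorners.range_eq_univ, mfderivWithin_univ] at h1
  have h2 : chartSymmDeriv n x₀ z u = e.symm ((extChartAt (𝓡 n) x₀).symm z) u := by
    have := DFunLike.congr_fun h1 u
    rw [e.symmL_apply (hb z hz)] at this
    exact this.symm
  rw [h2]
  exact congrArg Prod.snd (e.apply_mk_symm (hb z hz) u)

theorem contDiffAt_metricCoeff {x₀ : M} {y : EuclideanSpace ℝ (Fin n)}
    (hy : y ∈ (extChartAt (𝓡 n) x₀).target) (u w : EuclideanSpace ℝ (Fin n)) :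
    ContDiffAt ℝ ∞ (metricCoeff g x₀ u w) y := by
  rw [← contMDiffAt_iff_contDiffAt]
  have hopen := isOpen_extChartAt_target (I := 𝓡 n) x₀
  have hb : ContMDiffAt 𝓘(ℝ, EuclideanSpace ℝ (Fin n)) (𝓡 n) ∞ (extChartAt (𝓡 n) x₀).symm y :=
    (contMDiffOn_extChartAt_symm x₀).contMDiffAt (hopen.mem_nhds hy)
  have : ContMDiffAt 𝓘(ℝ, EuclideanSpace ℝ (Fin n)) ((𝓡 n).prod 𝓘(ℝ)) ∞
      (fun m ↦ TotalSpace.mk' ℝ (E := Bundle.Trivial M ℝ) ((extChartAt (𝓡 n) x₀).symm m)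
        (g.inner ((extChartAt (𝓡 n) x₀).symm m) (chartSymmDeriv n x₀ m u)
          (chartSymmDeriv n x₀ m w))) y := by
    apply ContMDiffAt.clm_bundle_apply₂ (F₁ := EuclideanSpace ℝ (Fin n))
      (F₂ := EuclideanSpace ℝ (Fin n))
    · exact ContMDiffAt.comp y g.contMDiff.contMDiffAt hb
    · exact contMDiffAt_chartSymmDeriv hy u
    · exact contMDiffAt_chartSymmDeriv hy w
  simp only [contMDiffAt_totalSpace] at this
  exact this.2

theorem isLocalMetric (x₀ : M) :
    IsLocalMetric (extChartAt (𝓡 n) x₀).target (metricForm g x₀) where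
  isOpen := isOpen_extChartAt_target x₀
  contDiffOn := contDiffOn_form fun u w y hy =>
    (contDiffAt_metricCoeff g hy u w).contDiffWithinAt
  symm y _ u w := g.symm _ _ _
  pos y hy u hu := by
    have h1 := chartDeriv_chartSymmDeriv ((extChartAt (𝓡 n) x₀).map_target hy) u
    rw [(extChartAt (𝓡 n) x₀).right_inv hy] at h1
    have h2 : chartSymmDeriv n x₀ y u ≠ 0 := fun h => hu (by rw [← h1, h, map_zero])
    exact g.pos ((extChartAt (𝓡 n) x₀).symm y) (chartSymmDeriv n x₀ y u) h2

theorem fderiv_metricCoeff {x₀ : M} {y : EuclideanSpace ℝ (Fin n)}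
    (hy : y ∈ (extChartAt (𝓡 n) x₀).target) (a u w : EuclideanSpace ℝ (Fin n)) :
    fderiv ℝ (metricCoeff g x₀ u w) y a = fderiv ℝ (metricForm g x₀) y a u w := by
  have h := (((isLocalMetric g x₀).differentiableAt hy).hasFDerivAt.clm_apply
    (hasFDerivAt_const u y)).clm_apply (hasFDerivAt_const w y)
  have h2 : HasFDerivAt (metricCoeff g x₀ u w) _ y := h
  rw [h2.fderiv]; simp

theorem christoffel_eq {x₀ : M} {y : EuclideanSpace ℝ (Fin n)}
    (hy : y ∈ (extChartAt (𝓡 n) x₀).target) (u w : EuclideanSpace ℝ (Fin n)) :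
    christoffel g x₀ y u u w = sprayForm (metricForm g x₀) y u w := by
  rw [christoffel, fderiv_metricCoeff g hy, fderiv_metricCoeff g hy, sprayForm_apply]
  ring

/-- In a chart, a geodesic solves the geodesic equation. -/
theorem IsGeodesic.hasDerivAt_chart {g : Metric n M} {γ : ℝ → M} (hγ : IsGeodesic g γ) {x₀ : M}
    {t : ℝ} (ht : γ t ∈ (extChartAt (𝓡 n) x₀).source) :
    HasDerivAt (fun s => extChartAt (𝓡 n) x₀ (γ s))
        (chartDeriv n x₀ (γ t) (velocityVec n γ t)) t ∧
      HasDerivAt (fun s => chartDeriv n x₀ (γ s) (velocityVec n γ s))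
        (spray (metricForm g x₀) (extChartAt (𝓡 n) x₀ (γ t))
          (chartDeriv n x₀ (γ t) (velocityVec n γ t))) t := by
  set c : ℝ → EuclideanSpace ℝ (Fin n) := fun s => extChartAt (𝓡 n) x₀ (γ s) with hc
  have hsrc : ∀ᶠ s in 𝓝 t, γ s ∈ (extChartAt (𝓡 n) x₀).source :=
    hγ.smooth.continuous.continuousAt.eventually
      ((isOpen_extChartAt_source (I := 𝓡 n) x₀).mem_nhds ht)
  have hmd : ∀ s, MDifferentiableAt 𝓘(ℝ, ℝ) (𝓡 n) γ s := fun s =>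
    (hγ.smooth s).mdifferentiableAt (by simp)
  have hd : ∀ᶠ s in 𝓝 t, HasDerivAt c (chartDeriv n x₀ (γ s) (velocityVec n γ s)) s :=
    hsrc.mono fun s hs => hasDerivAt_chart_comp (hmd s) hs
  have hcs : ContDiffAt ℝ ∞ c t := by
    rw [← contMDiffAt_iff_contDiffAt]
    have h1 := contMDiffAt_extChartAt' (I := 𝓡 n) (n := ∞) (x := x₀) (x' := γ t) (by simpa using ht)
    exact ContMDiffAt.comp t h1 (hγ.smooth t)
  have heq : deriv c =ᶠ[𝓝 t] fun s => chartDeriv n x₀ (γ s) (velocityVec n γ s) :=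
    hd.mono fun s hs => hs.deriv
  have hcs' : DifferentiableAt ℝ (deriv c) t := by
    have h1 : ContDiffAt ℝ ∞ (fderiv ℝ c) t := hcs.fderiv_right (by simp)
    exact (h1.differentiableAt (by simp)).clm_apply (differentiableAt_const 1)
  refine ⟨hd.self_of_nhds, ?_⟩
  have h1 := hcs'.hasDerivAt.congr_of_eventuallyEq heq.symm
  have hy : c t ∈ (extChartAt (𝓡 n) x₀).target := (extChartAt (𝓡 n) x₀).map_source ht
  -- The geodesic equation is stated weakly, tested against every `w`; nondegeneracy of the metric
  -- solves it for the acceleration.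
  have h2 : deriv (deriv c) t = spray (metricForm g x₀) (c t) (deriv c t) := by
    refine (isLocalMetric g x₀).eq_spray hy fun w => ?_
    have := hγ.equation x₀ t ht w
    simp only at this
    rw [← christoffel_eq g hy]
    exact eq_neg_of_add_eq_zero_left this
  rw [h2, hd.self_of_nhds.deriv] at h1
  exact h1

end Starshaped

end

/-! ### Uniqueness and rescaling of geodesics; the exponential map. -/

noncomputable section

namespace Starshaped

variable {n : ℕ} {M : Type*} [TopologicalSpace M] [ChartedSpace (EuclideanSpace ℝ (Fin n)) M]

/-- Position and velocity of a curve in the preferred chart at `x₀`. -/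
def phase (n : ℕ) {M : Type*} [TopologicalSpace M] [ChartedSpace (EuclideanSpace ℝ (Fin n)) M]
    (x₀ : M) (γ : ℝ → M) (t : ℝ) : EuclideanSpace ℝ (Fin n) × EuclideanSpace ℝ (Fin n) :=
  (extChartAt (𝓡 n) x₀ (γ t), chartDeriv n x₀ (γ t) (velocityVec n γ t))

variable [IsManifold (𝓡 n) ∞ M]

theorem isOpen_source (x₀ : M) : IsOpen (extChartAt (𝓡 n) x₀).source :=
  isOpen_extChartAt_source (I := 𝓡 n) x₀

/-- The vector field of the geodesic flow in a chart. -/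
def geodesicField (g : Metric n M) (x₀ : M)
    (q : EuclideanSpace ℝ (Fin n) × EuclideanSpace ℝ (Fin n)) :
    EuclideanSpace ℝ (Fin n) × EuclideanSpace ℝ (Fin n) :=
  (q.2, spray (metricForm g x₀) q.1 q.2)

theorem contDiffAt_geodesicField (g : Metric n M) {x₀ : M}
    {q : EuclideanSpace ℝ (Fin n) × EuclideanSpace ℝ (Fin n)}
    (hq : q.1 ∈ (extChartAt (𝓡 n) x₀).target) : ContDiffAt ℝ ∞ (geodesicField g x₀) q :=
  (isLocalMetric g x₀).contDiffAt_field hq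

section Geodesic

variable {g : Metric n M} {γ γ₁ γ₂ : ℝ → M} {x₀ : M} {t : ℝ}

theorem IsGeodesic.continuous (hγ : IsGeodesic g γ) : Continuous γ := hγ.smooth.continuous

theorem IsGeodesic.eventually_mem (hγ : IsGeodesic g γ) (ht : γ t ∈ (extChartAt (𝓡 n) x₀).source) :
    ∀ᶠ s in 𝓝 t, γ s ∈ (extChartAt (𝓡 n) x₀).source :=
  hγ.continuous.continuousAt.eventually ((isOpen_source x₀).mem_nhds ht)

theorem IsGeodesic.hasDerivAt_phase (hγ : IsGeodesic g γ)
    (ht : γ t ∈ (extChartAt (𝓡 n) x₀).source) :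
    HasDerivAt (phase n x₀ γ) (geodesicField g x₀ (phase n x₀ γ t)) t :=
  (hγ.hasDerivAt_chart ht).1.prodMk (hγ.hasDerivAt_chart ht).2

theorem IsGeodesic.eventually_hasDerivAt_phase (hγ : IsGeodesic g γ)
    (ht : γ t ∈ (extChartAt (𝓡 n) x₀).source) :
    ∀ᶠ s in 𝓝 t, HasDerivAt (phase n x₀ γ) (geodesicField g x₀ (phase n x₀ γ s)) s :=
  (hγ.eventually_mem ht).mono fun _ hs => hγ.hasDerivAt_phase hs

theorem IsGeodesic.eventuallyEq (h₁ : IsGeodesic g γ₁) (h₂ : IsGeodesic g γ₂)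
    (ht₁ : γ₁ t ∈ (extChartAt (𝓡 n) x₀).source) (ht₂ : γ₂ t ∈ (extChartAt (𝓡 n) x₀).source)
    (h : phase n x₀ γ₁ t = phase n x₀ γ₂ t) : γ₁ =ᶠ[𝓝 t] γ₂ := by
  have hf : ContDiffAt ℝ 1 (geodesicField g x₀) (phase n x₀ γ₁ t) :=
    (contDiffAt_geodesicField g ((extChartAt (𝓡 n) x₀).map_source ht₁)).of_le (by simp)
  have := eventuallyEq_of_hasDerivAt hf (h₁.eventually_hasDerivAt_phase ht₁)
    (h₂.eventually_hasDerivAt_phase ht₂) h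
  filter_upwards [this, h₁.eventually_mem ht₁, h₂.eventually_mem ht₂] with s hs h1 h2
  exact (extChartAt (𝓡 n) x₀).injOn h1 h2 (congrArg Prod.fst hs)

/-- If two geodesics agree near `t`, they have the same phase at `t`. -/
theorem IsGeodesic.phase_eq (h₁ : IsGeodesic g γ₁) (h₂ : IsGeodesic g γ₂)
    (ht₁ : γ₁ t ∈ (extChartAt (𝓡 n) x₀).source) (h : γ₁ =ᶠ[𝓝 t] γ₂) :
    phase n x₀ γ₁ t = phase n x₀ γ₂ t := by
  have ht₂ : γ₂ t ∈ (extChartAt (𝓡 n) x₀).source := h.self_of_nhds ▸ ht₁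
  have e : (fun s => extChartAt (𝓡 n) x₀ (γ₁ s)) =ᶠ[𝓝 t] fun s => extChartAt (𝓡 n) x₀ (γ₂ s) :=
    h.mono fun s hs => by simp only [hs]
  refine Prod.ext e.self_of_nhds ?_
  exact ((h₁.hasDerivAt_chart ht₁).1.congr_of_eventuallyEq e.symm).unique
    (h₂.hasDerivAt_chart ht₂).1

/-- Geodesics are determined by position and velocity at one time. -/
theorem IsGeodesic.eq [T2Space M] (h₁ : IsGeodesic g γ₁) (h₂ : IsGeodesic g γ₂)
    (h : γ₁ t = γ₂ t) (hv : velocityVec n γ₁ t = velocityVec n γ₂ t) : γ₁ = γ₂ := by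
  set A : Set ℝ := {s | γ₁ =ᶠ[𝓝 s] γ₂} with hA
  have hopen : IsOpen A := isOpen_iff_mem_nhds.2 fun s hs => by
    have : ∀ᶠ r in 𝓝 s, ∀ᶠ q in 𝓝 r, γ₁ q = γ₂ q := eventually_eventually_nhds.2 hs
    exact this
  -- Where two geodesics agree near times accumulating at `s`, their phases agree at those times,
  -- hence at `s` by continuity, and local uniqueness applies again.
  have hclosed : IsClosed A := by
    refine isClosed_of_closure_subset fun s hs => ?_
    have hfr : ∃ᶠ r in 𝓝 s, r ∈ A := mem_closure_iff_frequently.1 hs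
    have heq : γ₁ s = γ₂ s :=
      tendsto_nhds_unique_of_frequently_eq (h₁.continuous.tendsto s) (h₂.continuous.tendsto s)
        (hfr.mono fun r (hr : γ₁ =ᶠ[𝓝 r] γ₂) => hr.self_of_nhds)
    have hs₁ : γ₁ s ∈ (extChartAt (𝓡 n) (γ₁ s)).source := mem_extChartAt_source _
    have hs₂ : γ₂ s ∈ (extChartAt (𝓡 n) (γ₁ s)).source := heq ▸ hs₁
    refine h₁.eventuallyEq h₂ hs₁ hs₂ ?_
    refine tendsto_nhds_unique_of_frequently_eq (h₁.hasDerivAt_phase hs₁).continuousAt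
      (h₂.hasDerivAt_phase hs₂).continuousAt ?_
    exact (hfr.and_eventually (h₁.eventually_mem hs₁)).mono fun r hr =>
      h₁.phase_eq h₂ hr.2 hr.1
  have ht : t ∈ A := by
    have hs₁ : γ₁ t ∈ (extChartAt (𝓡 n) (γ₁ t)).source := mem_extChartAt_source _
    refine h₁.eventuallyEq h₂ hs₁ (h ▸ hs₁) ?_
    simp only [phase, ← h, hv]
  have huniv : A = univ := IsClopen.eq_univ ⟨hclosed, hopen⟩ ⟨t, ht⟩
  funext s
  have : s ∈ A := huniv ▸ mem_univ s
  exact Filter.EventuallyEq.eq_of_nhds this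

theorem IsGeodesic.mdifferentiableAt (hγ : IsGeodesic g γ) (t : ℝ) :
    MDifferentiableAt 𝓘(ℝ, ℝ) (𝓡 n) γ t :=
  (hγ.smooth t).mdifferentiableAt (by simp)

/-- Affine reparametrizations of geodesics are geodesics. -/
theorem IsGeodesic.comp_mul (hγ : IsGeodesic g γ) (a : ℝ) : IsGeodesic g fun s => γ (a * s) where
  smooth := hγ.smooth.comp (contMDiff_iff_contDiff.2 (by fun_prop))
  equation x₀ t ht w := by
    intro c
    set c₀ : ℝ → EuclideanSpace ℝ (Fin n) := fun s => extChartAt (𝓡 n) x₀ (γ s) with hc₀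
    have h1 : deriv c = fun s => a • deriv c₀ (a * s) := by
      ext1 s; exact deriv_comp_mul_left a c₀ s
    have h2 : deriv (deriv c) t = (a * a) • deriv (deriv c₀) (a * t) := by
      rw [h1, deriv_fun_const_smul_field, deriv_comp_mul_left a (deriv c₀) t, smul_smul]
    have h3 := hγ.equation x₀ (a * t) ht w
    simp only [← hc₀] at h3
    have hy : c₀ (a * t) ∈ (extChartAt (𝓡 n) x₀).target := (extChartAt (𝓡 n) x₀).map_source ht
    have hc : c t = c₀ (a * t) := rfl
    rw [christoffel_eq g hy, ← metricForm_apply] at h3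
    rw [h2, h1, hc, christoffel_eq g hy, ← metricForm_apply]
    rw [sprayForm_apply] at h3 ⊢
    simp only [map_smul, ContinuousLinearMap.smul_apply, smul_eq_mul]
    linear_combination a * a * h3

theorem velocityVec_comp_mul (hγ : IsGeodesic g γ) (a : ℝ) :
    velocityVec n (fun s => γ (a * s)) t = a • velocityVec n γ (a * t) := by
  have h1 := hasDerivAt_chart_comp (x₀ := γ (a * t)) ((hγ.comp_mul a).mdifferentiableAt t)
    (mem_extChartAt_source (I := 𝓡 n) (γ (a * t)))
  have h2 := hasDerivAt_chart_comp (x₀ := γ (a * t)) (hγ.mdifferentiableAt (a * t))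
    (mem_extChartAt_source (I := 𝓡 n) (γ (a * t)))
  have h3 := h2.scomp t ((hasDerivAt_id t).const_mul a)
  simp only [Function.comp_def, id, mul_one, chartDeriv_self] at h1 h3
  exact h1.unique h3

end Geodesic

section Exp

variable {g : Metric n M} (hg : IsComplete g)

theorem expMap_eq [T2Space M] {γ : ℝ → M} (hγ : IsGeodesic g γ) {p : M}
    {v : EuclideanSpace ℝ (Fin n)} (h0 : γ 0 = p) (hv : velocityVec n γ 0 = v) :
    expMap g p v = γ 1 := by
  have hex : ∃ γ : ℝ → M, IsGeodesic g γ ∧ PassesWith (n := n) γ 0 p v :=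
    ⟨γ, hγ, passesWith_iff.2 ⟨h0, hv⟩⟩
  rw [expMap, dif_pos hex]
  have h1 := hex.choose_spec
  have h2 := passesWith_iff.1 h1.2
  rw [h1.1.eq (t := 0) hγ (h2.1.trans h0.symm) (h2.2.trans hv.symm)]

/-- The geodesic with initial velocity `v` at `p`. -/
def geod (g : Metric n M) (p : M) (v : EuclideanSpace ℝ (Fin n)) (t : ℝ) : M := expMap g p (t • v)

theorem exists_eq_geod [T2Space M] (hg : IsComplete g) (p : M) (v : EuclideanSpace ℝ (Fin n)) :
    IsGeodesic g (geod g p v) ∧ geod g p v 0 = p ∧ velocityVec n (geod g p v) 0 = v := by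
  obtain ⟨γ, hγ, hp⟩ := hg p v
  obtain ⟨h0, hv⟩ := passesWith_iff.1 hp
  -- The rescaled curve `s ↦ γ (t s)` is the geodesic with initial velocity `t v`, and its value at
  -- time `1` is `γ t`.
  have : geod g p v = γ := by
    funext t
    have := expMap_eq (v := t • v) (hγ.comp_mul t) (p := p) (by simpa using h0) (by
      rw [velocityVec_comp_mul hγ, mul_zero, hv])
    simp only [mul_one] at this; exact this
  rw [this]
  exact ⟨hγ, h0, hv⟩

theorem isGeodesic_geod [T2Space M] (hg : IsComplete g) (p : M) (v : EuclideanSpace ℝ (Fin n)) :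
    IsGeodesic g (geod g p v) := (exists_eq_geod hg p v).1

theorem geod_zero [T2Space M] (hg : IsComplete g) (p : M) (v : EuclideanSpace ℝ (Fin n)) :
    geod g p v 0 = p := (exists_eq_geod hg p v).2.1

theorem velocityVec_geod_zero [T2Space M] (hg : IsComplete g) (p : M)
    (v : EuclideanSpace ℝ (Fin n)) : velocityVec n (geod g p v) 0 = v := (exists_eq_geod hg p v).2.2

end Exp

end Starshaped

end

/-! ### `C¹` dependence of geodesics on the initial velocity and on time. -/

noncomputable section

namespace Starshaped

variable {n : ℕ} {M : Type*} [TopologicalSpace M] [ChartedSpace (EuclideanSpace ℝ (Fin n)) M]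
  [IsManifold (𝓡 n) ∞ M]

section ChartChange

/-- The transition map between two preferred charts. -/
def transition (n : ℕ) {M : Type*} [TopologicalSpace M]
    [ChartedSpace (EuclideanSpace ℝ (Fin n)) M] (x₀ x₁ : M) (y : EuclideanSpace ℝ (Fin n)) :
    EuclideanSpace ℝ (Fin n) := extChartAt (𝓡 n) x₁ ((extChartAt (𝓡 n) x₀).symm y)

theorem contDiffAt_transition {x₀ x₁ q : M} (h₀ : q ∈ (extChartAt (𝓡 n) x₀).source)
    (h₁ : q ∈ (extChartAt (𝓡 n) x₁).source) :
    ContDiffAt ℝ ∞ (transition n x₀ x₁) (extChartAt (𝓡 n) x₀ q) := by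
  rw [← contMDiffAt_iff_contDiffAt]
  have hs : ContMDiffAt 𝓘(ℝ, EuclideanSpace ℝ (Fin n)) (𝓡 n) ∞ (extChartAt (𝓡 n) x₀).symm
      (extChartAt (𝓡 n) x₀ q) :=
    (contMDiffOn_extChartAt_symm x₀).contMDiffAt
      ((isOpen_extChartAt_target x₀).mem_nhds ((extChartAt (𝓡 n) x₀).map_source h₀))
  have h := contMDiffAt_extChartAt' (I := 𝓡 n) (n := ∞) (x := x₁) (x' := q) (by simpa using h₁)
  rw [← (extChartAt (𝓡 n) x₀).left_inv h₀] at h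
  exact ContMDiffAt.comp _ h hs

theorem chartDeriv_eq_transition {x₀ x₁ q : M} (h₀ : q ∈ (extChartAt (𝓡 n) x₀).source)
    (h₁ : q ∈ (extChartAt (𝓡 n) x₁).source) (u : EuclideanSpace ℝ (Fin n)) :
    chartDeriv n x₁ q u =
      fderiv ℝ (transition n x₀ x₁) (extChartAt (𝓡 n) x₀ q) (chartDeriv n x₀ q u) := by
  have hs : MDifferentiableAt 𝓘(ℝ, EuclideanSpace ℝ (Fin n)) (𝓡 n) (extChartAt (𝓡 n) x₀).symm
      (extChartAt (𝓡 n) x₀ q) :=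
    ((contMDiffOn_extChartAt_symm (n := ∞) x₀).contMDiffAt
      ((isOpen_extChartAt_target x₀).mem_nhds
        ((extChartAt (𝓡 n) x₀).map_source h₀))).mdifferentiableAt (by simp)
  have h : MDifferentiableAt (𝓡 n) 𝓘(ℝ, EuclideanSpace ℝ (Fin n)) (extChartAt (𝓡 n) x₁)
      ((extChartAt (𝓡 n) x₀).symm (extChartAt (𝓡 n) x₀ q)) := by
    rw [(extChartAt (𝓡 n) x₀).left_inv h₀]
    exact mdifferentiableAt_extChartAt (by simpa using h₁)
  have h2 : HasFDerivAt (transition n x₀ x₁)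
      ((chartDeriv n x₁ ((extChartAt (𝓡 n) x₀).symm (extChartAt (𝓡 n) x₀ q))).comp
        (chartSymmDeriv n x₀ (extChartAt (𝓡 n) x₀ q))) (extChartAt (𝓡 n) x₀ q) :=
    (h.hasMFDerivAt.comp _ hs.hasMFDerivAt).hasFDerivAt
  rw [h2.fderiv, ContinuousLinearMap.comp_apply, chartSymmDeriv_chartDeriv h₀,
    (extChartAt (𝓡 n) x₀).left_inv h₀]

/-- The phase of a curve in two charts. -/
theorem phase_eq_transition {x₀ x₁ : M} {γ : ℝ → M} {t : ℝ}
    (h₀ : γ t ∈ (extChartAt (𝓡 n) x₀).source) (h₁ : γ t ∈ (extChartAt (𝓡 n) x₁).source) :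
    phase n x₁ γ t = (transition n x₀ x₁ (phase n x₀ γ t).1,
      fderiv ℝ (transition n x₀ x₁) (phase n x₀ γ t).1 (phase n x₀ γ t).2) := by
  simp only [phase, ← chartDeriv_eq_transition h₀ h₁]
  simp only [transition, (extChartAt (𝓡 n) x₀).left_inv h₀]

end ChartChange

section Regularity

variable {g : Metric n M} {p : M} {x₀ x₁ : M} {v₀ : EuclideanSpace ℝ (Fin n)} {t₀ t₁ t : ℝ}

/-- Near `(v₀, t₀)`, the geodesics issuing from `p` stay in the chart at `x₀` and depend in a `C¹`
way on the initial velocity and on time. -/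
def GoodAt (g : Metric n M) (p x₀ : M) (v₀ : EuclideanSpace ℝ (Fin n)) (t₀ : ℝ) : Prop :=
  (∀ᶠ z : EuclideanSpace ℝ (Fin n) × ℝ in 𝓝 (v₀, t₀),
      geod g p z.1 z.2 ∈ (extChartAt (𝓡 n) x₀).source) ∧
    ContDiffAt ℝ 1 (fun z : EuclideanSpace ℝ (Fin n) × ℝ => phase n x₀ (geod g p z.1) z.2) (v₀, t₀)

/-- The version of `GoodAt` for a fixed time. -/
def GoodSliceAt (g : Metric n M) (p x₀ : M) (v₀ : EuclideanSpace ℝ (Fin n)) (t₀ : ℝ) : Prop :=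
  (∀ᶠ v in 𝓝 v₀, geod g p v t₀ ∈ (extChartAt (𝓡 n) x₀).source) ∧
    ContDiffAt ℝ 1 (fun v => phase n x₀ (geod g p v) t₀) v₀

theorem GoodAt.slice (h : GoodAt g p x₀ v₀ t₀) : GoodSliceAt g p x₀ v₀ t₀ := by
  have hc : ContDiffAt ℝ 1 (fun v : EuclideanSpace ℝ (Fin n) => (v, t₀)) v₀ := by fun_prop
  exact ⟨hc.continuousAt.eventually h.1, ContDiffAt.comp (f := fun v => (v, t₀)) v₀ h.2 hc⟩

/-- The transition map and its derivative are smooth and carry one phase to the other. Continuity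
keeps the neighbouring geodesics in both charts. -/
theorem GoodAt.change (h : GoodAt g p x₀ v₀ t₀) (hcont : ContinuousAt
      (fun z : EuclideanSpace ℝ (Fin n) × ℝ => geod g p z.1 z.2) (v₀, t₀))
    (h₁ : geod g p v₀ t₀ ∈ (extChartAt (𝓡 n) x₁).source) : GoodAt g p x₁ v₀ t₀ := by
  have hev := hcont.eventually ((isOpen_source x₁).mem_nhds h₁)
  refine ⟨hev, ?_⟩
  have h0 := h.1.self_of_nhds
  have hT := contDiffAt_transition h0 h₁
  have hT' : ContDiffAt ℝ ∞ (fderiv ℝ (transition n x₀ x₁))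
      (phase n x₀ (geod g p v₀) t₀).1 := hT.fderiv_right (by simp)
  have h1 : ContDiffAt ℝ 1 (fun z : EuclideanSpace ℝ (Fin n) × ℝ =>
      (phase n x₀ (geod g p z.1) z.2).1) (v₀, t₀) := contDiffAt_fst.comp _ h.2
  have h2 : ContDiffAt ℝ 1 (fun z : EuclideanSpace ℝ (Fin n) × ℝ =>
      (phase n x₀ (geod g p z.1) z.2).2) (v₀, t₀) := contDiffAt_snd.comp _ h.2
  have h3 := ((hT.of_le (m := 1) (by simp)).comp (v₀, t₀)
      (f := fun z : EuclideanSpace ℝ (Fin n) × ℝ => (phase n x₀ (geod g p z.1) z.2).1) h1).prodMk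
    (((hT'.of_le (m := 1) (by simp)).comp (v₀, t₀)
      (f := fun z : EuclideanSpace ℝ (Fin n) × ℝ => (phase n x₀ (geod g p z.1) z.2).1) h1).clm_apply
        h2)
  refine h3.congr_of_eventuallyEq ?_
  filter_upwards [h.1, hev] with z hz hz'
  exact phase_eq_transition hz hz'

theorem GoodAt.continuousAt (h : GoodAt g p x₀ v₀ t₀) : ContinuousAt
    (fun z : EuclideanSpace ℝ (Fin n) × ℝ => geod g p z.1 z.2) (v₀, t₀) := by
  have h1 : ContinuousAt (fun z : EuclideanSpace ℝ (Fin n) × ℝ =>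
      (phase n x₀ (geod g p z.1) z.2).1) (v₀, t₀) :=
    continuousAt_fst.comp (f := fun z : EuclideanSpace ℝ (Fin n) × ℝ =>
      phase n x₀ (geod g p z.1) z.2) h.2.continuousAt
  have h0 := h.1.self_of_nhds
  have h2 := continuousAt_extChartAt_symm'' (I := 𝓡 n) ((extChartAt (𝓡 n) x₀).map_source h0)
  have h3 : ContinuousAt (fun z : EuclideanSpace ℝ (Fin n) × ℝ => (extChartAt (𝓡 n) x₀).symm
      ((phase n x₀ (geod g p z.1) z.2).1)) (v₀, t₀) := ContinuousAt.comp (x := (v₀, t₀)) h2 h1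
  refine h3.congr ?_
  filter_upwards [h.1] with z hz
  exact (extChartAt (𝓡 n) x₀).left_inv hz

variable [T2Space M]

/-- A geodesic follows the solution of the geodesic equation in a chart as long as the latter
exists. -/
theorem IsGeodesic.phase_eq_of_hasDerivAt {γ : ℝ → M} (hγ : IsGeodesic g γ) {a b : ℝ}
    {σ : ℝ → EuclideanSpace ℝ (Fin n) × EuclideanSpace ℝ (Fin n)}
    (hσ : ∀ t ∈ Ioo a b, (σ t).1 ∈ (extChartAt (𝓡 n) x₀).target ∧
      HasDerivAt σ (geodesicField g x₀ (σ t)) t) (ht₁ : t₁ ∈ Ioo a b)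
    (hmem : γ t₁ ∈ (extChartAt (𝓡 n) x₀).source) (heq : phase n x₀ γ t₁ = σ t₁) :
    ∀ t ∈ Ioo a b, γ t ∈ (extChartAt (𝓡 n) x₀).source ∧ phase n x₀ γ t = σ t := by
  set A : Set ℝ := {t | t ∈ Ioo a b ∧ γ t ∈ (extChartAt (𝓡 n) x₀).source ∧
    phase n x₀ γ t = σ t} with hA
  have hopen : IsOpen A := isOpen_iff_mem_nhds.2 fun s hs => by
    have h1 : ∀ᶠ r in 𝓝 s, r ∈ Ioo a b := isOpen_Ioo.mem_nhds hs.1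
    have h2 := hγ.eventually_mem hs.2.1
    have h3 := eventuallyEq_of_hasDerivAt (f := geodesicField g x₀)
      ((contDiffAt_geodesicField g (x₀ := x₀) (q := phase n x₀ γ s)
        ((extChartAt (𝓡 n) x₀).map_source hs.2.1)).of_le (by simp))
      (hγ.eventually_hasDerivAt_phase hs.2.1) (h1.mono fun r hr => (hσ r hr).2) hs.2.2
    filter_upwards [h1, h2, h3] with r hr1 hr2 hr3 using ⟨hr1, hr2, hr3⟩
  have hsub : Ioo a b ⊆ A := by
    refine isPreconnected_Ioo.subset_of_closure_inter_subset hopen ⟨t₁, ht₁, ht₁, hmem, heq⟩ ?_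
    rintro s ⟨hs, hsI⟩
    have hfr : ∃ᶠ r in 𝓝 s, r ∈ A := mem_closure_iff_frequently.1 hs
    have hc : ContinuousAt (fun r => (extChartAt (𝓡 n) x₀).symm (σ r).1) s :=
      ContinuousAt.comp (f := fun r => (σ r).1)
        (continuousAt_extChartAt_symm'' (I := 𝓡 n) (hσ s hsI).1)
        (continuousAt_fst.comp (hσ s hsI).2.continuousAt)
    have e1 : γ s = (extChartAt (𝓡 n) x₀).symm (σ s).1 := by
      refine tendsto_nhds_unique_of_frequently_eq (hγ.continuous.tendsto s) hc
        (hfr.mono fun r hr => ?_)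
      rw [← hr.2.2]
      exact ((extChartAt (𝓡 n) x₀).left_inv hr.2.1).symm
    have hs' : γ s ∈ (extChartAt (𝓡 n) x₀).source :=
      e1 ▸ (extChartAt (𝓡 n) x₀).map_target (hσ s hsI).1
    refine ⟨hsI, hs', ?_⟩
    exact tendsto_nhds_unique_of_frequently_eq (hγ.hasDerivAt_phase hs').continuousAt
      (hσ s hsI).2.continuousAt (hfr.mono fun r hr => hr.2.2)
  exact fun t ht => (hsub ht).2

/-- The local flow near the phase at `t₀` transports regularity from any time `t₁` of a window to
all its other times. The window depends on `t₀` only, which is what both openness and closedness in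
`goodAt` require. -/
theorem exists_goodAt_of_goodSliceAt (hg : IsComplete g)
    (h₀ : geod g p v₀ t₀ ∈ (extChartAt (𝓡 n) x₀).source) :
    ∃ η > 0, ∀ t₁ ∈ Ioo (t₀ - η) (t₀ + η), GoodSliceAt g p x₀ v₀ t₁ →
      ∀ t ∈ Ioo (t₀ - η) (t₀ + η), GoodAt g p x₀ v₀ t := by
  set γ₀ := geod g p v₀ with hγ₀
  have hgeo := isGeodesic_geod hg p v₀
  have hz₀ : (phase n x₀ γ₀ t₀).1 ∈ (extChartAt (𝓡 n) x₀).target :=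
    (extChartAt (𝓡 n) x₀).map_source h₀
  obtain ⟨Ψ, δ, hδ, hΨ0, hΨ⟩ := exists_contDiffAt_flow (f := geodesicField g x₀)
    (z₀ := phase n x₀ γ₀ t₀) ((contDiffAt_geodesicField g hz₀).of_le (by exact WithTop.coe_le_coe.2 le_top))
    (N := (extChartAt (𝓡 n) x₀).target ×ˢ univ)
    (((isOpen_extChartAt_target x₀).prod isOpen_univ).mem_nhds ⟨hz₀, mem_univ _⟩)
  have h1 : ∀ᶠ s in 𝓝 t₀, phase n x₀ γ₀ s ∈ Metric.ball (phase n x₀ γ₀ t₀) δ :=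
    (hgeo.hasDerivAt_phase h₀).continuousAt.eventually (Metric.ball_mem_nhds _ hδ)
  obtain ⟨η₀, hη₀, hη₀'⟩ := Metric.eventually_nhds_iff.1 h1
  -- Two times in the window differ by less than `δ`, so one flow box reaches from `t₁` to `t`.
  set η := min η₀ (δ / 2) with hη
  have hηpos : 0 < η := lt_min hη₀ (by linarith)
  have hη1 : η ≤ η₀ := min_le_left _ _
  have hη2 : η ≤ δ / 2 := min_le_right _ _
  refine ⟨η, hηpos, fun t₁ ht₁ hs t ht => ?_⟩
  have hb₁ : phase n x₀ γ₀ t₁ ∈ Metric.ball (phase n x₀ γ₀ t₀) δ :=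
    hη₀' (by rw [Real.dist_eq, abs_lt]; exact ⟨by linarith [ht₁.1], by linarith [ht₁.2]⟩)
  -- By uniqueness, each nearby geodesic is the flow line through its phase at time `t₁`.
  have hev : ∀ᶠ v in 𝓝 v₀, ∀ s ∈ Ioo (t₁ - δ) (t₁ + δ),
      geod g p v s ∈ (extChartAt (𝓡 n) x₀).source ∧
        phase n x₀ (geod g p v) s = Ψ (phase n x₀ (geod g p v) t₁, s - t₁) := by
    have hb : ∀ᶠ v in 𝓝 v₀, phase n x₀ (geod g p v) t₁ ∈
        Metric.ball (phase n x₀ γ₀ t₀) δ :=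
      hs.2.continuousAt.eventually (Metric.isOpen_ball.mem_nhds hb₁)
    filter_upwards [hs.1, hb] with v hv hvb
    refine (isGeodesic_geod hg p v).phase_eq_of_hasDerivAt
      (σ := fun s => Ψ (phase n x₀ (geod g p v) t₁, s - t₁)) (t₁ := t₁) (fun s hsI => ?_)
      ⟨by linarith, by linarith⟩ hv ?_
    · have h2 := hΨ _ hvb (s - t₁) ⟨by linarith [hsI.1], by linarith [hsI.2]⟩
      exact ⟨h2.1.1, HasDerivAt.comp_sub_const (f := fun r => Ψ (phase n x₀ (geod g p v) t₁, r))
        s t₁ h2.2.1⟩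
    · simp only [sub_self]
      exact (hΨ0 _ hvb).symm
  have htI : t ∈ Ioo (t₁ - δ) (t₁ + δ) :=
    ⟨by linarith [ht.1, ht₁.2], by linarith [ht.2, ht₁.1]⟩
  have hev2 : ∀ᶠ z : EuclideanSpace ℝ (Fin n) × ℝ in 𝓝 (v₀, t),
      geod g p z.1 z.2 ∈ (extChartAt (𝓡 n) x₀).source ∧
        phase n x₀ (geod g p z.1) z.2 = Ψ (phase n x₀ (geod g p z.1) t₁, z.2 - t₁) := by
    rw [nhds_prod_eq]
    filter_upwards [hev.prod_mk (isOpen_Ioo.mem_nhds htI)] with z hz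
    exact hz.1 z.2 hz.2
  refine ⟨hev2.mono fun z hz => hz.1, ?_⟩
  have h3 : ContDiffAt ℝ 1 Ψ (phase n x₀ γ₀ t₁, t - t₁) :=
    (hΨ _ hb₁ (t - t₁) ⟨by linarith [htI.1], by linarith [htI.2]⟩).2.2
  have h4 : ContDiffAt ℝ 1 (fun z : EuclideanSpace ℝ (Fin n) × ℝ =>
      (phase n x₀ (geod g p z.1) t₁, z.2 - t₁)) (v₀, t) :=
    (ContDiffAt.comp (v₀, t) hs.2 contDiffAt_fst).prodMk (contDiffAt_snd.sub contDiffAt_const)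
  have h5 := ContDiffAt.comp (f := fun z : EuclideanSpace ℝ (Fin n) × ℝ =>
      (phase n x₀ (geod g p z.1) t₁, z.2 - t₁)) (v₀, t) h3 h4
  exact h5.congr_of_eventuallyEq (hev2.mono fun z hz => hz.2)

/-- At time zero the phase in the chart at `p` is the constant base point paired with `v`, so it is
affine in `v`; this starts the continuation in time. -/
theorem goodAt_zero (hg : IsComplete g) : GoodSliceAt g p p v₀ 0 := by
  constructor
  · refine Eventually.of_forall fun v => ?_
    rw [geod_zero hg]; exact mem_extChartAt_source p
  · have : (fun v => phase n p (geod g p v) 0) = fun v => (extChartAt (𝓡 n) p p, v) := by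
      funext v
      rw [phase, geod_zero hg, velocityVec_geod_zero hg, chartDeriv_self]
    rw [this]; fun_prop

/-- The geodesics issuing from `p` depend in a `C¹` way on the initial velocity and on time. -/
theorem goodAt (hg : IsComplete g) (h₁ : geod g p v₀ t ∈ (extChartAt (𝓡 n) x₁).source) :
    GoodAt g p x₁ v₀ t := by
  suffices h : GoodAt g p (geod g p v₀ t) v₀ t from h.change h.continuousAt h₁
  -- The good times form a nonempty clopen subset of the line.
  set B : Set ℝ := {t | GoodAt g p (geod g p v₀ t) v₀ t} with hB
  have key : ∀ t₀, ∃ η > 0, ∀ t₁ ∈ Ioo (t₀ - η) (t₀ + η), GoodSliceAt g p (geod g p v₀ t₀) v₀ t₁ →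
      ∀ t ∈ Ioo (t₀ - η) (t₀ + η), GoodAt g p (geod g p v₀ t₀) v₀ t := fun t₀ =>
    exists_goodAt_of_goodSliceAt hg (mem_extChartAt_source _)
  have hch : ∀ {x s}, GoodAt g p x v₀ s → s ∈ B := fun {x s} h =>
    h.change h.continuousAt (mem_extChartAt_source _)
  have hopen : IsOpen B := isOpen_iff_mem_nhds.2 fun s hs => by
    obtain ⟨η, hη, h⟩ := key s
    filter_upwards [Ioo_mem_nhds (sub_lt_self s hη) (lt_add_of_pos_right s hη)] with r hr
    exact hch (h s ⟨by linarith, by linarith⟩ (GoodAt.slice hs) r hr)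
  have hclosed : IsClosed B := by
    refine isClosed_of_closure_subset fun s hs => ?_
    obtain ⟨η, hη, h⟩ := key s
    have h2 := (mem_closure_iff_frequently.1 hs).and_eventually
      (((isGeodesic_geod hg p v₀).eventually_mem (mem_extChartAt_source (I := 𝓡 n) (geod g p v₀ s))).and
        (Ioo_mem_nhds (sub_lt_self s hη) (lt_add_of_pos_right s hη)))
    obtain ⟨r, hr, hr2, hr3⟩ := h2.exists
    have hr' : GoodAt g p (geod g p v₀ r) v₀ r := hr
    exact h r hr3 (hr'.change hr'.continuousAt hr2).slice s ⟨by linarith, by linarith⟩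
  have h0 : (0 : ℝ) ∈ B := by
    obtain ⟨η, hη, h⟩ := key 0
    have : GoodSliceAt g p (geod g p v₀ 0) v₀ 0 := by
      rw [geod_zero hg]; exact goodAt_zero hg
    exact h 0 ⟨by linarith, by linarith⟩ this 0 ⟨by linarith, by linarith⟩
  have : B = univ := IsClopen.eq_univ ⟨hclosed, hopen⟩ ⟨0, h0⟩
  exact (this ▸ mem_univ t : t ∈ B)

variable (n) in
/-- The geodesics issuing from `p`, in the chart at `x₀`. -/
def posIn (g : Metric n M) (p x₀ : M) (z : EuclideanSpace ℝ (Fin n) × ℝ) :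
    EuclideanSpace ℝ (Fin n) := extChartAt (𝓡 n) x₀ (geod g p z.1 z.2)

variable (n) in
/-- The velocities of the geodesics issuing from `p`, in the chart at `x₀`. -/
def velIn (g : Metric n M) (p x₀ : M) (z : EuclideanSpace ℝ (Fin n) × ℝ) :
    EuclideanSpace ℝ (Fin n) :=
  chartDeriv n x₀ (geod g p z.1 z.2) (velocityVec n (geod g p z.1) z.2)

theorem isGeodesicFamilyAt (hg : IsComplete g)
    (h₀ : geod g p v₀ t ∈ (extChartAt (𝓡 n) x₀).source) :
    IsGeodesicFamilyAt (extChartAt (𝓡 n) x₀).target (metricForm g x₀) (posIn n g p x₀)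
      (velIn n g p x₀) (v₀, t) where
  mem := (extChartAt (𝓡 n) x₀).map_source h₀
  contDiffAt := contDiffAt_fst.comp _ (goodAt hg h₀).2
  contDiffAt_vel := contDiffAt_snd.comp _ (goodAt hg h₀).2
  hasDerivAt := (goodAt hg h₀).1.mono fun z hz => ((isGeodesic_geod hg p z.1).hasDerivAt_chart hz).1
  hasDerivAt_vel :=
    (goodAt hg h₀).1.mono fun z hz => ((isGeodesic_geod hg p z.1).hasDerivAt_chart hz).2

theorem continuous_geod (hg : IsComplete g) (p : M) :
    Continuous fun z : EuclideanSpace ℝ (Fin n) × ℝ => geod g p z.1 z.2 :=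
  continuous_iff_continuousAt.2 fun z =>
    (goodAt (v₀ := z.1) (t := z.2) hg (mem_extChartAt_source _)).continuousAt

theorem geod_one (g : Metric n M) (p : M) (v : EuclideanSpace ℝ (Fin n)) : geod g p v 1 = expMap g p v := by
  rw [geod, one_smul]

theorem continuous_expMap (hg : IsComplete g) (p : M) : Continuous (expMap g p) := by
  have : expMap g p = fun v => geod g p v 1 := funext fun v => (geod_one g p v).symm
  rw [this]
  exact (continuous_geod hg p).comp (continuous_id.prodMk continuous_const)

end Regularity

end Starshaped

end

/-! ### Second fundamental forms of wave fronts and the Riccati estimate. -/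

noncomputable section

namespace Starshaped

section Aux

theorem image_le_add_of_hasDerivAt_le {f f' : ℝ → ℝ} {a b C : ℝ}
    (hf : ∀ t ∈ Ioo a b, HasDerivAt f (f' t) t) (hC : ∀ t ∈ Ioo a b, f' t ≤ C) {s t : ℝ}
    (hs : s ∈ Ioo a b) (ht : t ∈ Ioo a b) (hst : s ≤ t) : f t ≤ f s + C * (t - s) := by
  have := Convex.image_sub_le_mul_sub_of_deriv_le (convex_Ioo a b)
    (fun r hr => (hf r hr).continuousAt.continuousWithinAt)
    (fun r hr => (hf r (interior_subset hr)).differentiableAt.differentiableWithinAt)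
    (C := C) (fun r hr => by
      rw [(hf r (interior_subset hr)).deriv]; exact hC r (interior_subset hr)) s hs t ht hst
  linarith

/-- The function `exp (-C r) f r` is nonincreasing. Unlike the norm version of Grönwall, this needs
only a one-sided bound, and no sign of `C`. -/
theorem image_le_mul_exp_of_hasDerivAt_le {f f' : ℝ → ℝ} {a b C : ℝ}
    (hf : ∀ t ∈ Ioo a b, HasDerivAt f (f' t) t) (hC : ∀ t ∈ Ioo a b, f' t ≤ C * f t) {s t : ℝ}
    (hs : s ∈ Ioo a b) (ht : t ∈ Ioo a b) (hst : s ≤ t) :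
    f t ≤ Real.exp (C * (t - s)) * f s := by
  have h := image_le_add_of_hasDerivAt_le (f := fun r => Real.exp (-(C * r)) * f r) (C := 0)
    (f' := fun r => Real.exp (-(C * r)) * (-C) * f r + Real.exp (-(C * r)) * f' r)
    (a := a) (b := b) (fun r hr => by
      have h1 : HasDerivAt (fun r => Real.exp (-(C * r))) (Real.exp (-(C * r)) * (-C)) r := by
        have := ((hasDerivAt_id r).const_mul C).neg.exp
        simpa using this
      exact h1.mul (hf r hr)) (fun r hr => by
      have := mul_le_mul_of_nonneg_left (hC r hr) (Real.exp_nonneg (-(C * r)))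
      nlinarith) hs ht hst
  simp only [zero_mul, add_zero] at h
  have h2 := mul_le_mul_of_nonneg_left h (Real.exp_nonneg (C * t))
  rw [← mul_assoc, ← mul_assoc, ← Real.exp_add, ← Real.exp_add] at h2
  rw [show C * t + -(C * t) = 0 by ring, show C * t + -(C * s) = C * (t - s) by ring] at h2
  simpa using h2

variable {E : Type*} [NormedAddCommGroup E] [NormedSpace ℝ E] [FiniteDimensional ℝ E]

theorem isInvertible_of_injective {A : E →L[ℝ] E} (hA : Function.Injective A) : A.IsInvertible :=
  ⟨(LinearEquiv.ofInjectiveEndo (A : E →ₗ[ℝ] E) hA).toContinuousLinearEquiv, by ext; rfl⟩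

/-- Injective endomorphisms are uniformly bounded below, locally uniformly. -/
theorem eventually_le_norm_of_injective {Z : Type*} [TopologicalSpace Z] {A : Z → E →L[ℝ] E} {z₀ : Z}
    (hc : ContinuousAt A z₀) (hA : Function.Injective (A z₀)) :
    ∃ κ > 0, ∀ᶠ z in 𝓝 z₀, ∀ b, κ * ‖b‖ ≤ ‖A z b‖ := by
  obtain ⟨K, hK0, hK⟩ := (A z₀).toLinearMap.exists_antilipschitzWith (LinearMap.ker_eq_bot.2 hA)
  have hK' : (0 : ℝ) < K := hK0
  refine ⟨(K : ℝ)⁻¹ / 2, by positivity, ?_⟩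
  have h1 : ∀ᶠ z in 𝓝 z₀, A z ∈ Metric.ball (A z₀) ((K : ℝ)⁻¹ / 2) :=
    hc.eventually (Metric.ball_mem_nhds _ (by positivity))
  filter_upwards [h1] with z hz b
  rw [Metric.mem_ball, dist_eq_norm] at hz
  have h2 : ‖b‖ ≤ K * ‖A z₀ b‖ := by
    simpa using hK.le_mul_dist b 0
  have h3 : ‖(A z - A z₀) b‖ ≤ (K : ℝ)⁻¹ / 2 * ‖b‖ :=
    ((A z - A z₀).le_opNorm b).trans (by gcongr)
  have h4 : ‖A z₀ b‖ ≤ ‖A z b‖ + ‖(A z - A z₀) b‖ := by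
    have : A z₀ b = A z b - (A z - A z₀) b := by simp
    calc ‖A z₀ b‖ = ‖A z b - (A z - A z₀) b‖ := by rw [← this]
      _ ≤ _ := norm_sub_le _ _
  have h5 : (K : ℝ)⁻¹ * ‖b‖ ≤ ‖A z₀ b‖ := by
    rw [inv_mul_le_iff₀ hK']; exact h2
  linarith

theorem eventually_norm_le {Z F : Type*} [TopologicalSpace Z] [NormedAddCommGroup F] {A : Z → F}
    {z₀ : Z} (hc : ContinuousAt A z₀) : ∃ C > 0, ∀ᶠ z in 𝓝 z₀, ‖A z‖ ≤ C :=
  ⟨‖A z₀‖ + 1, by positivity,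
    (hc.norm.eventually (gt_mem_nhds (lt_add_one _))).mono fun _ h => h.le⟩

/-- A `C¹` map with injective derivative has a `C¹` local inverse. -/
theorem exists_localInverse {f : E → E} {v₀ : E} (hf : ContDiffAt ℝ 1 f v₀)
    (hinj : Function.Injective (fderiv ℝ f v₀)) :
    ∃ ψ : E → E, ContDiffAt ℝ 1 ψ (f v₀) ∧ ψ (f v₀) = v₀ ∧ (∀ᶠ v in 𝓝 v₀, ψ (f v) = v) ∧
      ∀ᶠ y in 𝓝 (f v₀), f (ψ y) = y := by
  obtain ⟨e, he⟩ := isInvertible_of_injective hinj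
  have hfd : HasFDerivAt f (e : E →L[ℝ] E) v₀ := by
    rw [he]; exact (hf.differentiableAt (by simp)).hasFDerivAt
  have hs := hf.hasStrictFDerivAt' hfd (by simp)
  exact ⟨hf.localInverse hfd (by simp), hf.to_localInverse hfd (by simp),
    hs.localInverse_apply_image, hs.eventually_left_inverse, hs.eventually_right_inverse⟩

end Aux

namespace IsGeodesicFamilyAt

variable {E : Type*} [NormedAddCommGroup E] [NormedSpace ℝ E] [FiniteDimensional ℝ E]
  {V : Set E} {G : E → E →L[ℝ] E →L[ℝ] ℝ} {X Ξ : E × ℝ → E} {v₀ : E} {t₀ : ℝ}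
  {B : E →L[ℝ] E →L[ℝ] ℝ}

/-- At times without conjugate points, the second fundamental form of the wave front is symmetric. -/
theorem momentum_symm (hG : IsLocalMetric V G) (h : IsGeodesicFamilyAt V G X Ξ (v₀, t₀))
    (hB : ∀ a b, B a b = B b a)
    (hgauss : ∀ᶠ v in 𝓝 v₀, ∀ c, G (X (v, t₀)) (Ξ (v, t₀)) (fderiv ℝ (fun v => X (v, t₀)) v c)
      = t₀ * B v c)
    (hinj : Function.Injective (fderiv ℝ (fun v => X (v, t₀)) v₀)) (b c : E) :
    fderiv ℝ (fun v => G (X (v, t₀)) (Ξ (v, t₀))) v₀ b (fderiv ℝ (fun v => X (v, t₀)) v₀ c) =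
      fderiv ℝ (fun v => G (X (v, t₀)) (Ξ (v, t₀))) v₀ c (fderiv ℝ (fun v => X (v, t₀)) v₀ b) := by
  have hin : ContDiffAt ℝ 1 (fun v : E => (v, t₀)) v₀ := by fun_prop
  set f : E → E := fun v => X (v, t₀) with hf
  have hfc : ContDiffAt ℝ 1 f v₀ := ContDiffAt.comp (f := fun v => (v, t₀)) v₀ h.contDiffAt hin
  have hΞc : ContDiffAt ℝ 1 (fun v => Ξ (v, t₀)) v₀ :=
    ContDiffAt.comp (f := fun v => (v, t₀)) v₀ h.contDiffAt_vel hin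
  obtain ⟨ψ, hψ, hψ0, hψl, hψr⟩ := exists_localInverse hfc hinj
  -- Without a conjugate vector, the momentum descends to a one-form on position space. By the Gauss
  -- lemma it is the differential of `t₀ / 2 * B (ψ y) (ψ y)`, so its derivative is symmetric as a
  -- second derivative.
  set α : E → E →L[ℝ] ℝ := fun y => G y (Ξ (ψ y, t₀)) with hα
  have hαc : ContDiffAt ℝ 1 α (f v₀) := by
    refine ((hG.contDiffAt h.mem).of_le (by simp)).clm_apply ?_
    refine ContDiffAt.comp (g := fun v => Ξ (v, t₀)) (f v₀) ?_ hψ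
    rw [hψ0]; exact hΞc
  have hψt : Tendsto ψ (𝓝 (f v₀)) (𝓝 v₀) := by
    have := hψ.continuousAt.tendsto
    rwa [hψ0] at this
  have hQ : ∀ᶠ y in 𝓝 (f v₀), HasFDerivAt (fun y => t₀ / 2 * B (ψ y) (ψ y)) (α y) y := by
    filter_upwards [hψr.eventually_nhds, hψt.eventually hgauss, hψ.eventually (by simp),
      hψt.eventually (hfc.eventually (by simp))] with y h1 h2 h3 h4
    have hd := (h3.differentiableAt (by simp)).hasFDerivAt
    have hfd := (h4.differentiableAt (by simp)).hasFDerivAt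
    have hid : (fderiv ℝ f (ψ y)).comp (fderiv ℝ ψ y) = ContinuousLinearMap.id ℝ E := by
      refine HasFDerivAt.unique ((hfd.comp y hd).congr_of_eventuallyEq ?_) (hasFDerivAt_id y)
      exact h1.mono fun z hz => hz.symm
    refine ((((hasFDerivAt_const B y).clm_apply hd).clm_apply hd).const_mul
      (t₀ / 2)).congr_fderiv ?_
    ext w
    have hw : fderiv ℝ f (ψ y) (fderiv ℝ ψ y w) = w := DFunLike.congr_fun hid w
    have h5 := h2 (fderiv ℝ ψ y w)
    rw [hw] at h5
    have h6 : X (ψ y, t₀) = y := h1.self_of_nhds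
    rw [h6] at h5
    simp only [hα, h5]
    simp [hB (fderiv ℝ ψ y w)]
    ring
  have hα' := (hαc.differentiableAt (by simp)).hasFDerivAt
  have hsym := second_derivative_symmetric_of_eventually hQ hα'
  have hmom : HasFDerivAt (fun v => G (X (v, t₀)) (Ξ (v, t₀)))
      ((fderiv ℝ α (f v₀)).comp (fderiv ℝ f v₀)) v₀ := by
    refine (hα'.comp v₀ (hfc.differentiableAt (by simp)).hasFDerivAt).congr_of_eventuallyEq ?_
    filter_upwards [hψl] with v hv
    have hv' : ψ (X (v, t₀)) = v := hv
    simp only [Function.comp_apply, hα, hf, hv']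
  rw [hmom.fderiv]
  exact hsym _ _

/-- The Riccati equation for the second fundamental form of the wave fronts. -/
theorem hasDerivAt_riccati (hG : IsLocalMetric V G) (h : IsGeodesicFamilyAt V G X Ξ (v₀, t₀))
    (hsym : ∀ b c, fderiv ℝ (fun v => G (X (v, t₀)) (Ξ (v, t₀))) v₀ b
        (fderiv ℝ (fun v => X (v, t₀)) v₀ c) =
      fderiv ℝ (fun v => G (X (v, t₀)) (Ξ (v, t₀))) v₀ c (fderiv ℝ (fun v => X (v, t₀)) v₀ b))
    (hinj : Function.Injective (fderiv ℝ (fun v => X (v, t₀)) v₀)) (x : E) :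
    ∃ k, HasDerivAt (fun t => fderiv ℝ (fun v => G (X (v, t)) (Ξ (v, t))) v₀
        ((fderiv ℝ (fun v => X (v, t)) v₀).inverse x) x)
      (fderiv ℝ (fderiv ℝ G) (X (v₀, t₀)) x x (Ξ (v₀, t₀)) (Ξ (v₀, t₀)) / 2 - G (X (v₀, t₀)) k k)
      t₀ := by
  have hinv := isInvertible_of_injective hinj
  set J : ℝ → E →L[ℝ] E := fun t => fderiv ℝ (fun v => X (v, t)) v₀ with hJ
  set K := fderiv ℝ (fun v => Ξ (v, t₀)) v₀ with hK
  set P := fderiv ℝ (fun v => G (X (v, t₀)) (Ξ (v, t₀))) v₀ with hP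
  have hJd : HasDerivAt J K t₀ := h.hasDerivAt_jacobi
  have hJi : DifferentiableAt ℝ (fun t => (J t).inverse) t₀ :=
    DifferentiableAt.comp (g := ContinuousLinearMap.inverse) t₀
      ((hinv.contDiffAt_map_inverse (n := 1)).differentiableAt (by simp)) hJd.differentiableAt
  set b : ℝ → E := fun t => (J t).inverse x with hb
  have hbd : DifferentiableAt ℝ b t₀ := hJi.clm_apply (differentiableAt_const x)
  have hev : ∀ᶠ t in 𝓝 t₀, (J t).IsInvertible := by
    obtain ⟨κ, hκ, hκ'⟩ := eventually_le_norm_of_injective hJd.continuousAt hinj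
    filter_upwards [hκ'] with t ht
    refine isInvertible_of_injective ((injective_iff_map_eq_zero _).2 fun c hc => ?_)
    have := ht c
    rw [hc, norm_zero] at this
    exact norm_le_zero_iff.1 (by nlinarith)
  -- This is the derivative of the identity `J b = x`; it trades the derivative of `b` for `-J⁻¹ K
  -- b`.
  have hJb : K (b t₀) + J t₀ (deriv b t₀) = 0 := by
    have h1 := hJd.clm_apply hbd.hasDerivAt
    refine h1.unique ((hasDerivAt_const t₀ x).congr_of_eventuallyEq ?_)
    filter_upwards [hev] with t ht
    exact ht.self_apply_inverse x
  have hx : J t₀ (b t₀) = x := hinv.self_apply_inverse x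
  refine ⟨K (b t₀), ?_⟩
  have h2 := ((h.hasDerivAt_fderiv_momentum hG).clm_apply hbd.hasDerivAt).clm_apply
    (hasDerivAt_const t₀ x)
  refine h2.congr_deriv ?_
  -- Symmetry moves the derivative of `b` into the other slot. There it becomes `-K b`, which
  -- produces the square `-G(k, k)` with `k = K b`, and the terms with a first derivative of `G`
  -- cancel against those of the force.
  have h3 := hsym (deriv b t₀) (b t₀)
  change P (deriv b t₀) (J t₀ (b t₀)) = P (b t₀) (J t₀ (deriv b t₀)) at h3
  rw [eq_neg_of_add_eq_zero_right hJb, map_neg, hP, h.fderiv_momentum_apply hG (b t₀)] at h3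
  have h4 := h.fderiv_force_apply hG (b t₀) x
  have hx' : fderiv ℝ (fun v => X (v, t₀)) v₀ (b t₀) = x := hx
  rw [hx'] at h3 h4
  simp only [map_zero, add_zero, ContinuousLinearMap.add_apply]
  change fderiv ℝ (fun v => forceForm G (X (v, t₀)) (Ξ (v, t₀))) v₀ (b t₀) x
    + P (deriv b t₀) x = _
  rw [h3, h4]
  simp only [← hK]
  ring

/-- In the Riccati equation the quadratic term has a favourable sign and can be dropped, so the
second fundamental form stays bounded above to the right of `t₁`. This controls the logarithmic
growth of Jacobi fields. The constant involves only the listed bounds, so it is uniform over nearby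
geodesics even when their conjugate points come close. -/
theorem riccati_le (hG : IsLocalMetric V G) {a b C κ κ₁ t₁ : ℝ} (ht₁ : t₁ ∈ Ioo a b) (hκ : 0 < κ)
    (hκ₁ : 0 < κ₁) (hC : 0 < C)
    (h : ∀ t ∈ Ioo a b, IsGeodesicFamilyAt V G X Ξ (v₀, t))
    (hB : ∀ a b, B a b = B b a)
    (hgauss : ∀ t ∈ Ioo a b, ∀ᶠ v in 𝓝 v₀, ∀ c,
      G (X (v, t)) (Ξ (v, t)) (fderiv ℝ (fun v => X (v, t)) v c) = t * B v c)
    (hinj : ∀ t ∈ Ioo a b, Function.Injective (fderiv ℝ (fun v => X (v, t)) v₀))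
    (h1 : ∀ t ∈ Ioo a b, ‖fderiv ℝ G (X (v₀, t))‖ ≤ C)
    (h2 : ∀ t ∈ Ioo a b, ‖fderiv ℝ (fderiv ℝ G) (X (v₀, t))‖ ≤ C)
    (h3 : ∀ t ∈ Ioo a b, ‖Ξ (v₀, t)‖ ≤ C)
    (h4 : ‖fderiv ℝ (fun v => G (X (v, t₁)) (Ξ (v, t₁))) v₀‖ ≤ C)
    (h5 : ∀ t ∈ Ioo a b, ∀ u, κ * ‖u‖ ^ 2 ≤ G (X (v₀, t)) u u)
    (h6 : ∀ c, κ₁ * ‖c‖ ≤ ‖fderiv ℝ (fun v => X (v, t₁)) v₀ c‖)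
    {s t : ℝ} (hs : s ∈ Icc t₁ t) (ht : t < b) (c : E) :
    G (X (v₀, t)) (fderiv ℝ (fun v => X (v, t)) v₀ c) (fderiv ℝ (fun v => X (v, t)) v₀ c) ≤
      Real.exp ((3 * C ^ 2 + 2 * (C / κ₁ + C ^ 3 * (b - a))) / κ * (t - s)) *
      G (X (v₀, s)) (fderiv ℝ (fun v => X (v, s)) v₀ c) (fderiv ℝ (fun v => X (v, s)) v₀ c) := by
  set P : ℝ → E →L[ℝ] E →L[ℝ] ℝ := fun t => fderiv ℝ (fun v => G (X (v, t)) (Ξ (v, t))) v₀ with hP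
  set J : ℝ → E →L[ℝ] E := fun t => fderiv ℝ (fun v => X (v, t)) v₀ with hJ
  -- The first summand bounds the form at `t₁`, where `J⁻¹` has norm at most `1 / κ₁`; the second
  -- bounds its later increase, since the source term of the Riccati equation is at most `C ^ 3 *
  -- ‖x‖ ^ 2`.
  set C₂ := C / κ₁ + C ^ 3 * (b - a) with hC₂
  have hab : 0 < b - a := by linarith [ht₁.1, ht₁.2]
  have hC₂0 : 0 ≤ C₂ := by positivity
  have key : ∀ x, ∀ t ∈ Ico t₁ b, P t ((J t).inverse x) x ≤ C₂ * ‖x‖ ^ 2 := by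
    intro x t ht
    choose! k hk using fun r (hr : r ∈ Ioo a b) => (h r hr).hasDerivAt_riccati hG
      ((h r hr).momentum_symm hG hB (hgauss r hr) (hinj r hr)) (hinj r hr) x
    have hle := image_le_add_of_hasDerivAt_le hk (C := C ^ 3 * ‖x‖ ^ 2) (fun r hr => by
      have e1 := hG.nonneg (h r hr).mem (k r)
      have e2 : |fderiv ℝ (fderiv ℝ G) (X (v₀, r)) x x (Ξ (v₀, r)) (Ξ (v₀, r))| ≤
          C * ‖x‖ * ‖x‖ * C * C := by
        calc _ ≤ ‖fderiv ℝ (fderiv ℝ G) (X (v₀, r)) x x (Ξ (v₀, r))‖ * ‖Ξ (v₀, r)‖ :=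
              ContinuousLinearMap.le_opNorm _ _
          _ ≤ ‖fderiv ℝ (fderiv ℝ G) (X (v₀, r)) x x‖ * ‖Ξ (v₀, r)‖ * ‖Ξ (v₀, r)‖ := by
              gcongr; exact ContinuousLinearMap.le_opNorm _ _
          _ ≤ ‖fderiv ℝ (fderiv ℝ G) (X (v₀, r)) x‖ * ‖x‖ * ‖Ξ (v₀, r)‖ * ‖Ξ (v₀, r)‖ := by
              gcongr; exact ContinuousLinearMap.le_opNorm _ _
          _ ≤ ‖fderiv ℝ (fderiv ℝ G) (X (v₀, r))‖ * ‖x‖ * ‖x‖ * ‖Ξ (v₀, r)‖ * ‖Ξ (v₀, r)‖ := by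
              gcongr; exact ContinuousLinearMap.le_opNorm _ _
          _ ≤ _ := by
              gcongr
              · exact h2 r hr
              · exact h3 r hr
              · exact h3 r hr
      have e3 := (abs_le.1 e2).2
      have e4 : 0 ≤ C ^ 3 * ‖x‖ ^ 2 := by positivity
      nlinarith) ht₁ ⟨by linarith [ht₁.1, ht.1], ht.2⟩ ht.1
    change P t ((J t).inverse x) x ≤ P t₁ ((J t₁).inverse x) x + _ at hle
    have hb1 : κ₁ * ‖(J t₁).inverse x‖ ≤ ‖x‖ := by
      have := h6 ((J t₁).inverse x)
      rwa [show fderiv ℝ (fun v => X (v, t₁)) v₀ ((J t₁).inverse x) = x from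
        (isInvertible_of_injective (hinj t₁ ht₁)).self_apply_inverse x] at this
    have hb2 : ‖(J t₁).inverse x‖ ≤ ‖x‖ / κ₁ := by
      rw [le_div_iff₀ hκ₁]; linarith
    have hp : P t₁ ((J t₁).inverse x) x ≤ C * (‖x‖ / κ₁) * ‖x‖ := by
      calc _ ≤ ‖P t₁ ((J t₁).inverse x) x‖ := le_abs_self _
        _ ≤ ‖P t₁‖ * ‖(J t₁).inverse x‖ * ‖x‖ := (P t₁).le_opNorm₂ _ _
        _ ≤ _ := by gcongr
    have hq : C ^ 3 * ‖x‖ ^ 2 * (t - t₁) ≤ C ^ 3 * ‖x‖ ^ 2 * (b - a) := by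
      gcongr
      · exact ht.2.le
      · exact ht₁.1.le
    calc _ ≤ C * (‖x‖ / κ₁) * ‖x‖ + C ^ 3 * ‖x‖ ^ 2 * (b - a) := by linarith
      _ = _ := by rw [hC₂]; ring
  set m' : ℝ → ℝ := fun t => fderiv ℝ G (X (v₀, t)) (Ξ (v₀, t)) (J t c) (J t c)
    + G (X (v₀, t)) (fderiv ℝ (fun v => Ξ (v, t)) v₀ c) (J t c)
    + G (X (v₀, t)) (J t c) (fderiv ℝ (fun v => Ξ (v, t)) v₀ c) with hm'
  have hm : ∀ r ∈ Ioo a b, HasDerivAt (fun t => G (X (v₀, t)) (J t c) (J t c)) (m' r) r := by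
    intro r hr
    have hd : HasDerivAt (fun t => J t c) (fderiv ℝ (fun v => Ξ (v, r)) v₀ c) r := by
      simpa using (h r hr).hasDerivAt_jacobi.clm_apply (hasDerivAt_const r c)
    exact (h r hr).hasDerivAt_apply hG hd hd
  have hsI : s ∈ Ioo a b := ⟨by linarith [ht₁.1, hs.1], by linarith [hs.2]⟩
  obtain rfl | hst := hs.2.eq_or_lt
  · simp
  -- work on an interval that starts after `t₁`; the endpoint is treated by continuity
  have main : ∀ s' ∈ Ioo t₁ t, G (X (v₀, t)) (J t c) (J t c) ≤
      Real.exp ((3 * C ^ 2 + 2 * C₂) / κ * (t - s')) * G (X (v₀, s')) (J s' c) (J s' c) := by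
    intro s' hs'
    refine image_le_mul_exp_of_hasDerivAt_le (f' := m') (a := t₁) (b := b)
      (fun r hr => hm r ⟨by linarith [ht₁.1, hr.1], hr.2⟩) (fun r hr => ?_)
      ⟨hs'.1, by linarith [hs'.2]⟩ ⟨by linarith [hs'.1, hs'.2], ht⟩ hs'.2.le
    have hr' : r ∈ Ioo a b := ⟨by linarith [ht₁.1, hr.1], hr.2⟩
    have hinvr : (J r).inverse (J r c) = c :=
      (isInvertible_of_injective (hinj r hr')).inverse_apply_self c
    -- With `x = J c`, the form is `P c (J c)`, which differs from `G(K c, J c)` by one derivative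
    -- of `G`. That term enters `m'` twice, and one more derivative of `G` comes from the moving
    -- base point; hence `3 * C ^ 2` next to `2 * C₂`.
    have e1 := key (J r c) r ⟨hr.1.le, hr.2⟩
    rw [hinvr] at e1
    have e2 := (h r hr').fderiv_momentum_apply hG c (J r c)
    change P r c (J r c) = fderiv ℝ G _ (J r c) _ _ + _ at e2
    rw [e2] at e1
    have hd3 : ∀ x y z : E, |fderiv ℝ G (X (v₀, r)) x y z| ≤ C * ‖x‖ * ‖y‖ * ‖z‖ := fun x y z => by
      calc _ ≤ ‖fderiv ℝ G (X (v₀, r)) x y‖ * ‖z‖ := ContinuousLinearMap.le_opNorm _ _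
          _ ≤ ‖fderiv ℝ G (X (v₀, r))‖ * ‖x‖ * ‖y‖ * ‖z‖ := by
            gcongr; exact ContinuousLinearMap.le_opNorm₂ _ _ _
          _ ≤ _ := by
              gcongr
              exact h1 r hr'
    have e3 := (abs_le.1 (hd3 (Ξ (v₀, r)) (J r c) (J r c))).2
    have e4 := (abs_le.1 (hd3 (J r c) (Ξ (v₀, r)) (J r c))).1
    have e5 := h3 r hr'
    have e6 : C * ‖Ξ (v₀, r)‖ * ‖J r c‖ * ‖J r c‖ ≤ C * C * ‖J r c‖ * ‖J r c‖ := by gcongr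
    have e7 := h5 r hr' (J r c)
    have e8 := hG.symm _ (h r hr').mem (J r c) (fderiv ℝ (fun v => Ξ (v, r)) v₀ c)
    have e9 : m' r ≤ (3 * C ^ 2 + 2 * C₂) * ‖J r c‖ ^ 2 := by
      simp only [hm', e8]
      nlinarith
    have e10 : (3 * C ^ 2 + 2 * C₂) / κ * (κ * ‖J r c‖ ^ 2) ≤
        (3 * C ^ 2 + 2 * C₂) / κ * G (X (v₀, r)) (J r c) (J r c) := by gcongr
    have e11 : (3 * C ^ 2 + 2 * C₂) / κ * (κ * ‖J r c‖ ^ 2) = (3 * C ^ 2 + 2 * C₂) * ‖J r c‖ ^ 2 := by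
      field_simp
    linarith
  have hlim : Tendsto (fun s' => Real.exp ((3 * C ^ 2 + 2 * C₂) / κ * (t - s')) *
      G (X (v₀, s')) (J s' c) (J s' c)) (𝓝[>] s)
      (𝓝 (Real.exp ((3 * C ^ 2 + 2 * C₂) / κ * (t - s)) * G (X (v₀, s)) (J s c) (J s c))) := by
    refine Tendsto.mono_left ?_ nhdsWithin_le_nhds
    refine ContinuousAt.mul ?_ (hm s hsI).continuousAt
    fun_prop
  refine ge_of_tendsto hlim ?_
  filter_upwards [Ioo_mem_nhdsGT hst] with s' hs'
  exact main s' ⟨lt_of_le_of_lt hs.1 hs'.1, hs'.2⟩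

end IsGeodesicFamilyAt

end Starshaped

end

/-! ### Limits of geodesics without conjugate points. -/

noncomputable section

namespace Starshaped

namespace IsGeodesicFamilyAt

theorem continuousAt_fderiv_left {U F : Type*} [NormedAddCommGroup U] [NormedSpace ℝ U]
    [NormedAddCommGroup F] [NormedSpace ℝ F] {f : U × ℝ → F} {z₀ : U × ℝ}
    (hf : ContDiffAt ℝ 1 f z₀) :
    ContinuousAt (fun z : U × ℝ => fderiv ℝ (fun v => f (v, z.2)) z.1) z₀ := by
  have h1 : ContinuousAt (fun z => (fderiv ℝ f z).comp (ContinuousLinearMap.inl ℝ U ℝ)) z₀ :=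
    (hf.fderiv_right (m := 0) (by simp)).continuousAt.clm_comp continuousAt_const
  refine h1.congr ?_
  filter_upwards [hf.eventually (by simp)] with z hz
  exact (hasFDerivAt_left (hz.differentiableAt (by simp)).hasFDerivAt).fderiv.symm

variable {E : Type*} [NormedAddCommGroup E] [NormedSpace ℝ E] [FiniteDimensional ℝ E]
  {V : Set E} {G : E → E →L[ℝ] E →L[ℝ] ℝ} {X Ξ : E × ℝ → E} {v₀ : E} {t₀ : ℝ}
  {B : E →L[ℝ] E →L[ℝ] ℝ}

/-- A Jacobi field that vanishes on one side of `t₀` vanishes on the other side. -/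
theorem eventually_jacobi_eq_zero (hG : IsLocalMetric V G)
    (h : IsGeodesicFamilyAt V G X Ξ (v₀, t₀)) {c : E}
    (hc : ∀ᶠ t in 𝓝[≥] t₀, fderiv ℝ (fun v => X (v, t)) v₀ c = 0) :
    ∀ᶠ t in 𝓝 t₀, fderiv ℝ (fun v => X (v, t)) v₀ c = 0 := by
  set J : ℝ → E →L[ℝ] E := fun t => fderiv ℝ (fun v => X (v, t)) v₀ with hJ
  set K : ℝ → E →L[ℝ] E := fun t => fderiv ℝ (fun v => Ξ (v, t)) v₀ with hK
  have hcont : ContinuousAt (fun t : ℝ => (v₀, t)) t₀ := by fun_prop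
  set D : ℝ → E × E →L[ℝ] E := fun t => fderiv ℝ (fun q : E × E => spray G q.1 q.2)
    (X (v₀, t), Ξ (v₀, t)) with hD
  have hDc : ContinuousAt D t₀ := by
    have h1 : ContDiffAt ℝ ∞ (fderiv ℝ (fun q : E × E => spray G q.1 q.2))
        (X (v₀, t₀), Ξ (v₀, t₀)) := (hG.contDiffAt_spray (z := (X (v₀, t₀), Ξ (v₀, t₀)))
          h.mem).fderiv_right (by simp)
    exact ContinuousAt.comp (f := fun t => (X (v₀, t), Ξ (v₀, t))) h1.continuousAt
      (h.hasDerivAt.self_of_nhds.continuousAt.prodMk h.hasDerivAt_vel.self_of_nhds.continuousAt)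
  obtain ⟨C, hC, hC'⟩ := eventually_norm_le hDc
  have hfam : ∀ᶠ t in 𝓝 t₀, IsGeodesicFamilyAt V G X Ξ (v₀, t) :=
    hcont.eventually (h.eventually hG)
  have hd : ∀ᶠ t in 𝓝 t₀, HasDerivAt (fun t => (J t c, K t c)) (K t c, D t (J t c, K t c)) t := by
    filter_upwards [hfam] with t ht
    have e1 : HasDerivAt (fun t => J t c) (K t c) t := by
      simpa using ht.hasDerivAt_jacobi.clm_apply (hasDerivAt_const t c)
    have e2 : HasDerivAt (fun t => K t c) (D t (J t c, K t c)) t := by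
      have := (ht.hasDerivAt_fderiv_vel hG).clm_apply (hasDerivAt_const t c)
      rw [ht.fderiv_spray_apply hG, map_zero, add_zero] at this
      exact this
    exact e1.prodMk e2
  have hJ0 : J t₀ c = 0 := hc.self_of_nhdsWithin self_mem_Ici
  -- The derivative of `J c` at `t₀` can be computed from the right. Thus position and velocity of
  -- the Jacobi field both vanish at `t₀`, and Grönwall for the linear equation applies on both
  -- sides.
  have hK0 : K t₀ c = 0 := by
    have e1 : HasDerivAt (fun t => J t c) (K t₀ c) t₀ := by
      simpa using h.hasDerivAt_jacobi.clm_apply (hasDerivAt_const t₀ c)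
    have e2 : HasDerivWithinAt (fun t => J t c) 0 (Ici t₀) t₀ :=
      (hasDerivWithinAt_const t₀ (Ici t₀) (0 : E)).congr_of_eventuallyEq hc hJ0
    exact (uniqueDiffWithinAt_Ici t₀).eq_deriv _ e1.hasDerivWithinAt e2
  obtain ⟨δ, hδ, hδ'⟩ := Metric.eventually_nhds_iff.1 (hd.and hC')
  have hsub : ∀ s ∈ Ioo (-δ) δ, dist (t₀ + s) t₀ < δ := fun s hs => by
    rw [Real.dist_eq, add_sub_cancel_left, abs_lt]; exact hs
  have hz : ∀ s ∈ Ioo (-δ) δ, ‖(J (t₀ + s) c, K (t₀ + s) c)‖ ≤ 0 := fun s hs => by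
    have := norm_le_mul_of_norm_deriv_le (K := C + 1) (c := 0) (δ := δ) (by positivity) le_rfl
      (e := fun s => (J (t₀ + s) c, K (t₀ + s) c))
      (e' := fun s => (K (t₀ + s) c, D (t₀ + s) (J (t₀ + s) c, K (t₀ + s) c))) (fun r hr => by
        exact HasDerivAt.comp_const_add (f := fun t => (J t c, K t c)) t₀ r (hδ' (hsub r hr)).1)
      (by simp [hJ0, hK0]) (fun r hr => by
        have h2 := (hδ' (hsub r hr)).2
        have h3 : ‖D (t₀ + r) (J (t₀ + r) c, K (t₀ + r) c)‖ ≤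
            C * ‖(J (t₀ + r) c, K (t₀ + r) c)‖ := (ContinuousLinearMap.le_opNorm _ _).trans (by gcongr)
        have h4 : ‖K (t₀ + r) c‖ ≤ ‖(J (t₀ + r) c, K (t₀ + r) c)‖ :=
          norm_snd_le (J (t₀ + r) c, K (t₀ + r) c)
        have h5 := norm_nonneg (J (t₀ + r) c, K (t₀ + r) c)
        rw [Prod.norm_def]
        refine max_le ?_ ?_ <;> nlinarith) hs
    simpa using this
  filter_upwards [Metric.ball_mem_nhds t₀ hδ] with t ht
  have := hz (t - t₀) (by
    rw [Metric.mem_ball, Real.dist_eq, abs_lt] at ht; exact ht)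
  rw [add_sub_cancel] at this
  exact congrArg Prod.fst (norm_le_zero_iff.1 this)

/-- Limits of geodesics without conjugate points have no first conjugate point in the interior. -/
theorem injective_of_mem_closure (hG : IsLocalMetric V G)
    (h : IsGeodesicFamilyAt V G X Ξ (v₀, t₀)) (hB : ∀ a b, B a b = B b a)
    (hgauss : ∀ᶠ z : E × ℝ in 𝓝 (v₀, t₀), ∀ c,
      G (X z) (Ξ z) (fderiv ℝ (fun v => X (v, z.2)) z.1 c) = z.2 * B z.1 c)
    {A : Set E} (hA : v₀ ∈ closure A) {a b : ℝ} (ht₀ : t₀ ∈ Ioo a b)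
    (hinjA : ∀ v ∈ A, ∀ t ∈ Ioo a b, Function.Injective (fderiv ℝ (fun v => X (v, t)) v))
    (hinj : ∀ t ∈ Ioo a t₀, Function.Injective (fderiv ℝ (fun v => X (v, t)) v₀)) :
    Function.Injective (fderiv ℝ (fun v => X (v, t₀)) v₀) := by
  obtain ⟨C₁, hC₁, h1⟩ := eventually_norm_le (A := fun z => fderiv ℝ G (X z)) (z₀ := (v₀, t₀))
    (ContinuousAt.comp (hG.contDiffAt_fderiv h.mem).continuousAt h.contDiffAt.continuousAt)
  obtain ⟨C₂, hC₂, h2⟩ := eventually_norm_le (A := fun z => fderiv ℝ (fderiv ℝ G) (X z))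
    (z₀ := (v₀, t₀)) (ContinuousAt.comp ((hG.contDiffAt_fderiv h.mem).fderiv_right (m := ∞)
      (by simp)).continuousAt h.contDiffAt.continuousAt)
  obtain ⟨C₃, hC₃, h3⟩ := eventually_norm_le h.contDiffAt_vel.continuousAt
  obtain ⟨C₄, hC₄, h4⟩ := eventually_norm_le (continuousAt_fderiv_left (h.contDiffAt_momentum hG))
  obtain ⟨C₅, hC₅, h5⟩ := eventually_norm_le (A := fun z => G (X z)) (z₀ := (v₀, t₀))
    (ContinuousAt.comp (hG.contDiffAt h.mem).continuousAt h.contDiffAt.continuousAt)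
  obtain ⟨κ, hκ, h6⟩ := hG.eventually_le h.mem
  have h6 := h.contDiffAt.continuousAt.eventually h6
  have hall := (h.eventually hG).and (hgauss.eventually_nhds.and
    (h1.and (h2.and (h3.and (h4.and (h5.and h6))))))
  obtain ⟨r, hr, hr'⟩ := Metric.eventually_nhds_iff.1 hall
  set a' := max a (t₀ - r) with ha'
  set b' := min b (t₀ + r) with hb'
  have hat : a' < t₀ := max_lt ht₀.1 (by linarith)
  have htb : t₀ < b' := lt_min ht₀.2 (by linarith)
  have haa : a ≤ a' := le_max_left _ _
  have hbb : b' ≤ b := min_le_left _ _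
  have har : t₀ - r ≤ a' := le_max_right _ _
  have hbr : b' ≤ t₀ + r := min_le_right _ _
  have hin : ∀ v ∈ Metric.ball v₀ r, ∀ t ∈ Ioo a' b', dist ((v, t) : E × ℝ) (v₀, t₀) < r := by
    intro v hv t ht
    rw [Prod.dist_eq, max_lt_iff]
    refine ⟨hv, ?_⟩
    rw [Real.dist_eq, abs_lt]
    exact ⟨by linarith [ht.1], by linarith [ht.2]⟩
  -- The Riccati estimate starts at a time before `t₀`, where `J` is still injective for the limit
  -- geodesic and hence uniformly so for the nearby ones.
  obtain ⟨t₁, ht₁⟩ := exists_between hat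
  have ht₁I : t₁ ∈ Ioo a' b' := ⟨ht₁.1, ht₁.2.trans htb⟩
  have hfam₁ := (hr' (hin v₀ (Metric.mem_ball_self hr) t₁ ht₁I)).1
  obtain ⟨κ₁, hκ₁, h7⟩ := eventually_le_norm_of_injective
    (A := fun v => fderiv ℝ (fun v => X (v, t₁)) v) (z₀ := v₀)
    (ContinuousAt.comp (f := fun v : E => (v, t₁)) (continuousAt_fderiv_left hfam₁.contDiffAt)
      (by fun_prop)) (hinj t₁ ⟨by linarith [ht₁.1], ht₁.2⟩)
  set C := C₁ + C₂ + C₃ + C₄ with hC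
  have hC0 : 0 < C := by positivity
  set L := (3 * C ^ 2 + 2 * (C / κ₁ + C ^ 3 * (b' - a'))) / κ with hL
  have hev : ∃ᶠ v in 𝓝 v₀, ∀ t ∈ Ico t₀ b', ∀ c,
      G (X (v, t)) (fderiv ℝ (fun v => X (v, t)) v c) (fderiv ℝ (fun v => X (v, t)) v c) ≤
      Real.exp (L * (t - t₀)) * G (X (v, t₀)) (fderiv ℝ (fun v => X (v, t₀)) v c)
        (fderiv ℝ (fun v => X (v, t₀)) v c) := by
    have hfr : ∃ᶠ v in 𝓝 v₀, v ∈ A := mem_closure_iff_frequently.1 hA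
    refine (hfr.and_eventually (h7.and (Metric.ball_mem_nhds v₀ hr))).mono ?_
    rintro v ⟨hvA, hv7, hvr⟩ t ht c
    refine riccati_le (B := B) hG ht₁I hκ hκ₁ hC0 (fun t ht => (hr' (hin v hvr t ht)).1) hB
      (fun t ht => ?_) (fun t ht => hinjA v hvA t ⟨by linarith [ht.1], by linarith [ht.2]⟩)
      (fun t ht => ?_) (fun t ht => ?_) (fun t ht => ?_) ?_ (fun t ht => ?_) hv7
      ⟨ht₁.2.le, ht.1⟩ ht.2 c
    · have := (hr' (hin v hvr t ht)).2.1
      have hc : ContinuousAt (fun v : E => (v, t)) v := by fun_prop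
      exact hc.eventually this
    · exact (hr' (hin v hvr t ht)).2.2.1.trans (by linarith)
    · exact (hr' (hin v hvr t ht)).2.2.2.1.trans (by linarith)
    · exact (hr' (hin v hvr t ht)).2.2.2.2.1.trans (by linarith)
    · exact (hr' (hin v hvr t₁ ht₁I)).2.2.2.2.2.1.trans (by linarith)
    · exact (hr' (hin v hvr t ht)).2.2.2.2.2.2.2
  refine (injective_iff_map_eq_zero _).2 fun c hc => ?_
  have hball := Metric.mem_ball_self (x := v₀) hr
  -- The growth estimate passes to the limit `v₀` because its constant does not depend on `v`; its
  -- right side vanishes when `J(t₀) c = 0`.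
  have hzero : ∀ t ∈ Ico t₀ b', fderiv ℝ (fun v => X (v, t)) v₀ c = 0 := by
    intro t ht
    have htI : t ∈ Ioo a' b' := ⟨by linarith [ht.1], ht.2⟩
    have hc' : ∀ s ∈ Ioo a' b', ContinuousAt (fun v => G (X (v, s))
        (fderiv ℝ (fun v => X (v, s)) v c) (fderiv ℝ (fun v => X (v, s)) v c)) v₀ := by
      intro s hs
      have hf := (hr' (hin v₀ hball s hs)).1
      have hcs : ContinuousAt (fun v : E => (v, s)) v₀ := by fun_prop
      have e1 : ContinuousAt (fun v => G (X (v, s))) v₀ :=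
        ContinuousAt.comp (f := fun v => X (v, s)) (hG.contDiffAt hf.mem).continuousAt
          (ContinuousAt.comp (f := fun v : E => (v, s)) hf.contDiffAt.continuousAt hcs)
      have e2 : ContinuousAt (fun v => fderiv ℝ (fun v => X (v, s)) v c) v₀ :=
        (ContinuousAt.comp (f := fun v : E => (v, s)) (continuousAt_fderiv_left hf.contDiffAt)
          hcs).clm_apply continuousAt_const
      exact (e1.clm_apply e2).clm_apply e2
    have hle := le_of_tendsto_of_tendsto_of_frequently (hc' t htI)
      ((hc' t₀ ⟨hat, htb⟩).const_mul (Real.exp (L * (t - t₀)))) (hev.mono fun v hv => hv t ht c)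
    simp only [hc, map_zero, mul_zero] at hle
    by_contra hne
    exact absurd hle (not_le.2 (hG.pos _ (hr' (hin v₀ hball t htI)).1.mem _ hne))
  -- Vanishing to the right of `t₀` propagates to the left, where `J` is injective.
  have hev2 := h.eventually_jacobi_eq_zero hG (c := c)
    (by filter_upwards [Ico_mem_nhdsGE htb] with t ht using hzero t ht)
  have hlt : ∀ᶠ t in 𝓝[<] t₀, t ∈ Ioo a t₀ := Ioo_mem_nhdsLT ht₀.1
  obtain ⟨s, hs1, hs2⟩ := ((hev2.filter_mono nhdsWithin_le_nhds).and hlt).exists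
  exact (injective_iff_map_eq_zero _).1 (hinj s hs2) c hs1

end IsGeodesicFamilyAt

end Starshaped

end

/-! ### The differential of the exponential map: Gauss lemma and conjugate vectors. -/

noncomputable section

namespace Starshaped

variable {n : ℕ} {M : Type*} [TopologicalSpace M] [ChartedSpace (EuclideanSpace ℝ (Fin n)) M]
  [IsManifold (𝓡 n) ∞ M]

/-- The exponential map at `p`, in the preferred chart at `x₀`. -/
def chartExp (g : Metric n M) (p x₀ : M) (v : EuclideanSpace ℝ (Fin n)) :
    EuclideanSpace ℝ (Fin n) := extChartAt (𝓡 n) x₀ (expMap g p v)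

/-- The derivative of the exponential map, on the model space. -/
def dexp (g : Metric n M) (p : M) (v : EuclideanSpace ℝ (Fin n)) :
    EuclideanSpace ℝ (Fin n) →L[ℝ] EuclideanSpace ℝ (Fin n) :=
  fderiv ℝ (chartExp g p (expMap g p v)) v

/-- The vector `v` is not a conjugate vector of the exponential map at `p`. -/
def NonConj (g : Metric n M) (p : M) (v : EuclideanSpace ℝ (Fin n)) : Prop :=
  Function.Injective (dexp g p v)

section

variable {g : Metric n M} {p x₀ : M} {v a : EuclideanSpace ℝ (Fin n)} {t : ℝ}

theorem innerForm_symm (q : M) (u w : EuclideanSpace ℝ (Fin n)) :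
    innerForm g q u w = innerForm g q w u := g.symm q u w

theorem innerForm_pos (q : M) {u : EuclideanSpace ℝ (Fin n)} (hu : u ≠ 0) :
    0 < innerForm g q u u := g.pos q u hu

theorem chartDeriv_injective {q : M} (hq : q ∈ (extChartAt (𝓡 n) x₀).source) :
    Function.Injective (chartDeriv n x₀ q) := fun u w h => by
  rw [← chartSymmDeriv_chartDeriv hq u, h, chartSymmDeriv_chartDeriv hq]

variable [T2Space M] (hg : IsComplete g)
include hg

theorem contDiffAt_chartExp (hv : expMap g p v ∈ (extChartAt (𝓡 n) x₀).source) :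
    ContDiffAt ℝ 1 (chartExp g p x₀) v := by
  have h : geod g p v 1 ∈ (extChartAt (𝓡 n) x₀).source := by rwa [geod_one]
  have h1 := (goodAt hg h).slice.2
  have h2 : chartExp g p x₀ = fun u => (phase n x₀ (geod g p u) 1).1 := by
    funext u
    simp only [phase, geod_one, chartExp]
  rw [h2]
  exact contDiffAt_fst.comp v h1

theorem eventually_expMap_mem (hv : expMap g p v ∈ (extChartAt (𝓡 n) x₀).source) :
    ∀ᶠ u in 𝓝 v, expMap g p u ∈ (extChartAt (𝓡 n) x₀).source :=
  (continuous_expMap hg p).continuousAt.eventually ((isOpen_source x₀).mem_nhds hv)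

/-- `dexp` is taken in the chart at the image point, which moves with `v`; this transports it to a
fixed chart, where regularity in `v` makes sense. -/
theorem hasFDerivAt_chartExp (hv : expMap g p v ∈ (extChartAt (𝓡 n) x₀).source) :
    HasFDerivAt (chartExp g p x₀) ((chartDeriv n x₀ (expMap g p v)).comp (dexp g p v)) v := by
  have hs := mem_extChartAt_source (I := 𝓡 n) (expMap g p v)
  have h1 := (contDiffAt_chartExp hg hs).differentiableAt (by simp)
  have h2 := ((contDiffAt_transition hs hv).differentiableAt (by simp)).hasFDerivAt
  have h3 : HasFDerivAt (fun u => transition n (expMap g p v) x₀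
      (chartExp g p (expMap g p v) u)) _ v :=
    HasFDerivAt.comp (g := transition n (expMap g p v) x₀) v h2 h1.hasFDerivAt
  have h4 : HasFDerivAt (chartExp g p x₀) _ v := h3.congr_of_eventuallyEq (by
    filter_upwards [eventually_expMap_mem hg hs] with u hu
    simp only [transition, chartExp, (extChartAt (𝓡 n) (expMap g p v)).left_inv hu])
  refine h4.congr_fderiv ?_
  ext1 a
  have h5 := chartDeriv_eq_transition hs hv (dexp g p v a)
  rw [chartDeriv_self] at h5
  exact h5.symm

theorem fderiv_chartExp (hv : expMap g p v ∈ (extChartAt (𝓡 n) x₀).source) :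
    fderiv ℝ (chartExp g p x₀) v a = chartDeriv n x₀ (expMap g p v) (dexp g p v a) := by
  rw [(hasFDerivAt_chartExp hg hv).fderiv]; rfl

/-- The family is `u ↦ exp (t u)`, whence the factor `t`. For `t ≠ 0` it does not affect
injectivity, which is how conjugate vectors and degenerate Jacobi fields correspond. -/
theorem fderiv_posIn (hv : geod g p v t ∈ (extChartAt (𝓡 n) x₀).source) :
    fderiv ℝ (fun u => posIn n g p x₀ (u, t)) v a =
      t • chartDeriv n x₀ (geod g p v t) (dexp g p (t • v) a) := by
  have h1 := hasFDerivAt_chartExp hg (v := t • v) hv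
  have h2 : HasFDerivAt (fun u : EuclideanSpace ℝ (Fin n) => t • u)
      (t • ContinuousLinearMap.id ℝ (EuclideanSpace ℝ (Fin n))) v :=
    (hasFDerivAt_id v).const_smul t
  have h3 : HasFDerivAt (fun u => posIn n g p x₀ (u, t)) _ v :=
    HasFDerivAt.comp (f := fun u => t • u) v h1 h2
  rw [h3.fderiv]
  simp [geod]

theorem nonConj_iff (hv : expMap g p v ∈ (extChartAt (𝓡 n) x₀).source) :
    NonConj g p v ↔ Function.Injective (fderiv ℝ (chartExp g p x₀) v) := by
  rw [(hasFDerivAt_chartExp hg hv).fderiv]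
  exact ⟨fun h => (chartDeriv_injective hv).comp h, fun h => Function.Injective.of_comp h⟩

theorem NonConj.eventually (h : NonConj g p v) : ∀ᶠ u in 𝓝 v, NonConj g p u := by
  have hs := mem_extChartAt_source (I := 𝓡 n) (expMap g p v)
  obtain ⟨κ, hκ, hκ'⟩ := eventually_le_norm_of_injective
    ((contDiffAt_chartExp hg hs).fderiv_right (m := 0) (by simp)).continuousAt h
  filter_upwards [hκ', eventually_expMap_mem hg hs] with u hu hus
  rw [nonConj_iff hg hus, injective_iff_map_eq_zero]
  intro c hc
  have := hu c
  rw [hc, norm_zero] at this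
  exact norm_le_zero_iff.1 (by nlinarith)

/-- The velocity of a radial geodesic. -/
theorem velocityVec_geod (v : EuclideanSpace ℝ (Fin n)) (t : ℝ) :
    velocityVec n (geod g p v) t = dexp g p (t • v) v := by
  have hs := mem_extChartAt_source (I := 𝓡 n) (geod g p v t)
  have h1 := hasDerivAt_chart_comp ((isGeodesic_geod hg p v).mdifferentiableAt t) hs
  rw [chartDeriv_self] at h1
  have h2 := hasFDerivAt_chartExp hg (v := t • v) hs
  have h3 : HasDerivAt (fun s : ℝ => s • v) v t := by
    simpa using (hasDerivAt_id t).smul_const v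
  have h4 := h2.comp_hasDerivAt t h3
  rw [ContinuousLinearMap.comp_apply] at h4
  have h5 := chartDeriv_self (geod g p v t) (dexp g p (t • v) v)
  exact (h1.unique h4).trans h5

theorem velIn_eq (z : EuclideanSpace ℝ (Fin n) × ℝ) :
    velIn n g p x₀ z = chartDeriv n x₀ (geod g p z.1 z.2) (dexp g p (z.2 • z.1) z.1) := by
  rw [velIn, velocityVec_geod hg]

theorem dexp_zero : dexp g p 0 a = a := by
  have := velocityVec_geod (p := p) hg a 0
  rw [velocityVec_geod_zero hg, zero_smul] at this
  exact this.symm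

theorem nonConj_zero : NonConj g p 0 := fun u w h => by
  rwa [dexp_zero hg, dexp_zero hg] at h

/-- Geodesics have constant speed. -/
theorem innerForm_dexp_self (v : EuclideanSpace ℝ (Fin n)) (t : ℝ) :
    innerForm g (geod g p v t) (dexp g p (t • v) v) (dexp g p (t • v) v) = innerForm g p v v := by
  set e : ℝ → ℝ := fun t =>
    innerForm g (geod g p v t) (velocityVec n (geod g p v) t) (velocityVec n (geod g p v) t) with he
  have hd : ∀ t, HasDerivAt e 0 t := by
    intro t
    have hs := mem_extChartAt_source (I := 𝓡 n) (geod g p v t)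
    refine ((isGeodesicFamilyAt hg hs).hasDerivAt_energy
      (isLocalMetric g _)).congr_of_eventuallyEq ?_
    filter_upwards [(isGeodesic_geod hg p v).eventually_mem hs] with s hss
    exact innerForm_eq g hss _ _
  have := is_const_of_deriv_eq_zero (fun t => (hd t).differentiableAt) (fun t => (hd t).deriv) t 0
  simp only [he, velocityVec_geod hg, zero_smul, dexp_zero hg, geod_zero hg] at this
  exact this

theorem metricForm_velIn (hv : geod g p v t ∈ (extChartAt (𝓡 n) x₀).source) :
    metricForm g x₀ (posIn n g p x₀ (v, t)) (velIn n g p x₀ (v, t)) (velIn n g p x₀ (v, t)) =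
      innerForm g p v v := by
  rw [velIn_eq hg, ← innerForm_dexp_self hg v t, innerForm_eq g hv]
  rfl

/-- The Gauss lemma. -/
theorem innerForm_dexp (v a : EuclideanSpace ℝ (Fin n)) :
    innerForm g (expMap g p v) (dexp g p v v) (dexp g p v a) = innerForm g p v a := by
  -- The first variation makes `F` constant: the energy of the geodesic with initial velocity `u` is
  -- `g_p(u, u)` at every time, so half its derivative at `v` in direction `a` is `g_p(v, a)`. At
  -- time `0` the factor `t` kills `F`.
  set F : ℝ → ℝ := fun t => innerForm g (geod g p v t) (velocityVec n (geod g p v) t)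
    (t • dexp g p (t • v) a) - t * innerForm g p v a with hF
  have hd : ∀ t, HasDerivAt F 0 t := by
    intro t
    have hs := mem_extChartAt_source (I := 𝓡 n) (geod g p v t)
    have h1 := (isGeodesicFamilyAt hg hs).hasDerivAt_momentum_jacobi (isLocalMetric g _) a
    have h2 : HasFDerivAt (fun u => metricForm g (geod g p v t)
        (posIn n g p (geod g p v t) (u, t)) (velIn n g p (geod g p v t) (u, t))
        (velIn n g p (geod g p v t) (u, t)))
        (innerForm g p v + (innerForm g p).flip v) v := by
      have h3 : HasFDerivAt (fun u => innerForm g p u u)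
          (innerForm g p v + (innerForm g p).flip v) v := by
        refine (((innerForm g p).hasFDerivAt).clm_apply (hasFDerivAt_id v)).congr_fderiv ?_
        ext w; simp
      refine h3.congr_of_eventuallyEq ?_
      filter_upwards [(goodAt hg hs).slice.1] with u hu
      exact metricForm_velIn hg hu
    rw [h2.fderiv] at h1
    have h4 : (innerForm g p v + (innerForm g p).flip v) a / 2 = innerForm g p v a := by
      simp [innerForm_symm p a v]
    rw [h4] at h1
    have h5 : HasDerivAt (fun s : ℝ => s * innerForm g p v a) (innerForm g p v a) t := by
      simpa using (hasDerivAt_id t).mul_const (innerForm g p v a)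
    refine ((h1.sub h5).congr_of_eventuallyEq ?_).congr_deriv (sub_self _)
    filter_upwards [(isGeodesic_geod hg p v).eventually_mem hs] with s hss
    simp only [hF, Pi.sub_apply]
    rw [fderiv_posIn hg hss, innerForm_eq g hss, map_smul]
    rfl
  have := is_const_of_deriv_eq_zero (fun t => (hd t).differentiableAt) (fun t => (hd t).deriv) 1 0
  simp only [hF, velocityVec_geod hg, geod_one, one_smul, zero_smul, map_zero, zero_mul, sub_zero,
    one_mul] at this
  exact sub_eq_zero.1 this

theorem metricForm_gauss (hv : geod g p v t ∈ (extChartAt (𝓡 n) x₀).source)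
    (c : EuclideanSpace ℝ (Fin n)) :
    metricForm g x₀ (posIn n g p x₀ (v, t)) (velIn n g p x₀ (v, t))
      (fderiv ℝ (fun u => posIn n g p x₀ (u, t)) v c) = t * innerForm g p v c := by
  rw [velIn_eq hg, fderiv_posIn hg hv, map_smul]
  have h1 := innerForm_dexp hg (p := p) (t • v) c
  change innerForm g (geod g p v t) _ _ = _ at h1
  rw [innerForm_eq g hv] at h1
  simp only [map_smul, ContinuousLinearMap.smul_apply, smul_eq_mul] at h1 ⊢
  exact h1

theorem nonConj_smul_iff (ht : t ≠ 0) (hv : geod g p v t ∈ (extChartAt (𝓡 n) x₀).source) :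
    NonConj g p (t • v) ↔ Function.Injective (fderiv ℝ (fun u => posIn n g p x₀ (u, t)) v) := by
  rw [nonConj_iff hg (x₀ := x₀) hv, injective_iff_map_eq_zero, injective_iff_map_eq_zero]
  refine forall_congr' fun a => ?_
  rw [fderiv_posIn hg hv, fderiv_chartExp hg hv, smul_eq_zero]
  simp [ht, geod]

/-- A limit of geodesics without conjugate points has no conjugate points in its interior. -/
theorem nonConj_of_mem_closure
    (hv : v ∈ closure {u | ∀ t ∈ Icc (0 : ℝ) 1, NonConj g p (t • u)}) :
    ∀ t ∈ Ico (0 : ℝ) 1, NonConj g p (t • v) := by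
  by_contra! hcon
  obtain ⟨t', ht', hct'⟩ := hcon
  have hcv : Continuous fun t : ℝ => t • v := by fun_prop
  set Z : Set ℝ := {t | t ∈ Icc (0 : ℝ) 1 ∧ ¬ NonConj g p (t • v)} with hZ
  have hZc : IsClosed Z := by
    refine isClosed_Icc.inter (isOpen_compl_iff.1 (isOpen_iff_mem_nhds.2 fun t ht => ?_))
    have ht : NonConj g p (t • v) := not_not.1 ht
    filter_upwards [hcv.continuousAt.eventually (ht.eventually hg)] with s hs
    exact not_not.2 hs
  have hZne : Z.Nonempty := ⟨t', ⟨ht'.1, ht'.2.le⟩, hct'⟩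
  have hZb : BddBelow Z := ⟨0, fun t ht => ht.1.1⟩
  -- `τ` is the first conjugate time. It is positive because `dexp` at `0` is the identity, and less
  -- than `1` by assumption, so the limit argument has room on both sides.
  set τ := sInf Z with hτ
  have hτZ : τ ∈ Z := hZc.csInf_mem hZne hZb
  have hτ1 : τ < 1 := (csInf_le hZb ⟨⟨ht'.1, ht'.2.le⟩, hct'⟩).trans_lt ht'.2
  have hτ0 : 0 < τ := by
    refine lt_of_le_of_ne hτZ.1.1 fun h => hτZ.2 ?_
    rw [← h, zero_smul]; exact nonConj_zero hg
  have hlt : ∀ t, 0 ≤ t → t < τ → NonConj g p (t • v) := fun t h0 h1 => by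
    by_contra h
    exact absurd (csInf_le hZb (show t ∈ Z from ⟨⟨h0, h1.le.trans hτZ.1.2⟩, h⟩)) (not_le.2 h1)
  have hs := mem_extChartAt_source (I := 𝓡 n) (geod g p v τ)
  set x₀ := geod g p v τ with hx₀
  obtain ⟨r, hr, hr'⟩ := Metric.eventually_nhds_iff.1 (goodAt hg hs).1
  set a := max 0 (τ - r) with ha
  set b := min 1 (τ + r) with hb
  have ha0 : 0 ≤ a := le_max_left _ _
  have har : τ - r ≤ a := le_max_right _ _
  have hb1 : b ≤ 1 := min_le_left _ _
  have hbr : b ≤ τ + r := min_le_right _ _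
  have hτI : τ ∈ Ioo a b := ⟨max_lt hτ0 (by linarith), lt_min hτ1 (by linarith)⟩
  have hin : ∀ u ∈ Metric.ball v r, ∀ t ∈ Ioo a b, geod g p u t ∈ (extChartAt (𝓡 n) x₀).source := by
    intro u hu t ht
    refine hr' (y := (u, t)) ?_
    rw [Prod.dist_eq, max_lt_iff]
    refine ⟨hu, ?_⟩
    rw [Real.dist_eq, abs_lt]
    exact ⟨by linarith [ht.1], by linarith [ht.2]⟩
  have hev : ∀ᶠ z : EuclideanSpace ℝ (Fin n) × ℝ in 𝓝 (v, τ),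
      geod g p z.1 z.2 ∈ (extChartAt (𝓡 n) x₀).source := (goodAt hg hs).1
  refine hτZ.2 ((nonConj_smul_iff hg hτ0.ne' hs).2 ?_)
  refine (isGeodesicFamilyAt hg hs).injective_of_mem_closure (B := innerForm g p)
    (isLocalMetric g x₀) (innerForm_symm p) (hev.mono fun z hz => metricForm_gauss hg hz)
    (A := {u | ∀ t ∈ Icc (0 : ℝ) 1, NonConj g p (t • u)} ∩ Metric.ball v r) ?_ hτI ?_ ?_
  · rw [mem_closure_iff_frequently] at hv ⊢
    exact hv.and_eventually (Metric.ball_mem_nhds v hr)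
  · rintro u ⟨hu, hur⟩ t ht
    exact (nonConj_smul_iff hg (by linarith [ht.1]) (hin u hur t ht)).1
      (hu t ⟨by linarith [ht.1], by linarith [ht.2]⟩)
  · intro t ht
    have htI : t ∈ Ioo a b := ⟨ht.1, ht.2.trans hτI.2⟩
    exact (nonConj_smul_iff hg (by linarith [ht.1])
      (hin v (Metric.mem_ball_self hr) t htI)).1 (hlt t (by linarith [ht.1]) ht.2)

end

end Starshaped

end

/-! ### Defining functions, tangent spaces and normals of the boundary. -/

noncomputable section

namespace Starshaped

variable {n : ℕ} {M : Type*} [TopologicalSpace M] [ChartedSpace (EuclideanSpace ℝ (Fin n)) M]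

section Aux

/-- A function with positive derivative is positive to the right. -/
theorem eventually_pos_of_hasDerivAt {f : ℝ → ℝ} {f' : ℝ} (hf : HasDerivAt f f' 0) (h0 : f 0 = 0)
    (hpos : 0 < f') : ∀ᶠ s in 𝓝[>] (0 : ℝ), 0 < f s := by
  have h := hf.hasDerivWithinAt (s := Ioi 0)
  rw [hasDerivWithinAt_iff_tendsto_slope' self_notMem_Ioi] at h
  filter_upwards [h.eventually (lt_mem_nhds hpos), self_mem_nhdsWithin] with s hs hs0
  have hs0 : (0 : ℝ) < s := hs0
  rw [slope_def_field, h0, sub_zero, sub_zero] at hs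
  exact (div_pos_iff_of_pos_right hs0).1 hs

theorem eventually_neg_of_hasDerivAt {f : ℝ → ℝ} {f' : ℝ} (hf : HasDerivAt f f' 0) (h0 : f 0 = 0)
    (hneg : f' < 0) : ∀ᶠ s in 𝓝[>] (0 : ℝ), f s < 0 := by
  filter_upwards [eventually_pos_of_hasDerivAt hf.neg (by simp [h0]) (neg_pos.2 hneg)] with s hs
  simpa using hs

theorem exists_apply_neg {E : Type*} [NormedAddCommGroup E] [NormedSpace ℝ E] {D : E →L[ℝ] ℝ}
    (hD : D ≠ 0) : ∃ z, D z < 0 := by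
  by_contra! hcon
  refine hD (ContinuousLinearMap.ext fun w => le_antisymm ?_ (hcon w))
  have := hcon (-w)
  rwa [map_neg, neg_nonneg] at this

end Aux

/-- `r` is a defining function of `Ω` near `p`, in the preferred chart at `p`. -/
structure IsDefiningFunction (Ω : Set M) (p : M) (r : EuclideanSpace ℝ (Fin n) → ℝ) : Prop where
  eventually_contDiffAt : ∀ᶠ q in 𝓝 p, ContDiffAt ℝ ∞ r (extChartAt (𝓡 n) p q)
  fderiv_ne : fderiv ℝ r (extChartAt (𝓡 n) p p) ≠ 0
  mem_iff : ∀ᶠ q in 𝓝 p, q ∈ Ω ↔ r (extChartAt (𝓡 n) p q) < 0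
  frontier_iff : ∀ᶠ q in 𝓝 p, q ∈ frontier Ω ↔ r (extChartAt (𝓡 n) p q) = 0

variable {Ω : Set M} {p : M} {r : EuclideanSpace ℝ (Fin n) → ℝ}

theorem tendsto_chart_symm (p : M) :
    Tendsto (extChartAt (𝓡 n) p).symm (𝓝 (extChartAt (𝓡 n) p p)) (𝓝 p) := by
  have := continuousAt_extChartAt_symm (I := 𝓡 n) p
  have h2 := this.tendsto
  rwa [extChartAt_to_inv] at h2

theorem tendsto_chart (p : M) :
    Tendsto (extChartAt (𝓡 n) p) (𝓝 p) (𝓝 (extChartAt (𝓡 n) p p)) :=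
  continuousAt_extChartAt (I := 𝓡 n) p

theorem chart_target_mem_nhds (p : M) :
    (extChartAt (𝓡 n) p).target ∈ 𝓝 (extChartAt (𝓡 n) p p) := extChartAt_target_mem_nhds p

/-- From a nearby point with `r = 0`, moving in a fixed direction of decrease of `r` enters `Ω` at
once. The nonvanishing differential is what makes `{r = 0}` belong to the closure. -/
theorem eventually_mem_iff_closure {r : EuclideanSpace ℝ (Fin n) → ℝ}
    (hr : ContDiffAt ℝ ∞ r (extChartAt (𝓡 n) p p)) (hr' : fderiv ℝ r (extChartAt (𝓡 n) p p) ≠ 0)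
    (hmem : ∀ᶠ q in 𝓝 p, q ∈ Ω ↔ r (extChartAt (𝓡 n) p q) < 0) :
    ∀ᶠ q in 𝓝 p, q ∈ closure Ω ↔ r (extChartAt (𝓡 n) p q) ≤ 0 := by
  obtain ⟨z, hz⟩ := exists_apply_neg hr'
  have hd : ContDiffAt ℝ ∞ (fderiv ℝ r) (extChartAt (𝓡 n) p p) := hr.fderiv_right (by simp)
  have hev : ∀ᶠ y in 𝓝 (extChartAt (𝓡 n) p p), fderiv ℝ r y z < 0 :=
    (hd.continuousAt.clm_apply continuousAt_const).eventually (gt_mem_nhds hz)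
  have hev2 := (tendsto_chart p).eventually (hev.and ((hr.of_le (m := 1) (by simp)).eventually
    (by simp)))
  filter_upwards [hev2, hmem.eventually_nhds,
    (isOpen_extChartAt_source (I := 𝓡 n) p).mem_nhds (mem_extChartAt_source p)] with q hq hq2 hq3
  have hcd : ContinuousAt r (extChartAt (𝓡 n) p q) := hq.2.continuousAt
  have hcq : ContinuousAt (extChartAt (𝓡 n) p) q := continuousAt_extChartAt' hq3
  constructor
  · intro hc
    by_contra! hpos
    have h1 : ∀ᶠ x in 𝓝 q, 0 < r (extChartAt (𝓡 n) p x) :=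
      (ContinuousAt.comp (f := extChartAt (𝓡 n) p) hcd hcq).eventually (lt_mem_nhds hpos)
    obtain ⟨x, hx, hx1, hx2⟩ := ((mem_closure_iff_frequently.1 hc).and_eventually
      (h1.and hq2)).exists
    exact absurd (hx2.1 hx) (not_lt.2 hx1.le)
  · intro hle
    rcases hle.lt_or_eq with hlt | heq
    · exact subset_closure (hq2.self_of_nhds.2 hlt)
    · have hl : HasDerivAt (fun s : ℝ => extChartAt (𝓡 n) p q + s • z) z 0 := by
        simpa using ((hasDerivAt_id (0 : ℝ)).smul_const z).const_add (extChartAt (𝓡 n) p q)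
      have hrd : HasDerivAt (fun s : ℝ => r (extChartAt (𝓡 n) p q + s • z))
          (fderiv ℝ r (extChartAt (𝓡 n) p q) z) 0 := by
        refine HasFDerivAt.comp_hasDerivAt (f := fun s : ℝ => extChartAt (𝓡 n) p q + s • z) 0
          ?_ hl
        simp only [zero_smul, add_zero]
        exact (hq.2.differentiableAt (by simp)).hasFDerivAt
      have hneg := eventually_neg_of_hasDerivAt hrd (by simpa using heq) hq.1
      have htend : Tendsto (fun s : ℝ => (extChartAt (𝓡 n) p).symm (extChartAt (𝓡 n) p q + s • z))
          (𝓝[>] 0) (𝓝 q) := by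
        refine Tendsto.mono_left ?_ nhdsWithin_le_nhds
        have h1 := continuousAt_extChartAt_symm' (I := 𝓡 n) hq3
        have h2 : ContinuousAt (fun s : ℝ =>
            (extChartAt (𝓡 n) p).symm (extChartAt (𝓡 n) p q + s • z)) 0 :=
          ContinuousAt.comp (f := fun s : ℝ => extChartAt (𝓡 n) p q + s • z)
            (by simpa using h1) hl.continuousAt
        have h3 := h2.tendsto
        simp only [zero_smul, add_zero, (extChartAt (𝓡 n) p).left_inv hq3] at h3
        exact h3
      have htgt : ∀ᶠ s : ℝ in 𝓝[>] 0, extChartAt (𝓡 n) p q + s • z ∈ (extChartAt (𝓡 n) p).target := by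
        refine Filter.Eventually.filter_mono nhdsWithin_le_nhds (hl.continuousAt.eventually ?_)
        simp only [zero_smul, add_zero]
        exact (isOpen_extChartAt_target p).mem_nhds ((extChartAt (𝓡 n) p).map_source hq3)
      refine mem_closure_of_tendsto htend ?_
      filter_upwards [hneg, htend.eventually hq2, htgt] with s hs1 hs2 hs3
      rw [hs2, (extChartAt (𝓡 n) p).right_inv hs3]
      exact hs1

theorem exists_isDefiningFunction [IsManifold (𝓡 n) ∞ M] (hΩ : IsOpen Ω)
    (h : HasSmoothBoundary n Ω) (hp : p ∈ frontier Ω) :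
    ∃ r : EuclideanSpace ℝ (Fin n) → ℝ, IsDefiningFunction Ω p r := by
  obtain ⟨U, ρ, hU, hpU, hρ, hρ', hiff⟩ := h p hp
  have hρp : ContMDiffAt (𝓡 n) 𝓘(ℝ, ℝ) ∞ ρ p := hρ.contMDiffAt (hU.mem_nhds hpU)
  set r : EuclideanSpace ℝ (Fin n) → ℝ := fun y => ρ ((extChartAt (𝓡 n) p).symm y) with hr
  have hrc : ∀ᶠ q in 𝓝 p, ContDiffAt ℝ ∞ r (extChartAt (𝓡 n) p q) := by
    filter_upwards [hU.mem_nhds hpU,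
      (isOpen_extChartAt_source (I := 𝓡 n) p).mem_nhds (mem_extChartAt_source p)] with q hq hqs
    rw [← contMDiffAt_iff_contDiffAt]
    have h1 : ContMDiffAt 𝓘(ℝ, EuclideanSpace ℝ (Fin n)) (𝓡 n) ∞ (extChartAt (𝓡 n) p).symm
        (extChartAt (𝓡 n) p q) :=
      (contMDiffOn_extChartAt_symm p).contMDiffAt
        ((isOpen_extChartAt_target p).mem_nhds ((extChartAt (𝓡 n) p).map_source hqs))
    have h2 := hρ.contMDiffAt (hU.mem_nhds hq)
    rw [← (extChartAt (𝓡 n) p).left_inv hqs] at h2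
    exact ContMDiffAt.comp _ h2 h1
  have hrd : fderiv ℝ r (extChartAt (𝓡 n) p p) ≠ 0 := by
    have h1 := (hρp.mdifferentiableAt (by simp)).mfderiv
    rw [ModelWithCorners.range_eq_univ, fderivWithin_univ] at h1
    intro h2
    exact hρ' (h1.trans h2)
  have hmem : ∀ᶠ q in 𝓝 p, q ∈ Ω ↔ r (extChartAt (𝓡 n) p q) < 0 := by
    filter_upwards [hU.mem_nhds hpU,
      (isOpen_extChartAt_source (I := 𝓡 n) p).mem_nhds (mem_extChartAt_source p)] with q h1 h2
    simp only [hr, (extChartAt (𝓡 n) p).left_inv h2]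
    exact hiff q h1
  refine ⟨r, hrc, hrd, hmem, ?_⟩
  filter_upwards [hmem, eventually_mem_iff_closure hrc.self_of_nhds hrd hmem] with q h1 h2
  rw [hΩ.frontier_eq, mem_diff, h1, h2, not_lt]
  exact ⟨fun h => le_antisymm h.1 h.2, fun h => ⟨h.le, h.ge⟩⟩

theorem hasDerivAt_chart_geod [IsManifold (𝓡 n) ∞ M] [T2Space M] {g : Metric n M}
    (hg : IsComplete g) (p : M) (ν : EuclideanSpace ℝ (Fin n)) :
    HasDerivAt (fun ε => extChartAt (𝓡 n) p (geod g p ν ε)) ν 0 := by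
  have hs : geod g p ν 0 ∈ (extChartAt (𝓡 n) p).source := by
    rw [geod_zero hg]; exact mem_extChartAt_source p
  have h := hasDerivAt_chart_comp ((isGeodesic_geod hg p ν).mdifferentiableAt 0) hs
  rwa [geod_zero hg, velocityVec_geod_zero hg, chartDeriv_self] at h

namespace IsDefiningFunction

variable (hr : IsDefiningFunction Ω p r)
include hr

theorem contDiffAt : ContDiffAt ℝ ∞ r (extChartAt (𝓡 n) p p) := hr.eventually_contDiffAt.self_of_nhds

theorem mem_closure_iff : ∀ᶠ q in 𝓝 p, q ∈ closure Ω ↔ r (extChartAt (𝓡 n) p q) ≤ 0 :=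
  eventually_mem_iff_closure hr.contDiffAt hr.fderiv_ne hr.mem_iff

theorem eq_zero (hp : p ∈ frontier Ω) : r (extChartAt (𝓡 n) p p) = 0 :=
  hr.frontier_iff.self_of_nhds.1 hp

theorem hasFDerivAt : HasFDerivAt r (fderiv ℝ r (extChartAt (𝓡 n) p p)) (extChartAt (𝓡 n) p p) :=
  (hr.contDiffAt.differentiableAt (by simp)).hasFDerivAt

variable [IsManifold (𝓡 n) ∞ M]

/-- The tangent space of the boundary is the kernel of the differential of a defining function. -/
theorem isTangentToFrontier_iff (hp : p ∈ frontier Ω) {w : EuclideanSpace ℝ (Fin n)} :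
    IsTangentToFrontier Ω p (show TangentSpace (𝓡 n) p from w) ↔
      fderiv ℝ r (extChartAt (𝓡 n) p p) w = 0 := by
  have hsrc := mem_extChartAt_source (I := 𝓡 n) p
  constructor
  · rintro ⟨c, hc, hfr, hpass⟩
    obtain ⟨h0, hv⟩ := passesWith_iff.1 hpass
    have h1 := hasDerivAt_chart_comp (x₀ := p) (hc.mdifferentiableAt (by simp)) (by rwa [h0])
    rw [h0, hv, chartDeriv_self] at h1
    have h2 : HasDerivAt (fun t => r (extChartAt (𝓡 n) p (c t)))
        (fderiv ℝ r (extChartAt (𝓡 n) p p) w) 0 := by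
      refine HasFDerivAt.comp_hasDerivAt (f := fun t => extChartAt (𝓡 n) p (c t)) 0 ?_ h1
      rw [h0]; exact hr.hasFDerivAt
    refine h2.unique ((hasDerivAt_const (0 : ℝ) (0 : ℝ)).congr_of_eventuallyEq ?_)
    have h3 : Tendsto c (𝓝 0) (𝓝 p) := by
      have := hc.continuousAt.tendsto
      rwa [h0] at this
    filter_upwards [hfr, h3.eventually hr.frontier_iff] with t ht1 ht2 using ht2.1 ht1
  · intro hw
    set y₀ := extChartAt (𝓡 n) p p with hy₀
    set D := fderiv ℝ r y₀ with hD
    obtain ⟨z, hz⟩ : ∃ z, D z = 1 := by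
      obtain ⟨z, hz⟩ : ∃ z, D z ≠ 0 := by
        by_contra! h
        exact hr.fderiv_ne (ContinuousLinearMap.ext h)
      exact ⟨(D z)⁻¹ • z, by simp [hz]⟩
    -- This map straightens the boundary: `D z = 1` gives `D (f y - y₀) = r y` when `r y₀ = 0`, and
    -- its derivative at `y₀` is the identity. Its inverse sends the line `y₀ + t w`, on which `D`
    -- vanishes relative to `y₀`, into `{r = 0}`.
    set f : EuclideanSpace ℝ (Fin n) → EuclideanSpace ℝ (Fin n) :=
      fun y => y + (r y - D (y - y₀)) • z with hf
    have hfc : ContDiffAt ℝ ∞ f y₀ :=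
      contDiffAt_id.add ((hr.contDiffAt.sub (D.contDiff.contDiffAt.comp y₀
        (contDiffAt_id.sub contDiffAt_const))).smul contDiffAt_const)
    have hfd : HasFDerivAt f ((ContinuousLinearEquiv.refl ℝ (EuclideanSpace ℝ (Fin n)) :
        EuclideanSpace ℝ (Fin n) ≃L[ℝ] EuclideanSpace ℝ (Fin n)) :
        EuclideanSpace ℝ (Fin n) →L[ℝ] EuclideanSpace ℝ (Fin n)) y₀ := by
      have h1 : HasFDerivAt (fun y => D (y - y₀)) D y₀ :=
        D.hasFDerivAt.comp y₀ ((hasFDerivAt_id y₀).sub_const y₀)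
      have hrd : HasFDerivAt r D y₀ := hr.hasFDerivAt
      refine ((hasFDerivAt_id y₀).add ((hrd.sub h1).smul_const z)).congr_fderiv ?_
      ext1 u
      simp
    have hr0 : r y₀ = 0 := hr.eq_zero hp
    have hf0 : f y₀ = y₀ := by simp [hf, hr0]
    have hs := hfc.hasStrictFDerivAt' hfd (by simp)
    set ψ := hfc.localInverse hfd (by simp) with hψ
    have hψc : ContDiffAt ℝ ∞ ψ y₀ := by
      have := hfc.to_localInverse hfd (by simp)
      rwa [hf0] at this
    have hψ0 : ψ y₀ = y₀ := by
      have := hfc.localInverse_apply_image hfd (by simp)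
      rwa [hf0] at this
    have hψd : HasFDerivAt ψ (ContinuousLinearMap.id ℝ (EuclideanSpace ℝ (Fin n))) y₀ := by
      have := hs.to_localInverse.hasFDerivAt
      rw [hf0] at this
      exact this
    have hψr : ∀ᶠ y in 𝓝 y₀, f (ψ y) = y := by
      have := hs.eventually_right_inverse
      rw [hf0] at this
      exact this
    clear_value ψ
    have hl : HasDerivAt (fun t : ℝ => y₀ + t • w) w 0 := by
      simpa using ((hasDerivAt_id (0 : ℝ)).smul_const w).const_add y₀
    have hlt : Tendsto (fun t : ℝ => y₀ + t • w) (𝓝 0) (𝓝 y₀) := by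
      have := hl.continuousAt.tendsto
      simpa using this
    have hσd : HasDerivAt (fun t : ℝ => ψ (y₀ + t • w)) w 0 := by
      have := HasFDerivAt.comp_hasDerivAt (f := fun t : ℝ => y₀ + t • w) 0
        (by simpa using hψd) hl
      simpa [Function.comp_def] using this
    have hσt : Tendsto (fun t : ℝ => ψ (y₀ + t • w)) (𝓝 0) (𝓝 y₀) := by
      have := hσd.continuousAt.tendsto
      simpa [hψ0] using this
    have hσ0 : ∀ᶠ t : ℝ in 𝓝 0, r (ψ (y₀ + t • w)) = 0 := by
      filter_upwards [hlt.eventually hψr] with t ht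
      have h1 := congrArg (fun y => D (y - y₀)) ht
      simp only [hf] at h1
      rw [add_sub_right_comm, map_add, map_smul, hz, add_sub_cancel_left, map_smul, hw] at h1
      simpa using h1
    have hσc : ContDiffAt ℝ ∞ (fun t : ℝ => ψ (y₀ + t • w)) 0 :=
      ContDiffAt.comp (f := fun t : ℝ => y₀ + t • w) 0 (by simpa using hψc) (by fun_prop)
    set c : ℝ → M := fun t => (extChartAt (𝓡 n) p).symm (ψ (y₀ + t • w)) with hc
    have hc0 : c 0 = p := by
      simp only [hc, zero_smul, add_zero, hψ0]
      exact extChartAt_to_inv p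
    have hcm : ContMDiffAt 𝓘(ℝ, ℝ) (𝓡 n) ∞ c 0 := by
      have h1 : ContMDiffAt 𝓘(ℝ, EuclideanSpace ℝ (Fin n)) (𝓡 n) ∞ (extChartAt (𝓡 n) p).symm
          (ψ (y₀ + (0 : ℝ) • w)) := by
        simp only [zero_smul, add_zero, hψ0]
        exact (contMDiffOn_extChartAt_symm p).contMDiffAt (chart_target_mem_nhds p)
      exact ContMDiffAt.comp (f := fun t : ℝ => ψ (y₀ + t • w)) 0 h1
        (contMDiffAt_iff_contDiffAt.2 hσc)
    have hctgt : ∀ᶠ t : ℝ in 𝓝 0, ψ (y₀ + t • w) ∈ (extChartAt (𝓡 n) p).target :=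
      hσt.eventually (chart_target_mem_nhds p)
    have hct : Tendsto c (𝓝 0) (𝓝 p) := by
      have := hcm.continuousAt.tendsto
      rwa [hc0] at this
    refine ⟨c, hcm, ?_, passesWith_iff.2 ⟨hc0, ?_⟩⟩
    · filter_upwards [hσ0, hctgt, hct.eventually hr.frontier_iff] with t h1 h2 h3
      rw [h3, (extChartAt (𝓡 n) p).right_inv h2, h1]
    · have h1 := hasDerivAt_chart_comp (x₀ := p) (hcm.mdifferentiableAt (by simp)) (by rwa [hc0])
      rw [hc0, chartDeriv_self] at h1
      refine h1.unique (hσd.congr_of_eventuallyEq ?_)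
      filter_upwards [hctgt] with t ht
      exact (extChartAt (𝓡 n) p).right_inv ht

variable [T2Space M] {g : Metric n M} (hg : IsComplete g)
include hg

/-- Orthogonality to the kernel of `dr` makes `g(ν, ·)` proportional to `dr`. The sign of the factor
is read off along the geodesics with initial velocities `±ν`: since the factor cannot vanish, the
first order behaviour of `r` decides on which side they run. -/
theorem isOutwardUnitNormal_iff (hp : p ∈ frontier Ω) {ν : EuclideanSpace ℝ (Fin n)} :
    IsOutwardUnitNormal g Ω p (show TangentSpace (𝓡 n) p from ν) ↔ innerForm g p ν ν = 1 ∧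
      ∃ c > 0, ∀ w, fderiv ℝ r (extChartAt (𝓡 n) p p) w = c * innerForm g p ν w := by
  set D := fderiv ℝ r (extChartAt (𝓡 n) p p) with hD
  have hr0 := hr.eq_zero hp
  have hder : ∀ u : EuclideanSpace ℝ (Fin n),
      HasDerivAt (fun ε => r (extChartAt (𝓡 n) p (geod g p u ε))) (D u) 0 := fun u => by
    refine HasFDerivAt.comp_hasDerivAt (f := fun ε => extChartAt (𝓡 n) p (geod g p u ε)) 0 ?_
      (hasDerivAt_chart_geod hg p u)
    rw [geod_zero hg]; exact hr.hasFDerivAt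
  have hz : ∀ u : EuclideanSpace ℝ (Fin n), r (extChartAt (𝓡 n) p (geod g p u 0)) = 0 := fun u => by
    rw [geod_zero hg, hr0]
  have hmem : ∀ u : EuclideanSpace ℝ (Fin n), ∀ᶠ ε in 𝓝[>] (0 : ℝ),
      geod g p u ε ∈ Ω ↔ r (extChartAt (𝓡 n) p (geod g p u ε)) < 0 := fun u => by
    have h1 := (isGeodesic_geod hg p u).continuous.tendsto 0
    rw [geod_zero hg] at h1
    exact (h1.mono_left nhdsWithin_le_nhds).eventually hr.mem_iff
  have hneg : ∀ ε : ℝ, expMap g p (-(ε • ν)) = geod g p (-ν) ε := fun ε => by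
    rw [geod, smul_neg]
  constructor
  · rintro ⟨hunit, hnormal, hout⟩
    have hunit : innerForm g p ν ν = 1 := hunit
    have hker : ∀ w, D w = 0 → innerForm g p ν w = 0 := fun w hw =>
      hnormal w ((hr.isTangentToFrontier_iff hp).2 hw)
    have hDν : D ν ≠ 0 := fun h => by
      have := hker ν h
      rw [hunit] at this; exact one_ne_zero this
    have hDpos : 0 < D ν := by
      by_contra! hle
      have hlt : 0 < D (-ν) := by
        rw [map_neg]; exact neg_pos.2 (lt_of_le_of_ne hle hDν)
      obtain ⟨ε, h1, h2, h3⟩ := ((eventually_pos_of_hasDerivAt (hder (-ν)) (hz _) hlt).and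
        ((hmem (-ν)).and hout)).exists
      have h4 : geod g p (-ν) ε ∈ Ω := hneg ε ▸ h3.1
      exact absurd (h2.1 h4) (not_lt.2 h1.le)
    refine ⟨hunit, D ν, hDpos, fun w => ?_⟩
    have h1 := hker (w - (D w / D ν) • ν) (by simp [hDν])
    rw [map_sub, map_smul, hunit, smul_eq_mul, mul_one, sub_eq_zero] at h1
    rw [h1]; field_simp
  · rintro ⟨hunit, c, hc, hcD⟩
    refine ⟨hunit, fun w hw => ?_, ?_⟩
    · have h1 := (hr.isTangentToFrontier_iff hp).1 hw
      have h2 := hcD w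
      rw [← hD] at h1
      rw [h1] at h2
      exact (mul_eq_zero.1 h2.symm).resolve_left hc.ne'
    · have hDν : D ν = c := by rw [hcD, hunit, mul_one]
      filter_upwards [eventually_pos_of_hasDerivAt (hder ν) (hz _) (hDν ▸ hc),
        eventually_neg_of_hasDerivAt (hder (-ν)) (hz _) (by rw [map_neg, hDν]; exact neg_neg_of_pos hc),
        hmem ν, hmem (-ν)] with ε h1 h2 h3 h4
      constructor
      · have := h4.2 h2
        rwa [← hneg] at this
      · exact fun h => absurd (h3.1 h) (not_lt.2 h1.le)

/-- The normal is the Riesz representative of `dr`, divided by its length. In the chart at `p` the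
scalar product coincides with the coordinate metric, whose invertibility supplies the
representative. -/
theorem existsUnique_isOutwardUnitNormal (hp : p ∈ frontier Ω) :
    ∃! ν : TangentSpace (𝓡 n) p, IsOutwardUnitNormal g Ω p ν := by
  have hinj : ∀ u, (∀ w, innerForm g p u w = 0) → u = 0 := fun u hu => by
    by_contra hne
    exact (innerForm_pos (g := g) p hne).ne' (hu u)
  have hriesz : ∃ x : EuclideanSpace ℝ (Fin n),
      ∀ w, innerForm g p x w = fderiv ℝ r (extChartAt (𝓡 n) p p) w := by
    have hy : extChartAt (𝓡 n) p p ∈ (extChartAt (𝓡 n) p).target := mem_extChartAt_target p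
    refine ⟨(metricForm g p (extChartAt (𝓡 n) p p)).inverse
      (fderiv ℝ r (extChartAt (𝓡 n) p p)), fun w => ?_⟩
    rw [innerForm_eq g (mem_extChartAt_source (I := 𝓡 n) p), chartDeriv_self, chartDeriv_self,
      ((isLocalMetric g p).isInvertible hy).self_apply_inverse]
  obtain ⟨x, hx⟩ := hriesz
  have hx0 : x ≠ 0 := by
    rintro rfl
    exact hr.fderiv_ne (ContinuousLinearMap.ext fun w => by rw [← hx w]; simp)
  have hxx := innerForm_pos (g := g) p hx0
  set c := Real.sqrt (innerForm g p x x) with hc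
  have hcpos : 0 < c := Real.sqrt_pos.2 hxx
  have hcc : c * c = innerForm g p x x := Real.mul_self_sqrt hxx.le
  refine ⟨(c⁻¹ • x : EuclideanSpace ℝ (Fin n)), ?_, ?_⟩
  · refine (hr.isOutwardUnitNormal_iff hg hp).2 ⟨?_, c, hcpos, fun w => ?_⟩
    · simp only [map_smul, ContinuousLinearMap.smul_apply, smul_eq_mul, ← hcc]
      field_simp
    · simp only [map_smul, ContinuousLinearMap.smul_apply, smul_eq_mul, hx]
      field_simp
  · intro ν hν
    obtain ⟨hunit, c', hc', hcD⟩ := (hr.isOutwardUnitNormal_iff hg hp (ν := ν)).1 hν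
    set ν' : EuclideanSpace ℝ (Fin n) := ν with hν'
    have h1 : x = c' • ν' := by
      refine sub_eq_zero.1 (hinj _ fun w => ?_)
      simp only [map_sub, map_smul, ContinuousLinearMap.sub_apply, ContinuousLinearMap.smul_apply,
        smul_eq_mul, hx, hcD w, sub_self]
    have h2 : c = c' := by
      rw [hc, h1]
      simp only [map_smul, ContinuousLinearMap.smul_apply, smul_eq_mul, hunit, mul_one]
      exact Real.sqrt_mul_self hc'.le
    change ν' = c⁻¹ • x
    rw [h1, h2, smul_smul, inv_mul_cancel₀ hc'.ne', one_smul]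

end IsDefiningFunction

end Starshaped

end

/-! ### Radial velocities and the bound on the logarithm near the boundary. -/

noncomputable section

namespace Starshaped

variable {n : ℕ} {M : Type*} [TopologicalSpace M] [ChartedSpace (EuclideanSpace ℝ (Fin n)) M]
  [IsManifold (𝓡 n) ∞ M] {g : Metric n M} {o p x₀ : M} {Ω : Set M}
  {S : Set (EuclideanSpace ℝ (Fin n))} {r : EuclideanSpace ℝ (Fin n) → ℝ}

/-- The velocity at time `1` of the radial geodesic with initial velocity `v`, in the chart at
`x₀`. -/
def radialVel (g : Metric n M) (o x₀ : M) (v : EuclideanSpace ℝ (Fin n)) :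
    EuclideanSpace ℝ (Fin n) := chartDeriv n x₀ (expMap g o v) (dexp g o v v)

section RadialVel

variable [T2Space M] (hg : IsComplete g)
include hg

theorem radialVel_eq_velIn (v : EuclideanSpace ℝ (Fin n)) :
    radialVel g o x₀ v = velIn n g o x₀ (v, 1) := by
  rw [velIn_eq hg, one_smul, geod_one]; rfl

theorem contDiffAt_radialVel {v : EuclideanSpace ℝ (Fin n)}
    (hv : expMap g o v ∈ (extChartAt (𝓡 n) x₀).source) :
    ContDiffAt ℝ 1 (radialVel g o x₀) v := by
  have h : geod g o v 1 ∈ (extChartAt (𝓡 n) x₀).source := by rwa [geod_one]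
  have h1 := (isGeodesicFamilyAt hg h).contDiffAt_vel
  have h2 := ContDiffAt.comp (f := fun v : EuclideanSpace ℝ (Fin n) => (v, (1 : ℝ))) v h1
    (by fun_prop)
  rwa [show radialVel g o x₀ = fun v => velIn n g o x₀ (v, 1) from
    funext (radialVel_eq_velIn hg)]

theorem fderiv_chartExp_self {v : EuclideanSpace ℝ (Fin n)}
    (hv : expMap g o v ∈ (extChartAt (𝓡 n) x₀).source) :
    fderiv ℝ (chartExp g o x₀) v v = radialVel g o x₀ v := fderiv_chartExp hg hv

/-- The Gauss lemma in a fixed chart. Its use is that the derivative of half the squared length of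
the logarithm becomes the pairing with the radial velocity. -/
theorem metricForm_radialVel {v : EuclideanSpace ℝ (Fin n)}
    (hv : expMap g o v ∈ (extChartAt (𝓡 n) x₀).source) (a : EuclideanSpace ℝ (Fin n)) :
    metricForm g x₀ (chartExp g o x₀ v) (radialVel g o x₀ v) (fderiv ℝ (chartExp g o x₀) v a) =
      innerForm g o v a := by
  rw [fderiv_chartExp hg hv, ← innerForm_dexp hg v a, innerForm_eq g hv]
  rfl

theorem metricForm_radialVel_self {v : EuclideanSpace ℝ (Fin n)}
    (hv : expMap g o v ∈ (extChartAt (𝓡 n) x₀).source) :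
    metricForm g x₀ (chartExp g o x₀ v) (radialVel g o x₀ v) (radialVel g o x₀ v) =
      innerForm g o v v := by
  rw [← metricForm_radialVel hg hv v, fderiv_chartExp_self hg hv]

/-- The derivative of half the squared distance in `T_o M` along a curve. -/
theorem hasDerivAt_half_innerForm {c : ℝ → EuclideanSpace ℝ (Fin n)}
    {z : EuclideanSpace ℝ (Fin n)} {s : ℝ} (hc : DifferentiableAt ℝ c s)
    (hs : expMap g o (c s) ∈ (extChartAt (𝓡 n) x₀).source)
    (hz : HasDerivAt (fun s => chartExp g o x₀ (c s)) z s) :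
    HasDerivAt (fun s => innerForm g o (c s) (c s) / 2)
      (metricForm g x₀ (chartExp g o x₀ (c s)) (radialVel g o x₀ (c s)) z) s := by
  have h1 := ((((hasDerivAt_const s (innerForm g o)).clm_apply hc.hasDerivAt).clm_apply
    hc.hasDerivAt).div_const 2)
  refine h1.congr_deriv ?_
  have h2 := ((contDiffAt_chartExp hg hs).differentiableAt (by simp)).hasFDerivAt.comp_hasDerivAt s
    hc.hasDerivAt
  rw [hz.unique h2, metricForm_radialVel hg hs]
  simp [innerForm_symm o (deriv c s)]

end RadialVel

/-- Short segments in a direction of decrease of `r` enter `{r < 0}`. -/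
theorem eventually_segment_neg {E : Type*} [NormedAddCommGroup E] [NormedSpace ℝ E] {r : E → ℝ}
    {y₀ z : E} (hr : ContDiffAt ℝ 1 r y₀) (hz : fderiv ℝ r y₀ z < 0) {N : Set E} (hN : N ∈ 𝓝 y₀) :
    ∃ s₀ : ℝ, 0 < s₀ ∧ ∃ δ : ℝ, 0 < δ ∧ ∀ y ∈ Metric.ball y₀ δ, ∀ s ∈ Icc 0 s₀, y + s • z ∈ N ∧
      (r y ≤ 0 → 0 < s → r (y + s • z) < 0) := by
  have h1 : ∀ᶠ y in 𝓝 y₀, fderiv ℝ r y z < 0 :=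
    ((hr.fderiv_right (m := 0) (by simp)).continuousAt.clm_apply continuousAt_const).eventually
      (gt_mem_nhds hz)
  obtain ⟨ε, hε, hε'⟩ := Metric.eventually_nhds_iff.1
    ((h1.and (hr.eventually (by simp))).and (eventually_mem_set.2 hN))
  -- The displacement uses at most half of `ε` and the starting point the other half; adding `1`
  -- avoids division by zero.
  refine ⟨ε / (2 * (‖z‖ + 1)), by positivity, ε / 2, by positivity, fun y hy s hs => ?_⟩
  have hdist : ∀ s ∈ Icc 0 (ε / (2 * (‖z‖ + 1))), dist (y + s • z) y₀ < ε := fun s hs => by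
    have e1 : dist (y + s • z) y ≤ s * ‖z‖ := by
      rw [dist_eq_norm, add_sub_cancel_left, norm_smul, Real.norm_of_nonneg hs.1]
    have e2 : s * ‖z‖ ≤ ε / 2 := by
      have h3 : s * (2 * (‖z‖ + 1)) ≤ ε := (le_div_iff₀ (by positivity)).1 hs.2
      have := hs.1
      nlinarith
    have e3 := dist_triangle (y + s • z) y y₀
    have e4 : dist y y₀ < ε / 2 := hy
    linarith
  refine ⟨(hε' (hdist s hs)).2, fun hry hs0 => ?_⟩
  have hder : ∀ t ∈ Icc 0 s, HasDerivAt (fun t : ℝ => r (y + t • z)) (fderiv ℝ r (y + t • z) z) t := by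
    intro t ht
    have h2 := (hε' (hdist t ⟨ht.1, ht.2.trans hs.2⟩)).1.2
    have h3 : HasDerivAt (fun t : ℝ => y + t • z) z t := by
      simpa using ((hasDerivAt_id t).smul_const z).const_add y
    exact (h2.differentiableAt (by simp)).hasFDerivAt.comp_hasDerivAt t h3
  have hanti : StrictAntiOn (fun t : ℝ => r (y + t • z)) (Icc 0 s) :=
    strictAntiOn_of_deriv_neg (convex_Icc 0 s)
      (fun t ht => (hder t ht).continuousAt.continuousWithinAt) (fun t ht => by
        have ht' := interior_subset ht
        rw [(hder t ht').deriv]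
        exact (hε' (hdist t ⟨ht'.1, ht'.2.trans hs.2⟩)).1.1)
  have := hanti ⟨le_rfl, hs0.le⟩ ⟨hs0.le, le_rfl⟩ hs0
  simp only [zero_smul, add_zero] at this
  linarith

theorem innerForm_lower_bound (g : Metric n M) (o : M) :
    ∃ κ > 0, ∀ u, κ * ‖u‖ ^ 2 ≤ innerForm g o u u := by
  obtain ⟨κ, hκ, h⟩ := (isLocalMetric g o).eventually_le (mem_extChartAt_target (I := 𝓡 n) o)
  refine ⟨κ, hκ, fun u => ?_⟩
  have := h.self_of_nhds u
  rwa [innerForm_eq g (mem_extChartAt_source (I := 𝓡 n) o), chartDeriv_self]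

namespace IsNormalNhdVia

variable (hΩ : IsNormalNhdVia g o Ω S)
include hΩ

theorem log_mem {q : M} (hq : q ∈ Ω) : Function.invFunOn (expMap g o) S q ∈ S :=
  Function.invFunOn_mem (hΩ.bijOn.surjOn hq)

theorem exp_log {q : M} (hq : q ∈ Ω) : expMap g o (Function.invFunOn (expMap g o) S q) = q :=
  Function.invFunOn_eq (hΩ.bijOn.surjOn hq)

theorem log_exp {u : EuclideanSpace ℝ (Fin n)} (hu : u ∈ S) :
    Function.invFunOn (expMap g o) S (expMap g o u) = u :=
  hΩ.bijOn.injOn (hΩ.log_mem (hΩ.bijOn.mapsTo hu)) hu (hΩ.exp_log (hΩ.bijOn.mapsTo hu))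

theorem differentiableAt_log_chart {y : EuclideanSpace ℝ (Fin n)}
    (hy : y ∈ (extChartAt (𝓡 n) x₀).target) (hq : (extChartAt (𝓡 n) x₀).symm y ∈ Ω) :
    DifferentiableAt ℝ (fun y => Function.invFunOn (expMap g o) S ((extChartAt (𝓡 n) x₀).symm y))
      y := by
  have h1 : ContMDiffAt 𝓘(ℝ, EuclideanSpace ℝ (Fin n)) (𝓡 n) ∞ (extChartAt (𝓡 n) x₀).symm y :=
    (contMDiffOn_extChartAt_symm x₀).contMDiffAt ((isOpen_extChartAt_target x₀).mem_nhds hy)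
  have h2 := hΩ.smoothOn_inv.contMDiffAt (hΩ.isOpen.mem_nhds hq)
  have h3 := contMDiffAt_iff_contDiffAt.1 (ContMDiffAt.comp y h2 h1)
  exact h3.differentiableAt (by simp)

variable [T2Space M] (hg : IsComplete g)
include hg

/-- On `S`, `exp_o` has the logarithm as a differentiable left inverse, so its differential is
injective. -/
theorem nonConj {u : EuclideanSpace ℝ (Fin n)} (hu : u ∈ S) : NonConj g o u := by
  have hs := mem_extChartAt_source (I := 𝓡 n) (expMap g o u)
  set x₀ := expMap g o u with hx₀
  have hy : chartExp g o x₀ u ∈ (extChartAt (𝓡 n) x₀).target := (extChartAt (𝓡 n) x₀).map_source hs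
  have hsymm : (extChartAt (𝓡 n) x₀).symm (chartExp g o x₀ u) = x₀ :=
    (extChartAt (𝓡 n) x₀).left_inv hs
  have hL := hΩ.differentiableAt_log_chart hy (by rw [hsymm]; exact hΩ.bijOn.mapsTo hu)
  have hE := (contDiffAt_chartExp hg hs).differentiableAt (by simp)
  have hcomp := hL.hasFDerivAt.comp u hE.hasFDerivAt
  have hid := hcomp.unique ((hasFDerivAt_id u).congr_of_eventuallyEq (by
    filter_upwards [eventually_expMap_mem hg hs, hΩ.isOpen_source.mem_nhds hu] with v hv hvS
    simp only [Function.comp_apply, chartExp, (extChartAt (𝓡 n) x₀).left_inv hv, hΩ.log_exp hvS,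
      id]))
  rw [nonConj_iff hg hs, injective_iff_map_eq_zero]
  intro a ha
  have := DFunLike.congr_fun hid a
  rw [ContinuousLinearMap.comp_apply, ha, map_zero] at this
  exact this.symm

/-- Half the squared length of the logarithm along a segment in a chart. -/
theorem hasDerivAt_segment {y z : EuclideanSpace ℝ (Fin n)} {s : ℝ}
    (hy : y + s • z ∈ (extChartAt (𝓡 n) x₀).target)
    (hq : (extChartAt (𝓡 n) x₀).symm (y + s • z) ∈ Ω) :
    ContinuousAt (fun s : ℝ => Function.invFunOn (expMap g o) S
        ((extChartAt (𝓡 n) x₀).symm (y + s • z))) s ∧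
    chartExp g o x₀ (Function.invFunOn (expMap g o) S
        ((extChartAt (𝓡 n) x₀).symm (y + s • z))) = y + s • z ∧
    HasDerivAt (fun s : ℝ => innerForm g o
        (Function.invFunOn (expMap g o) S ((extChartAt (𝓡 n) x₀).symm (y + s • z)))
        (Function.invFunOn (expMap g o) S ((extChartAt (𝓡 n) x₀).symm (y + s • z))) / 2)
      (metricForm g x₀ (y + s • z) (radialVel g o x₀
        (Function.invFunOn (expMap g o) S ((extChartAt (𝓡 n) x₀).symm (y + s • z)))) z) s := by
  have hl : ∀ t : ℝ, HasDerivAt (fun t : ℝ => y + t • z) z t := fun t => by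
    simpa using ((hasDerivAt_id t).smul_const z).const_add y
  have hval : ∀ t : ℝ, y + t • z ∈ (extChartAt (𝓡 n) x₀).target →
      (extChartAt (𝓡 n) x₀).symm (y + t • z) ∈ Ω →
      chartExp g o x₀ (Function.invFunOn (expMap g o) S
        ((extChartAt (𝓡 n) x₀).symm (y + t • z))) = y + t • z := fun t ht hqt => by
    rw [chartExp, hΩ.exp_log hqt, (extChartAt (𝓡 n) x₀).right_inv ht]
  have hd : DifferentiableAt ℝ (fun s : ℝ => Function.invFunOn (expMap g o) S
      ((extChartAt (𝓡 n) x₀).symm (y + s • z))) s :=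
    DifferentiableAt.comp (f := fun s : ℝ => y + s • z) s (hΩ.differentiableAt_log_chart hy hq)
      (hl s).differentiableAt
  have hev : ∀ᶠ t in 𝓝 s, y + t • z ∈ (extChartAt (𝓡 n) x₀).target :=
    (hl s).continuousAt.eventually ((isOpen_extChartAt_target x₀).mem_nhds hy)
  have hcs : ContinuousAt (fun t : ℝ => (extChartAt (𝓡 n) x₀).symm (y + t • z)) s :=
    ContinuousAt.comp (f := fun t : ℝ => y + t • z)
      (continuousAt_extChartAt_symm'' (I := 𝓡 n) hy) (hl s).continuousAt
  refine ⟨hd.continuousAt, hval s hy hq, ?_⟩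
  have h1 := hasDerivAt_half_innerForm hg (o := o) (x₀ := x₀) (z := z) hd
    (by rw [hΩ.exp_log hq]; exact (extChartAt (𝓡 n) x₀).map_target hy)
    ((hl s).congr_of_eventuallyEq (by
      filter_upwards [hev, hcs.eventually (hΩ.isOpen.mem_nhds hq)] with t h1 h2
      exact hval t h1 h2))
  rwa [hval s hy hq] at h1

/-- The logarithm is bounded near each smooth boundary point. -/
theorem exists_norm_log_le (hp : p ∈ frontier Ω) (hr : IsDefiningFunction Ω p r) :
    ∃ R, ∀ᶠ q in 𝓝 p, q ∈ Ω → ‖Function.invFunOn (expMap g o) S q‖ ≤ R := by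
  set L := Function.invFunOn (expMap g o) S with hL
  set φ := extChartAt (𝓡 n) p with hφ
  set y₀ := φ p with hy₀
  have hG := isLocalMetric g p
  have hy₀t : y₀ ∈ φ.target := mem_extChartAt_target p
  obtain ⟨z, hz⟩ : ∃ z, fderiv ℝ r y₀ z < 0 := exists_apply_neg hr.fderiv_ne
  obtain ⟨C, hC, hC'⟩ := eventually_norm_le (A := fun y => metricForm g p y z z) (z₀ := y₀)
    (((hG.contDiffAt hy₀t).continuousAt.clm_apply continuousAt_const).clm_apply continuousAt_const)
  have hmem : ∀ᶠ y in 𝓝 y₀, y ∈ φ.target ∧ (φ.symm y ∈ Ω ↔ r y < 0) := by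
    filter_upwards [chart_target_mem_nhds p, (tendsto_chart_symm p).eventually hr.mem_iff]
      with y h1 h2
    rw [φ.right_inv h1] at h2
    exact ⟨h1, h2⟩
  obtain ⟨s₀, hs₀, δ, hδ, hseg⟩ := eventually_segment_neg (hr.contDiffAt.of_le (m := 1) (by simp))
    hz (hC'.and hmem)
  -- The point `y₀ + (s₀ / 2) z` is already inside `Ω`, where the logarithm is continuous; this
  -- bounds it at the far ends of all segments that start near `p`.
  have hend : ContinuousAt (fun y => L (φ.symm (y + (s₀ / 2) • z))) y₀ := by
    have h1 := hseg y₀ (Metric.mem_ball_self hδ) (s₀ / 2) ⟨by linarith, by linarith⟩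
    have h2 := h1.1.2.2.2 (h1.2 (hr.eq_zero hp).le (by linarith))
    exact ContinuousAt.comp (f := fun y => y + (s₀ / 2) • z)
      (hΩ.differentiableAt_log_chart h1.1.2.1 h2).continuousAt (by fun_prop)
  obtain ⟨R₁, hR₁, hR₁'⟩ := eventually_norm_le hend
  obtain ⟨κ, hκ, hκ'⟩ := innerForm_lower_bound g o
  set Q := Real.exp (s₀ / 2) * (‖innerForm g o‖ * R₁ * R₁ + C) with hQ
  refine ⟨Real.sqrt (Q / κ), ?_⟩
  filter_upwards [(tendsto_chart p).eventually (hR₁'.and (Metric.ball_mem_nhds y₀ hδ)),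
    (Starshaped.isOpen_source (n := n) p).mem_nhds (mem_extChartAt_source p)] with q hq hqs hqΩ
  have hsymm : φ.symm (φ q) = q := φ.left_inv hqs
  have hry : r (φ q) < 0 := by
    have h1 := (hseg (φ q) hq.2 0 ⟨le_rfl, hs₀.le⟩).1.2.2
    simp only [zero_smul, add_zero, hsymm] at h1
    exact h1.1 hqΩ
  have hin : ∀ s ∈ Icc 0 s₀, ‖metricForm g p (φ q + s • z) z z‖ ≤ C ∧ φ q + s • z ∈ φ.target ∧
      φ.symm (φ q + s • z) ∈ Ω := by
    intro s hs
    have h1 := hseg (φ q) hq.2 s hs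
    refine ⟨h1.1.1, h1.1.2.1, h1.1.2.2.2 ?_⟩
    rcases hs.1.eq_or_lt with h0 | h0
    · simpa [← h0] using hry
    · exact h1.2 hry.le h0
  set h : ℝ → ℝ := fun s => innerForm g o (L (φ.symm (φ q + s • z))) (L (φ.symm (φ q + s • z))) / 2
    with hh
  set h' : ℝ → ℝ := fun s => metricForm g p (φ q + s • z)
    (radialVel g o p (L (φ.symm (φ q + s • z)))) z with hh'
  -- By the Gauss lemma `h' = g(X, z)` and `g(X, X) = 2 h`. Positivity of `g` on `X ± z` bounds
  -- `|g(X, z)|` by `(g(X, X) + g(z, z)) / 2 ≤ h + C / 2`.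
  have hder : ∀ s ∈ Icc 0 s₀, HasDerivAt h (h' s) s ∧ |h' s| ≤ h s + C / 2 := by
    intro s hs
    obtain ⟨h1, h2, h3⟩ := hin s hs
    obtain ⟨-, h4, h5⟩ := hΩ.hasDerivAt_segment hg h2 h3
    refine ⟨h5, ?_⟩
    have hsrc : expMap g o (L (φ.symm (φ q + s • z))) ∈ φ.source := by
      rw [hL, hΩ.exp_log h3]; exact φ.map_target h2
    have h6 := metricForm_radialVel_self hg hsrc
    rw [h4] at h6
    set X := radialVel g o p (L (φ.symm (φ q + s • z))) with hX
    have h7 := hG.nonneg h2 (X - z)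
    have h8 := hG.nonneg h2 (X + z)
    have h9 := hG.symm _ h2 X z
    have h10 := (abs_le.1 h1).2
    simp only [map_sub, map_add, ContinuousLinearMap.sub_apply, ContinuousLinearMap.add_apply] at h7 h8
    have h11 : h' s = metricForm g p (φ q + s • z) X z := rfl
    have h12 : h s = metricForm g p (φ q + s • z) X X / 2 := by rw [h6]
    rw [abs_le, h11, h12]
    constructor <;> linarith
  -- Grönwall is run backwards, from the controlled end at `s₀ / 2` towards the point near the
  -- boundary.
  have hle : ∀ s ∈ Ioc 0 (s₀ / 2), h s + C / 2 ≤ Real.exp (s₀ / 2) * (h (s₀ / 2) + C / 2) := by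
    intro s hs
    have hneg : ∀ t ∈ Ioo (-s₀) 0, HasDerivAt (fun t => h (-t) + C / 2) (-h' (-t)) t := by
      intro t ht
      have h1 := (hder (-t) ⟨by linarith [ht.2], by linarith [ht.1]⟩).1
      have h2 := (h1.scomp t (hasDerivAt_neg t)).add_const (C / 2)
      simpa [Function.comp_def] using h2
    have h3 := image_le_mul_exp_of_hasDerivAt_le hneg (C := 1) (fun t ht => by
      have h2 := (abs_le.1 (hder (-t) ⟨by linarith [ht.2], by linarith [ht.1]⟩).2).1
      linarith) (s := -(s₀ / 2)) (t := -s) ⟨by linarith, by linarith⟩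
      ⟨by linarith [hs.2], by linarith [hs.1]⟩ (by linarith [hs.2])
    simp only [neg_neg] at h3
    refine h3.trans ?_
    have h4 : 0 ≤ h (s₀ / 2) + C / 2 :=
      (abs_nonneg _).trans (hder (s₀ / 2) ⟨by linarith, by linarith⟩).2
    gcongr
    linarith [hs.1]
  have hle0 : h 0 + C / 2 ≤ Real.exp (s₀ / 2) * (h (s₀ / 2) + C / 2) := by
    have hc : Tendsto (fun s => h s + C / 2) (𝓝[>] 0) (𝓝 (h 0 + C / 2)) :=
      (((hder 0 ⟨le_rfl, hs₀.le⟩).1.continuousAt.add continuousAt_const).tendsto).mono_left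
        nhdsWithin_le_nhds
    exact le_of_tendsto hc (by
      filter_upwards [Ioc_mem_nhdsGT (half_pos hs₀)] with s hs using hle s hs)
  have hend2 : h (s₀ / 2) + C / 2 ≤ (‖innerForm g o‖ * R₁ * R₁ + C) / 2 := by
    have h1 : ‖L (φ.symm (φ q + (s₀ / 2) • z))‖ ≤ R₁ := hq.1
    have h2 := (le_abs_self _).trans ((innerForm g o).le_opNorm₂ (L (φ.symm (φ q + (s₀ / 2) • z)))
      (L (φ.symm (φ q + (s₀ / 2) • z))))
    have h3 : ‖innerForm g o‖ * ‖L (φ.symm (φ q + (s₀ / 2) • z))‖ *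
        ‖L (φ.symm (φ q + (s₀ / 2) • z))‖ ≤ ‖innerForm g o‖ * R₁ * R₁ := by gcongr
    simp only [hh]
    linarith
  have hfin : 2 * h 0 ≤ Q := by
    have := mul_le_mul_of_nonneg_left hend2 (Real.exp_nonneg (s₀ / 2))
    rw [hQ]
    nlinarith
  have h0 : 2 * h 0 = innerForm g o (L q) (L q) := by
    simp only [hh, zero_smul, add_zero, hsymm]; ring
  rw [h0] at hfin
  refine Real.le_sqrt_of_sq_le ?_
  rw [le_div_iff₀ hκ]
  linarith [hκ' (L q)]

end IsNormalNhdVia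

end Starshaped

end

/-! ### The logarithm at the boundary; starshaped implies outward radial velocities. -/

noncomputable section

namespace Starshaped

variable {n : ℕ} {M : Type*} [TopologicalSpace M] [ChartedSpace (EuclideanSpace ℝ (Fin n)) M]
  [IsManifold (𝓡 n) ∞ M] {g : Metric n M} {o p x₀ : M} {Ω : Set M}
  {S : Set (EuclideanSpace ℝ (Fin n))} {r : EuclideanSpace ℝ (Fin n) → ℝ}

section Log

variable [T2Space M] (hg : IsComplete g)
include hg

theorem IsNormalNhdVia.exp_mem_closure (hΩ : IsNormalNhdVia g o Ω S)
    {u : EuclideanSpace ℝ (Fin n)} (hu : u ∈ closure S) : expMap g o u ∈ closure Ω :=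
  map_mem_closure (continuous_expMap hg o) hu hΩ.bijOn.mapsTo

/-- A vector of `closure S` is a limit of vectors of `S`, whose images are still near `p`, so the
bound on the logarithm passes to it. -/
theorem IsNormalNhdVia.exists_norm_le (hΩ : IsNormalNhdVia g o Ω S) (hp : p ∈ frontier Ω)
    (hr : IsDefiningFunction Ω p r) :
    ∃ R, ∀ᶠ q in 𝓝 p, ∀ u ∈ closure S, expMap g o u = q → ‖u‖ ≤ R := by
  obtain ⟨R, hR⟩ := hΩ.exists_norm_log_le hg hp hr
  refine ⟨R, ?_⟩
  filter_upwards [hR.eventually_nhds] with q hq u hu huq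
  have h1 : ∀ᶠ w in 𝓝 u, expMap g o w ∈ Ω →
      ‖Function.invFunOn (expMap g o) S (expMap g o w)‖ ≤ R := by
    have hc := (continuous_expMap hg o).tendsto u
    rw [huq] at hc
    exact hc.eventually hq
  refine le_of_tendsto_of_frequently (continuous_norm.tendsto u) ?_
  refine ((mem_closure_iff_frequently.1 hu).and_eventually h1).mono fun w hw => ?_
  have h2 := hw.2 (hΩ.bijOn.mapsTo hw.1)
  rwa [hΩ.log_exp hw.1] at h2

/-- Points of `Ω` near `p` have logarithms in one compact subset of `closure S`, whose image is
closed and hence contains `p`. -/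
theorem IsNormalNhdVia.exists_log (hΩ : IsNormalNhdVia g o Ω S) (hp : p ∈ frontier Ω)
    (hr : IsDefiningFunction Ω p r) : ∃ v ∈ closure S, expMap g o v = p := by
  obtain ⟨R, hR⟩ := hΩ.exists_norm_le hg hp hr
  have hK : IsCompact (closure S ∩ Metric.closedBall 0 R) :=
    (isCompact_closedBall 0 R).inter_left isClosed_closure
  have hclosed := (hK.image (continuous_expMap hg o)).isClosed
  have hmem : p ∈ expMap g o '' (closure S ∩ Metric.closedBall 0 R) := by
    refine hclosed.closure_subset (mem_closure_iff_frequently.2 ?_)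
    refine ((mem_closure_iff_frequently.1 (frontier_subset_closure hp)).and_eventually hR).mono ?_
    rintro q ⟨hq, hqR⟩
    obtain ⟨u, hu, rfl⟩ := hΩ.bijOn.surjOn hq
    exact ⟨u, ⟨subset_closure hu, mem_closedBall_zero_iff.2 (hqR u (subset_closure hu) rfl)⟩, rfl⟩
  obtain ⟨v, hv, hvp⟩ := hmem
  exact ⟨v, hv.1, hvp⟩

/-- If the image lay in `Ω`, it would also be the image of a point of `S`, against injectivity on
`closure S`. -/
theorem IsRegularNormalNhdVia.exp_mem_frontier (hΩ : IsRegularNormalNhdVia g o Ω S)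
    {u : EuclideanSpace ℝ (Fin n)} (hu : u ∈ closure S) (hu' : u ∉ S) :
    expMap g o u ∈ frontier Ω := by
  rw [hΩ.isOpen.frontier_eq]
  refine ⟨hΩ.exp_mem_closure hg hu, fun h => hu' ?_⟩
  obtain ⟨w, hw, hwu⟩ := hΩ.bijOn.surjOn h
  rwa [← hΩ.injOn_closure (subset_closure hw) hu hwu]

/-- The logarithm is continuous at smooth boundary points. -/
theorem IsRegularNormalNhdVia.eventually_log_mem (hΩ : IsRegularNormalNhdVia g o Ω S)
    (hp : p ∈ frontier Ω) (hr : IsDefiningFunction Ω p r) {v : EuclideanSpace ℝ (Fin n)}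
    (hv : v ∈ closure S) (hvp : expMap g o v = p) {N : Set (EuclideanSpace ℝ (Fin n))}
    (hN : N ∈ 𝓝 v) : ∀ᶠ q in 𝓝 p, ∀ u ∈ closure S, expMap g o u = q → u ∈ N := by
  obtain ⟨R, hR⟩ := hΩ.exists_norm_le hg hp hr
  have hK : IsCompact ((closure S ∩ Metric.closedBall 0 R) \ interior N) :=
    ((isCompact_closedBall 0 R).inter_left isClosed_closure).diff isOpen_interior
  have hclosed := (hK.image (continuous_expMap hg o)).isClosed
  -- By injectivity `v` is the only preimage of `p` in `closure S`, so the compact set of bounded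
  -- vectors outside `N` misses `p`, and its closed image misses a neighbourhood of `p`.
  have hnot : p ∉ expMap g o '' ((closure S ∩ Metric.closedBall 0 R) \ interior N) := by
    rintro ⟨w, hw, hwp⟩
    have := hΩ.injOn_closure hw.1.1 hv (hwp.trans hvp.symm)
    exact hw.2 (this ▸ mem_interior_iff_mem_nhds.2 hN)
  filter_upwards [hR, hclosed.isOpen_compl.mem_nhds hnot] with q hq1 hq2 u hu huq
  by_contra huN
  exact hq2 ⟨u, ⟨⟨hu, mem_closedBall_zero_iff.2 (hq1 u hu huq)⟩,
    fun h => huN (interior_subset h)⟩, huq⟩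

/-- A starshaped neighborhood is the image of a starshaped set under the exponential map, for
every choice of the normal domain. -/
theorem IsRegularNormalNhdVia.starConvex (hΩ : IsRegularNormalNhdVia g o Ω S)
    (h : IsStarshapedNhd g o Ω) : StarConvex ℝ 0 S := by
  obtain ⟨S', hS', hstar⟩ := h
  have hsub : S' ⊆ S := by
    intro u hu
    have hseg : ∀ t ∈ Icc (0 : ℝ) 1, t • u ∈ S' := fun t ht => by
      have := hstar.smul_mem hu ht.1 ht.2
      exact this
    have hc : Continuous fun t : ℝ => t • u := by fun_prop
    -- The times with `t u ∈ S` are open. They are closed in the interval as well: a limit vector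
    -- lies in `closure S` and its image lies in `Ω`, so injectivity on `closure S` puts it in `S`.
    have hI : Icc (0 : ℝ) 1 ⊆ (fun t : ℝ => t • u) ⁻¹' S := by
      refine isPreconnected_Icc.subset_of_closure_inter_subset (hΩ.isOpen_source.preimage hc)
        ⟨0, ⟨le_rfl, zero_le_one⟩, by simpa using hΩ.zero_mem⟩ ?_
      rintro t ⟨ht, htI⟩
      have h1 : t • u ∈ closure S := closure_mono (image_preimage_subset _ _)
        (mem_closure_image (f := fun t : ℝ => t • u) hc.continuousAt ht)
      obtain ⟨w, hw, hwu⟩ := hΩ.bijOn.surjOn (hS'.bijOn.mapsTo (hseg t htI))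
      have h2 := hΩ.injOn_closure (subset_closure hw) h1 hwu
      exact (h2 ▸ hw : t • u ∈ S)
    simpa using hI (right_mem_Icc.2 zero_le_one)
  have heq : S = S' := by
    refine Subset.antisymm (fun u hu => ?_) hsub
    obtain ⟨w, hw, hwu⟩ := hS'.bijOn.surjOn (hΩ.bijOn.mapsTo hu)
    rwa [← hΩ.bijOn.injOn (hsub hw) hu hwu]
  rw [heq]; exact hstar

/-- The radial geodesics of a starshaped neighborhood leave it outwards. -/
theorem IsNormalNhdVia.fderiv_radialVel_nonneg (hΩ : IsNormalNhdVia g o Ω S)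
    (hS : StarConvex ℝ 0 S) (hr : IsDefiningFunction Ω p r) (hp : p ∈ frontier Ω)
    {v : EuclideanSpace ℝ (Fin n)} (hv : v ∈ closure S) (hvp : expMap g o v = p) :
    0 ≤ fderiv ℝ r (extChartAt (𝓡 n) p p) (radialVel g o p v) := by
  have hs : expMap g o v ∈ (extChartAt (𝓡 n) p).source := by
    rw [hvp]; exact mem_extChartAt_source p
  have hline : HasDerivAt (fun t : ℝ => (1 - t) • v) (-v) 0 := by
    simpa using ((hasDerivAt_id (0 : ℝ)).const_sub 1).smul_const v
  have h1 : HasDerivAt (fun t : ℝ => chartExp g o p ((1 - t) • v)) (-radialVel g o p v) 0 := by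
    have h2 := ((contDiffAt_chartExp hg hs).differentiableAt (by simp)).hasFDerivAt
    have h3 := HasFDerivAt.comp_hasDerivAt (f := fun t : ℝ => (1 - t) • v) 0
      (by simpa using h2) hline
    rw [map_neg, fderiv_chartExp_self hg hs] at h3
    exact h3
  have hval : chartExp g o p v = extChartAt (𝓡 n) p p := by rw [chartExp, hvp]
  have h4 : HasDerivAt (fun t : ℝ => r (chartExp g o p ((1 - t) • v)))
      (-fderiv ℝ r (extChartAt (𝓡 n) p p) (radialVel g o p v)) 0 := by
    rw [← map_neg]
    refine HasFDerivAt.comp_hasDerivAt (f := fun t : ℝ => chartExp g o p ((1 - t) • v)) 0 ?_ h1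
    simp only [sub_zero, one_smul, hval]
    exact hr.hasFDerivAt
  by_contra! hneg
  -- A negative pairing would make `r` positive just before the end of the radial geodesic, but
  -- starshapedness keeps that part in `closure Ω`, where `r ≤ 0`.
  have h5 := eventually_pos_of_hasDerivAt h4
    (by simpa only [sub_zero, one_smul, hval] using hr.eq_zero hp) (neg_pos.2 hneg)
  have h6 : Tendsto (fun t : ℝ => expMap g o ((1 - t) • v)) (𝓝[>] 0) (𝓝 p) := by
    have hc : Continuous fun t : ℝ => expMap g o ((1 - t) • v) :=
      (continuous_expMap hg o).comp (by fun_prop)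
    have := hc.tendsto 0
    simp only [sub_zero, one_smul, hvp] at this
    exact this.mono_left nhdsWithin_le_nhds
  obtain ⟨t, ht1, ht2, ht3⟩ := (h5.and ((h6.eventually hr.mem_closure_iff).and
    (Ioo_mem_nhdsGT (zero_lt_one (α := ℝ))))).exists
  have h7 : (1 - t) • v ∈ closure S := by
    have hc : Continuous fun u : EuclideanSpace ℝ (Fin n) => (1 - t) • u := by fun_prop
    exact map_mem_closure hc hv fun u hu =>
      hS.smul_mem hu (by linarith [ht3.2]) (by linarith [ht3.1])
  exact absurd (ht2.1 (hΩ.exp_mem_closure hg h7)) (not_le.2 ht1)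

end Log

/-- A defining function near `p` yields defining functions at the boundary points near `p`. -/
theorem IsDefiningFunction.eventually_transition (hr : IsDefiningFunction Ω p r) :
    ∀ᶠ q in 𝓝 p, IsDefiningFunction Ω q (fun y => r (transition n q p y)) ∧
      ∀ w, fderiv ℝ (fun y => r (transition n q p y)) (extChartAt (𝓡 n) q q) w =
        fderiv ℝ r (extChartAt (𝓡 n) p q) (chartDeriv n p q w) := by
  have hd : ContDiffAt ℝ ∞ (fderiv ℝ r) (extChartAt (𝓡 n) p p) :=
    hr.contDiffAt.fderiv_right (by simp)
  have hne : ∀ᶠ q in 𝓝 p, fderiv ℝ r (extChartAt (𝓡 n) p q) ≠ 0 :=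
    (tendsto_chart p).eventually (hd.continuousAt.eventually_ne hr.fderiv_ne)
  filter_upwards [hr.eventually_contDiffAt.eventually_nhds, hne, hr.mem_iff.eventually_nhds,
    hr.frontier_iff.eventually_nhds, (isOpen_source (n := n) p).mem_nhds (mem_extChartAt_source p)]
    with q h1 h2 h3 h4 hq
  have hqq := mem_extChartAt_source (I := 𝓡 n) q
  have htr : ∀ᶠ q' in 𝓝 q, transition n q p (extChartAt (𝓡 n) q q') = extChartAt (𝓡 n) p q' := by
    filter_upwards [(isOpen_source (n := n) q).mem_nhds hqq] with q' hq'
    rw [transition, (extChartAt (𝓡 n) q).left_inv hq']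
  have hcd : ∀ᶠ q' in 𝓝 q, ContDiffAt ℝ ∞ (fun y => r (transition n q p y))
      (extChartAt (𝓡 n) q q') := by
    filter_upwards [(isOpen_source (n := n) q).mem_nhds hqq, (isOpen_source (n := n) p).mem_nhds hq, h1, htr]
      with q' h5 h6 h7 h8
    rw [← h8] at h7
    exact h7.comp _ (contDiffAt_transition h5 h6)
  have hder : ∀ w, fderiv ℝ (fun y => r (transition n q p y)) (extChartAt (𝓡 n) q q) w =
      fderiv ℝ r (extChartAt (𝓡 n) p q) (chartDeriv n p q w) := by
    intro w
    have h5 := (h1.self_of_nhds.differentiableAt (by simp)).hasFDerivAt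
    rw [← htr.self_of_nhds] at h5
    have h6 := ((contDiffAt_transition hqq hq).differentiableAt (by simp)).hasFDerivAt
    have h7 := (h5.comp _ h6).fderiv
    simp only [Function.comp_def] at h7
    rw [h7, ContinuousLinearMap.comp_apply, htr.self_of_nhds,
      chartDeriv_eq_transition hqq hq, chartDeriv_self]
  refine ⟨⟨hcd, fun h => h2 ?_, ?_, ?_⟩, hder⟩
  · ext w
    obtain ⟨w', rfl⟩ : ∃ w', chartDeriv n p q w' = w :=
      ⟨chartSymmDeriv n p (extChartAt (𝓡 n) p q) w, chartDeriv_chartSymmDeriv hq w⟩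
    rw [← hder, h]; rfl
  · filter_upwards [h3, htr] with q' h5 h6
    rw [h5, h6]
  · filter_upwards [h4, htr] with q' h5 h6
    rw [h5, h6]

end Starshaped

end

/-! ### Outward radial velocities imply starshaped. -/

noncomputable section

namespace Starshaped

theorem tendsto_form_apply {E ι : Type*} [NormedAddCommGroup E] [NormedSpace ℝ E] {l : Filter ι}
    {B : ι → E →L[ℝ] E →L[ℝ] ℝ} {B₀ : E →L[ℝ] E →L[ℝ] ℝ} {x : ι → E} {x₀ : E}
    (hB : Tendsto B l (𝓝 B₀)) (hx : Tendsto x l (𝓝 x₀)) (z : E) :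
    Tendsto (fun i => B i (x i) z) l (𝓝 (B₀ x₀ z)) := by
  have h : Continuous fun q : (E →L[ℝ] E →L[ℝ] ℝ) × E => q.1 q.2 z := by fun_prop
  exact (h.tendsto (B₀, x₀)).comp (hB.prodMk_nhds hx)

/-- A `C¹` function that is nonnegative on the hypersurface `{r = 0}` is bounded below by a
multiple of `-|r|`. -/
theorem exists_neg_mul_abs_le {E : Type*} [NormedAddCommGroup E] [NormedSpace ℝ E] {r b : E → ℝ}
    {y₀ : E} (hr : ContDiffAt ℝ 1 r y₀) (hr' : fderiv ℝ r y₀ ≠ 0) (hr0 : r y₀ = 0)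
    (hb : ContDiffAt ℝ 1 b y₀) (hpos : ∀ᶠ y in 𝓝 y₀, r y = 0 → 0 ≤ b y) :
    ∃ C, 0 ≤ C ∧ ∀ᶠ y in 𝓝 y₀, -(C * |r y|) ≤ b y := by
  -- Since `r` increases at speed at least `1` along `z`, a zero of `r` is met within time `|r y|`.
  -- There `b` is nonnegative, and Lipschitz continuity of `b` loses at most `K ‖z‖ |r y|` on the
  -- way back.
  obtain ⟨z, hz⟩ : ∃ z, 1 < fderiv ℝ r y₀ z := by
    obtain ⟨z, hz⟩ := exists_apply_neg hr'
    exact ⟨(2 / fderiv ℝ r y₀ z) • z, by simp [hz.ne]⟩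
  obtain ⟨K, N, hN, hK⟩ := hb.exists_lipschitzOnWith
  have h1 : ∀ᶠ y in 𝓝 y₀, 1 < fderiv ℝ r y z :=
    ((hr.fderiv_right (m := 0) (by simp)).continuousAt.clm_apply continuousAt_const).eventually
      (lt_mem_nhds hz)
  obtain ⟨ε, hε, hε'⟩ := Metric.eventually_nhds_iff.1
    ((h1.and (hr.eventually (by simp))).and ((eventually_mem_set.2 hN).and hpos))
  have hrc : Tendsto (fun y => |r y| * ‖z‖) (𝓝 y₀) (𝓝 0) := by
    have := hr.continuousAt.tendsto.abs.mul_const ‖z‖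
    simpa [hr0] using this
  refine ⟨K * ‖z‖, by positivity, ?_⟩
  filter_upwards [hrc.eventually (gt_mem_nhds (half_pos hε)),
    Metric.ball_mem_nhds y₀ (half_pos hε)] with y hy hyb
  have hdist : ∀ s ∈ Icc (-|r y|) |r y|, dist (y + s • z) y₀ < ε := fun s hs => by
    have e1 : dist (y + s • z) y ≤ |r y| * ‖z‖ := by
      rw [dist_eq_norm, add_sub_cancel_left, norm_smul, Real.norm_eq_abs]
      exact mul_le_mul_of_nonneg_right (abs_le.2 hs) (norm_nonneg z)
    have e3 := dist_triangle (y + s • z) y y₀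
    have e4 : dist y y₀ < ε / 2 := hyb
    linarith
  have hder : ∀ t ∈ Icc (-|r y|) |r y|,
      HasDerivAt (fun t : ℝ => r (y + t • z)) (fderiv ℝ r (y + t • z) z) t := by
    intro t ht
    have h3 : HasDerivAt (fun t : ℝ => y + t • z) z t := by
      simpa using ((hasDerivAt_id t).smul_const z).const_add y
    exact ((hε' (hdist t ht)).1.2.differentiableAt (by simp)).hasFDerivAt.comp_hasDerivAt t h3
  have hcont : ContinuousOn (fun t : ℝ => r (y + t • z)) (Icc (-|r y|) |r y|) :=
    fun t ht => (hder t ht).continuousAt.continuousWithinAt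
  have habs := abs_nonneg (r y)
  have hmono := Convex.mul_sub_le_image_sub_of_le_deriv (convex_Icc (-|r y|) |r y|) hcont
    (fun t ht => (hder t (interior_subset ht)).differentiableAt.differentiableWithinAt) (C := 1)
    (fun t ht => by
      rw [(hder t (interior_subset ht)).deriv]
      exact (hε' (hdist t (interior_subset ht))).1.1.le)
  have h0 : (0 : ℝ) ∈ Icc (-|r y|) |r y| := ⟨by linarith, habs⟩
  have hl : (-|r y|) ∈ Icc (-|r y|) |r y| := ⟨le_rfl, by linarith⟩
  have hu : |r y| ∈ Icc (-|r y|) |r y| := ⟨by linarith, le_rfl⟩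
  have e1 := hmono _ hl _ h0 h0.1
  have e2 := hmono _ h0 _ hu h0.2
  simp only [zero_smul, add_zero] at e1 e2
  obtain ⟨s, hs, hs0⟩ := intermediate_value_Icc (by linarith) hcont
    (show (0 : ℝ) ∈ Icc _ _ from ⟨by linarith [le_abs_self (r y)], by linarith [neg_abs_le (r y)]⟩)
  have hbs := (hε' (hdist s hs)).2.2 hs0
  have hLip := hK.dist_le_mul _ (hε' (hdist s hs)).2.1 y (by
    have := (hε' (hdist 0 h0)).2.1
    simpa using this)
  rw [Real.dist_eq, dist_eq_norm, add_sub_cancel_left, norm_smul, Real.norm_eq_abs] at hLip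
  have e3 : (K : ℝ) * (|s| * ‖z‖) ≤ K * (|r y| * ‖z‖) :=
    mul_le_mul_of_nonneg_left (mul_le_mul_of_nonneg_right (abs_le.2 hs) (norm_nonneg z)) K.2
  have e4 := le_abs_self (b (y + s • z) - b y)
  linarith

variable {n : ℕ} {M : Type*} [TopologicalSpace M] [ChartedSpace (EuclideanSpace ℝ (Fin n)) M]
  [IsManifold (𝓡 n) ∞ M] {g : Metric n M} {o p x₀ : M} {Ω : Set M}
  {S : Set (EuclideanSpace ℝ (Fin n))} {r : EuclideanSpace ℝ (Fin n) → ℝ}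

/-- The radial geodesics do not enter `Ω` at its boundary points. -/
def RadiallyOutward (g : Metric n M) (o : M) (Ω : Set M) (S : Set (EuclideanSpace ℝ (Fin n))) :
    Prop :=
  ∀ p ∈ frontier Ω, ∀ r : EuclideanSpace ℝ (Fin n) → ℝ, IsDefiningFunction Ω p r →
    ∀ v ∈ closure S, expMap g o v = p →
      0 ≤ fderiv ℝ r (extChartAt (𝓡 n) p p) (radialVel g o p v)

/-- The part of `S` that is starshaped about `0`. -/
def starPart (S : Set (EuclideanSpace ℝ (Fin n))) : Set (EuclideanSpace ℝ (Fin n)) :=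
  {u | ∀ t ∈ Icc (0 : ℝ) 1, t • u ∈ S}

theorem isOpen_starPart (hS : IsOpen S) : IsOpen (starPart S) := by
  refine isOpen_iff_mem_nhds.2 fun u hu => ?_
  refine isCompact_Icc.eventually_forall_of_forall_eventually fun t ht => ?_
  have hc : Continuous fun z : EuclideanSpace ℝ (Fin n) × ℝ => z.2 • z.1 := by fun_prop
  exact hc.continuousAt.eventually (hS.mem_nhds (hu t ht))

section

variable [T2Space M] (hg : IsComplete g) (hΩ : IsRegularNormalNhdVia g o Ω S)
include hg hΩ

/-- The logarithm of a segment issuing from `p` is not known to start in `A`, only at a limit point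
of `A`. The segment is therefore approximated by parallel ones that start at images of points of
`A`. Their logarithms stay in `A` by connectedness, and relative closedness passes this to the
limit. -/
theorem exists_log_segment_mem (hp : p ∈ frontier Ω) (hr : IsDefiningFunction Ω p r)
    {A : Set (EuclideanSpace ℝ (Fin n))} (hAS : A ⊆ S) (hAopen : IsOpen A)
    (hAcl : closure A ∩ S ⊆ A) {w : EuclideanSpace ℝ (Fin n)} (hwA : w ∈ closure A)
    (hwp : expMap g o w = p) {z : EuclideanSpace ℝ (Fin n)}
    (hz : fderiv ℝ r (extChartAt (𝓡 n) p p) z < 0) :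
    ∃ s₀ : ℝ, 0 < s₀ ∧ ∀ s ∈ Ioc 0 s₀,
      extChartAt (𝓡 n) p p + s • z ∈ (extChartAt (𝓡 n) p).target ∧
      (extChartAt (𝓡 n) p).symm (extChartAt (𝓡 n) p p + s • z) ∈ Ω ∧
      Function.invFunOn (expMap g o) S
        ((extChartAt (𝓡 n) p).symm (extChartAt (𝓡 n) p p + s • z)) ∈ A := by
  set L := Function.invFunOn (expMap g o) S with hL
  have hs : expMap g o w ∈ (extChartAt (𝓡 n) p).source := by
    rw [hwp]; exact mem_extChartAt_source p
  have hmem : ∀ᶠ y in 𝓝 (extChartAt (𝓡 n) p p), y ∈ (extChartAt (𝓡 n) p).target ∧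
      ((extChartAt (𝓡 n) p).symm y ∈ Ω ↔ r y < 0) := by
    filter_upwards [chart_target_mem_nhds p, (tendsto_chart_symm p).eventually hr.mem_iff]
      with y h1 h2
    rw [(extChartAt (𝓡 n) p).right_inv h1] at h2
    exact ⟨h1, h2⟩
  obtain ⟨s₀, hs₀, δ, hδ, hseg⟩ := eventually_segment_neg
    (hr.contDiffAt.of_le (m := 1) (by simp)) hz hmem
  have hin : ∀ y ∈ Metric.ball (extChartAt (𝓡 n) p p) δ, r y ≤ 0 → ∀ s ∈ Ioc 0 s₀,
      y + s • z ∈ (extChartAt (𝓡 n) p).target ∧ (extChartAt (𝓡 n) p).symm (y + s • z) ∈ Ω := by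
    intro y hy hry s hs
    have h1 := hseg y hy s ⟨hs.1.le, hs.2⟩
    exact ⟨h1.1.1, h1.1.2.2 (h1.2 hry hs.1)⟩
  have hfc : ContinuousAt (chartExp g o p) w := (contDiffAt_chartExp hg hs).continuousAt
  have hy₀ : chartExp g o p w = extChartAt (𝓡 n) p p := by rw [chartExp, hwp]
  have hinA : ∀ s ∈ Ioc 0 s₀,
      L ((extChartAt (𝓡 n) p).symm (extChartAt (𝓡 n) p p + s • z)) ∈ A := by
    intro s hs'
    have hy₀in := hin _ (Metric.mem_ball_self hδ) (hr.eq_zero hp).le s hs'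
    have hfr : ∃ᶠ u in 𝓝 w, u ∈ A := mem_closure_iff_frequently.1 hwA
    have hcl : L ((extChartAt (𝓡 n) p).symm (extChartAt (𝓡 n) p p + s • z)) ∈ closure A := by
      have hc : ContinuousAt (fun u => L ((extChartAt (𝓡 n) p).symm (chartExp g o p u + s • z))) w :=
        ContinuousAt.comp (g := fun y => L ((extChartAt (𝓡 n) p).symm y))
          (f := fun u => chartExp g o p u + s • z)
          (by rw [hy₀]; exact (hΩ.differentiableAt_log_chart hy₀in.1 hy₀in.2).continuousAt)
          (hfc.add continuousAt_const)
      have hct := hc.tendsto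
      rw [hy₀] at hct
      refine mem_closure_iff_frequently.2 (Tendsto.frequently hct ?_)
      have hb : ∀ᶠ u in 𝓝 w, chartExp g o p u ∈ Metric.ball (extChartAt (𝓡 n) p p) δ :=
        hfc.eventually (hy₀ ▸ Metric.ball_mem_nhds _ hδ)
      refine (hfr.and_eventually (hb.and (eventually_expMap_mem hg hs))).mono ?_
      rintro u ⟨huA, hub, hus⟩
      have hru : (extChartAt (𝓡 n) p).symm (chartExp g o p u) = expMap g o u :=
        (extChartAt (𝓡 n) p).left_inv hus
      have huΩ : expMap g o u ∈ Ω := hΩ.bijOn.mapsTo (hAS huA)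
      have hry : r (chartExp g o p u) < 0 := by
        have h1 := (hseg _ hub 0 ⟨le_rfl, hs₀.le⟩).1.2
        simp only [zero_smul, add_zero, hru] at h1
        exact h1.1 huΩ
      have hpath : ∀ t ∈ Icc 0 s₀, chartExp g o p u + t • z ∈ (extChartAt (𝓡 n) p).target ∧
          (extChartAt (𝓡 n) p).symm (chartExp g o p u + t • z) ∈ Ω := by
        intro t ht
        rcases ht.1.eq_or_lt with h | h
        · rw [← h, zero_smul, add_zero, hru]
          exact ⟨(extChartAt (𝓡 n) p).map_source hus, huΩ⟩
        · exact hin _ hub hry.le t ⟨h, ht.2⟩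
      have hsubA : (fun t : ℝ => L ((extChartAt (𝓡 n) p).symm (chartExp g o p u + t • z))) ''
          Icc 0 s₀ ⊆ A := by
        refine IsPreconnected.subset_of_closure_inter_subset
          (isPreconnected_Icc.image _ fun t ht => ?_) hAopen ?_ ?_
        · exact (hΩ.hasDerivAt_segment hg (hpath t ht).1 (hpath t ht).2).1.continuousWithinAt
        · refine ⟨u, ⟨0, ⟨le_rfl, hs₀.le⟩, ?_⟩, huA⟩
          simp only [zero_smul, add_zero, hru]
          exact hΩ.log_exp (hAS huA)
        · rintro _ ⟨h1, t, ht, rfl⟩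
          exact hAcl ⟨h1, hΩ.log_mem (hpath t ht).2⟩
      exact hsubA ⟨s, ⟨hs'.1.le, hs'.2⟩, rfl⟩
    exact hAcl ⟨hcl, hΩ.log_mem hy₀in.2⟩
  refine ⟨s₀, hs₀, fun s hs' => ?_⟩
  have h1 := hin _ (Metric.mem_ball_self hδ) (hr.eq_zero hp).le s hs'
  exact ⟨h1.1, h1.2, hinA s hs'⟩

/-- The radial velocity at a nearest point of a relatively clopen part of `S` points outwards. -/
theorem metricForm_radialVel_nonneg_of_minimal (hp : p ∈ frontier Ω) (hr : IsDefiningFunction Ω p r)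
    {A : Set (EuclideanSpace ℝ (Fin n))} (hAS : A ⊆ S) (hAopen : IsOpen A)
    (hAcl : closure A ∩ S ⊆ A) {w : EuclideanSpace ℝ (Fin n)} (hwA : w ∈ closure A)
    (hwmin : ∀ u ∈ A, innerForm g o w w ≤ innerForm g o u u)
    (hwp : expMap g o w = p) {z : EuclideanSpace ℝ (Fin n)}
    (hz : fderiv ℝ r (extChartAt (𝓡 n) p p) z < 0) :
    0 ≤ metricForm g p (extChartAt (𝓡 n) p p) (radialVel g o p w) z := by
  by_contra! hlt
  obtain ⟨s₀, hs₀, hin⟩ := exists_log_segment_mem hg hΩ hp hr hAS hAopen hAcl hwA hwp hz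
  have hs : expMap g o w ∈ (extChartAt (𝓡 n) p).source := by
    rw [hwp]; exact mem_extChartAt_source p
  have hG := isLocalMetric g p
  have hy₀t : extChartAt (𝓡 n) p p ∈ (extChartAt (𝓡 n) p).target := mem_extChartAt_target p
  set X := radialVel g o p w with hX
  have hNc : Continuous fun u => innerForm g o u u := by fun_prop
  set L := Function.invFunOn (expMap g o) S with hL
  set c : ℝ → EuclideanSpace ℝ (Fin n) := fun s =>
    L ((extChartAt (𝓡 n) p).symm (extChartAt (𝓡 n) p p + s • z)) with hc
  have hcS : ∀ s ∈ Ioc 0 s₀, ContinuousAt c s ∧ expMap g o (c s) =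
      (extChartAt (𝓡 n) p).symm (extChartAt (𝓡 n) p p + s • z) ∧
      HasDerivAt (fun s => innerForm g o (c s) (c s) / 2)
        (metricForm g p (extChartAt (𝓡 n) p p + s • z) (radialVel g o p (c s)) z) s := by
    intro s hs'
    have h1 := hin s hs'
    have h2 := hΩ.hasDerivAt_segment hg h1.1 h1.2.1
    exact ⟨h2.1, hΩ.exp_log h1.2.1, h2.2.2⟩
  have hline : Tendsto (fun s : ℝ => extChartAt (𝓡 n) p p + s • z) (𝓝[>] 0)
      (𝓝 (extChartAt (𝓡 n) p p)) := by
    have hcl : Continuous fun s : ℝ => extChartAt (𝓡 n) p p + s • z := by fun_prop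
    have := (hcl.tendsto 0).mono_left (nhdsWithin_le_nhds (s := Ioi 0))
    simpa using this
  -- Continuity of the logarithm at `p` makes the path start at `w`.
  have hclim : Tendsto c (𝓝[>] 0) (𝓝 w) := by
    refine tendsto_iff_forall_eventually_mem.2 fun N hN => ?_
    have h1 := ((tendsto_chart_symm p).comp hline).eventually
      (hΩ.eventually_log_mem hg hp hr (closure_mono hAS hwA) hwp hN)
    filter_upwards [h1, Ioc_mem_nhdsGT hs₀] with s hs1 hs2
    exact hs1 _ (subset_closure (hAS (hin s hs2).2.2)) (hcS s hs2).2.1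
  have hderlim : Tendsto (fun s => metricForm g p (extChartAt (𝓡 n) p p + s • z)
      (radialVel g o p (c s)) z) (𝓝[>] 0) (𝓝 (metricForm g p (extChartAt (𝓡 n) p p) X z)) := by
    have h1 : Tendsto (fun s : ℝ => metricForm g p (extChartAt (𝓡 n) p p + s • z)) (𝓝[>] 0)
        (𝓝 (metricForm g p (extChartAt (𝓡 n) p p))) :=
      (hG.contDiffAt hy₀t).continuousAt.tendsto.comp hline
    have h2 : Tendsto (fun s => radialVel g o p (c s)) (𝓝[>] 0) (𝓝 X) :=
      (contDiffAt_radialVel hg hs).continuousAt.tendsto.comp hclim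
    exact tendsto_form_apply h1 h2 z
  have hev := hderlim.eventually (gt_mem_nhds hlt)
  obtain ⟨s₁, hs₁, hs₁'⟩ := mem_nhdsGT_iff_exists_Ioo_subset.1 (hev.and (Ioc_mem_nhdsGT hs₀))
  have hs₁ : 0 < s₁ := hs₁
  -- If `g(X, z)` were negative, the squared length would strictly decrease along the path from its
  -- initial value `|w|²`, while the path stays in `A`.
  have hanti : StrictAntiOn (fun s => innerForm g o (c s) (c s) / 2) (Ioo 0 s₁) :=
    strictAntiOn_of_deriv_neg (convex_Ioo 0 s₁)
      (fun s hs' => (hcS s (hs₁' hs').2).2.2.continuousAt.continuousWithinAt) (fun s hs' => by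
        rw [interior_Ioo] at hs'
        rw [(hcS s (hs₁' hs').2).2.2.deriv]
        exact (hs₁' hs').1)
  -- Two times are used: the limit gives only a weak inequality at `s₁ / 3`, and strict decrease up
  -- to `s₁ / 2` makes it strict.
  have hI2 : s₁ / 2 ∈ Ioo 0 s₁ := ⟨by linarith, by linarith⟩
  have hI3 : s₁ / 3 ∈ Ioo 0 s₁ := ⟨by linarith, by linarith⟩
  have hlim2 : Tendsto (fun s => innerForm g o (c s) (c s) / 2) (𝓝[>] 0)
      (𝓝 (innerForm g o w w / 2)) := ((hNc.tendsto w).comp hclim).div_const 2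
  have h5 : innerForm g o (c (s₁ / 3)) (c (s₁ / 3)) / 2 ≤ innerForm g o w w / 2 := by
    refine ge_of_tendsto hlim2 ?_
    filter_upwards [Ioo_mem_nhdsGT (show (0 : ℝ) < s₁ / 3 by linarith)] with s hs'
    exact (hanti ⟨hs'.1, by linarith [hs'.2]⟩ hI3 hs'.2).le
  have h6 := hanti hI3 hI2 (by linarith)
  have h7 := hwmin _ (hin _ (hs₁' hI2).2).2.2
  simp only at h6
  change innerForm g o w w ≤ innerForm g o (c (s₁ / 2)) (c (s₁ / 2)) at h7
  linarith

end

section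

variable [T2Space M] (hg : IsComplete g) (hΩ : IsRegularNormalNhdVia g o Ω S)
  (hsmooth : HasSmoothBoundary n Ω) (H : RadiallyOutward g o Ω S)
include hg hΩ hsmooth H

/-- Under the boundary condition, a limit of segments in `S` that ends in `S` stays in `S`. -/
theorem mem_starPart_of_mem_closure {v : EuclideanSpace ℝ (Fin n)} (hv : v ∈ S)
    (hvT : v ∈ closure (starPart S)) : v ∈ starPart S := by
  by_contra hnot
  have hct : Continuous fun t : ℝ => t • v := by fun_prop
  have hclT : ∀ t ∈ Icc (0 : ℝ) 1, t • v ∈ closure S := fun t ht => by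
    have hc : Continuous fun u : EuclideanSpace ℝ (Fin n) => t • u := by fun_prop
    exact map_mem_closure hc hvT fun u hu => hu t ht
  set Z : Set ℝ := {t | t ∈ Icc (0 : ℝ) 1 ∧ t • v ∉ S} with hZ
  have hZne : Z.Nonempty := by
    by_contra! h
    refine hnot fun t ht => ?_
    by_contra h'
    exact (h ▸ (show t ∈ Z from ⟨ht, h'⟩) : t ∈ (∅ : Set ℝ))
  have hZc : IsClosed Z :=
    isClosed_Icc.inter (hΩ.isOpen_source.preimage hct).isClosed_compl
  have hZb : BddAbove Z := ⟨1, fun t ht => ht.1.2⟩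
  -- The last exit time from `S`: after it the segment stays in `S`, so the geodesic enters `Ω`
  -- there.
  set τ := sSup Z with hτ
  have hτZ : τ ∈ Z := hZc.csSup_mem hZne hZb
  have hτ1 : τ < 1 := by
    refine lt_of_le_of_ne hτZ.1.2 fun h => hτZ.2 ?_
    rw [h, one_smul]; exact hv
  have hτ0 : 0 < τ := by
    refine lt_of_le_of_ne hτZ.1.1 fun h => hτZ.2 ?_
    rw [← h, zero_smul]; exact hΩ.zero_mem
  have hgt : ∀ t, τ < t → t ≤ 1 → t • v ∈ S := fun t h1 h2 => by
    by_contra h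
    exact absurd (le_csSup hZb (show t ∈ Z from ⟨⟨by linarith, h2⟩, h⟩)) (not_le.2 h1)
  set w := τ • v with hw
  have hwS : w ∈ closure S := hclT τ hτZ.1
  have hp : expMap g o w ∈ frontier Ω := hΩ.exp_mem_frontier hg hwS hτZ.2
  -- Because `τ < 1`, the vector `w` is interior to a limit of segments in `S`, which carry no
  -- conjugate vectors.
  have hnc : NonConj g o w := by
    refine nonConj_of_mem_closure hg (closure_mono ?_ hvT) τ ⟨hτ0.le, hτ1⟩
    exact fun u hu t ht => hΩ.nonConj hg (hu t ht)
  set p := expMap g o w with hpw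
  obtain ⟨r, hr⟩ := exists_isDefiningFunction hΩ.isOpen hsmooth hp
  have hs : expMap g o w ∈ (extChartAt (𝓡 n) p).source := mem_extChartAt_source p
  have hfc := contDiffAt_chartExp hg hs
  obtain ⟨ψ, hψ, hψ0, hψl, hψr⟩ := exists_localInverse hfc ((nonConj_iff hg hs).1 hnc)
  have hy₀ : chartExp g o p w = extChartAt (𝓡 n) p p := rfl
  rw [hy₀] at hψ hψ0 hψr
  have hr1 : ContDiffAt ℝ 1 r (extChartAt (𝓡 n) p p) := hr.contDiffAt.of_le (by simp)
  have hrd : ContDiffAt ℝ 1 (fderiv ℝ r) (extChartAt (𝓡 n) p p) := by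
    have : ContDiffAt ℝ ∞ (fderiv ℝ r) (extChartAt (𝓡 n) p p) :=
      hr.contDiffAt.fderiv_right (by simp)
    exact this.of_le (by simp)
  -- The radial velocity field near the boundary point, through the local inverse `ψ` of the
  -- exponential map, paired with `dr`.
  set b : EuclideanSpace ℝ (Fin n) → ℝ := fun y => fderiv ℝ r y (radialVel g o p (ψ y)) with hb
  have hbc : ContDiffAt ℝ 1 b (extChartAt (𝓡 n) p p) := by
    refine hrd.clm_apply (ContDiffAt.comp (g := radialVel g o p) _ ?_ hψ)
    rw [hψ0]; exact contDiffAt_radialVel hg hs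
  -- Continuity of the logarithm ensures that at boundary points near `p` the local inverse `ψ`
  -- agrees with the logarithm, so the hypothesis `H` there is a statement about `b`.
  have hbpos : ∀ᶠ y in 𝓝 (extChartAt (𝓡 n) p p), r y = 0 → 0 ≤ b y := by
    filter_upwards [(tendsto_chart_symm p).eventually (hr.frontier_iff.and
      (hr.eventually_transition.and ((isOpen_source (n := n) p).mem_nhds
        (mem_extChartAt_source p)))),
      (tendsto_chart_symm p).eventually (hΩ.eventually_log_mem hg hp hr hwS rfl hψl),
      chart_target_mem_nhds p] with y hy hlog hyt hy0
    obtain ⟨hfr, ⟨htr, htr'⟩, hys⟩ := hy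
    have hright : extChartAt (𝓡 n) p ((extChartAt (𝓡 n) p).symm y) = y :=
      (extChartAt (𝓡 n) p).right_inv hyt
    rw [hright] at hfr
    set q := (extChartAt (𝓡 n) p).symm y with hq
    have hqf : q ∈ frontier Ω := hfr.2 hy0
    obtain ⟨u, hu, huq⟩ := hΩ.exists_log hg hqf htr
    have hψu : ψ (chartExp g o p u) = u := hlog u hu huq
    have hcu : chartExp g o p u = y := by rw [chartExp, huq, hright]
    rw [hcu] at hψu
    have h1 := H q hqf _ htr u hu huq
    have h2 : radialVel g o q u = dexp g o u u := by rw [radialVel, huq, chartDeriv_self]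
    rw [htr', h2, hright] at h1
    simp only [hb, hψu, radialVel, huq]
    exact h1
  obtain ⟨C, hC, hCb⟩ := exists_neg_mul_abs_le hr1 hr.fderiv_ne (hr.eq_zero hp) hbc hbpos
  have hlw : Tendsto (fun t : ℝ => t • w) (𝓝 1) (𝓝 w) := by
    have hc : Continuous fun t : ℝ => t • w := by fun_prop
    simpa using hc.tendsto 1
  have hft : Tendsto (fun t : ℝ => chartExp g o p (t • w)) (𝓝 1) (𝓝 (extChartAt (𝓡 n) p p)) :=
    hfc.continuousAt.tendsto.comp hlw
  -- The factor `t` appears because `radialVel` at `t w` is the differential applied to `t w`, while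
  -- the curve `t ↦ t w` has velocity `w`.
  have hder : ∀ᶠ t : ℝ in 𝓝 1, ∃ d, HasDerivAt (fun t : ℝ => r (chartExp g o p (t • w))) d t ∧
      t * d = b (chartExp g o p (t • w)) := by
    filter_upwards [hlw.eventually (hψl.and (eventually_expMap_mem hg hs)),
      hft.eventually (hr1.eventually (by simp))] with t ht1 ht2
    have h1 : HasDerivAt (fun t : ℝ => t • w) w t := by
      simpa using (hasDerivAt_id t).smul_const w
    have h2 := ((contDiffAt_chartExp hg ht1.2).differentiableAt
      (by simp)).hasFDerivAt.comp_hasDerivAt t h1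
    have h3 := (ht2.differentiableAt (by simp)).hasFDerivAt.comp_hasDerivAt t h2
    refine ⟨_, h3, ?_⟩
    simp only [hb, ht1.1]
    rw [← fderiv_chartExp_self hg ht1.2, ContinuousLinearMap.map_smul _ t w,
      ContinuousLinearMap.map_smul _ t, smul_eq_mul]
  have hneg : ∀ᶠ t : ℝ in 𝓝 1, 1 < t → r (chartExp g o p (t • w)) < 0 := by
    have hmem : Tendsto (fun t : ℝ => expMap g o (t • w)) (𝓝 1) (𝓝 p) :=
      ((continuous_expMap hg o).tendsto w).comp hlw
    filter_upwards [hmem.eventually hr.mem_iff, gt_mem_nhds (one_lt_one_div hτ0 hτ1)]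
      with t ht1 ht2 ht3
    refine ht1.1 (hΩ.bijOn.mapsTo ?_)
    rw [hw, smul_smul]
    rw [lt_div_iff₀ hτ0] at ht2
    exact hgt _ (by nlinarith) ht2.le
  obtain ⟨ε, hε, hε'⟩ := Metric.eventually_nhds_iff.1
    ((hder.and hneg).and (hft.eventually hCb))
  have hball : ∀ t ∈ Ioo (1 - ε) (1 + ε), dist t 1 < ε := fun t ht => by
    rw [Real.dist_eq, abs_lt]
    exact ⟨by linarith [ht.1], by linarith [ht.2]⟩
  set f : ℝ → ℝ := fun t => r (chartExp g o p (t • w)) with hf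
  choose! d hd hdb using fun t (ht : t ∈ Ioo (1 - ε) (1 + ε)) => (hε' (hball t ht)).1.1
  have hf1 : f 1 = 0 := by
    simp only [hf, one_smul]
    exact hr.eq_zero hp
  -- For `t > 1`, `r` is negative on the curve, so `t d ≥ -C |f|` reads `-d ≤ C (-f)`. Letting `s`
  -- tend to `1`, where `f` vanishes, forces `f ≥ 0` later on.
  have hle : ∀ s ∈ Ioo (1 : ℝ) (1 + ε / 2), -f (1 + ε / 2) ≤
      Real.exp (C * ((1 + ε / 2) - s)) * (-f s) := by
    intro s hs
    refine image_le_mul_exp_of_hasDerivAt_le (f := fun t => -f t) (f' := fun t => -d t) (a := 1)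
      (b := 1 + ε) (fun t ht => (hd t ⟨by linarith [ht.1], ht.2⟩).neg) (fun t ht => ?_)
      ⟨hs.1, by linarith [hs.2]⟩ ⟨by linarith, by linarith⟩ hs.2.le
    have htI : t ∈ Ioo (1 - ε) (1 + ε) := ⟨by linarith [ht.1], ht.2⟩
    have h1 := hdb t htI
    have h2 := (hε' (hball t htI)).2
    have h3 := (hε' (hball t htI)).1.2 ht.1
    rw [← h1, abs_of_neg h3] at h2
    have h4 : 0 ≤ C * (-f t) := mul_nonneg hC (neg_nonneg.2 h3.le)
    change -(C * (-f t)) ≤ _ at h2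
    by_contra! h5
    have h6 : C * (-f t) < -d t := h5
    have h7 := ht.1
    nlinarith
  have hlim : Tendsto (fun s => Real.exp (C * ((1 + ε / 2) - s)) * (-f s)) (𝓝[>] 1)
      (𝓝 (Real.exp (C * ((1 + ε / 2) - 1)) * (-f 1))) := by
    refine Tendsto.mono_left ?_ nhdsWithin_le_nhds
    refine ContinuousAt.mul (by fun_prop)
      (hd 1 ⟨by linarith, by linarith⟩).continuousAt.neg
  have h1 : -f (1 + ε / 2) ≤ Real.exp (C * ((1 + ε / 2) - 1)) * (-f 1) :=
    ge_of_tendsto hlim (by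
      filter_upwards [Ioo_mem_nhdsGT (show (1 : ℝ) < 1 + ε / 2 by linarith)] with s hs using hle s hs)
  rw [hf1, neg_zero, mul_zero] at h1
  have h2 := (hε' (hball (1 + ε / 2) ⟨by linarith, by linarith⟩)).1.2 (by linarith)
  change f (1 + ε / 2) < 0 at h2
  linarith

/-- Under the boundary condition, `S` is starshaped. -/
theorem subset_starPart : S ⊆ starPart S := by
  by_contra hnot
  set A := S \ starPart S with hA
  have hAne : A.Nonempty := by
    obtain ⟨u, hu, hu'⟩ := not_subset.1 hnot
    exact ⟨u, hu, hu'⟩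
  -- Relative closedness of the starshaped part makes `A` open; openness of that part makes `A`
  -- relatively closed.
  have hAeq : A = S ∩ (closure (starPart S))ᶜ := by
    ext u
    refine ⟨fun h => ⟨h.1, fun h' => h.2 (mem_starPart_of_mem_closure hg hΩ hsmooth H h.1 h')⟩,
      fun h => ⟨h.1, fun h' => h.2 (subset_closure h')⟩⟩
  have hAopen : IsOpen A := by
    rw [hAeq]; exact hΩ.isOpen_source.inter isClosed_closure.isOpen_compl
  have hAcl : closure A ∩ S ⊆ A := fun u hu => by
    refine ⟨hu.2, fun h => ?_⟩
    obtain ⟨x, hx1, hx2⟩ := mem_closure_iff.1 hu.1 _ (isOpen_starPart hΩ.isOpen_source) h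
    exact hx2.2 hx1
  have hAS : closure A ⊆ closure S := closure_mono diff_subset
  have h0 : (0 : EuclideanSpace ℝ (Fin n)) ∈ starPart S := fun t _ => by
    rw [smul_zero]; exact hΩ.zero_mem
  obtain ⟨κ, hκ, hκ'⟩ := innerForm_lower_bound g o
  have hNc : Continuous fun u => innerForm g o u u := by fun_prop
  obtain ⟨w, hwA, hwmin⟩ : ∃ w ∈ closure A, ∀ u ∈ closure A, innerForm g o w w ≤ innerForm g o u u := by
    obtain ⟨u₀, hu₀⟩ := hAne
    have hcoer : ∀ᶠ u in cocompact _ ⊓ 𝓟 (closure A), innerForm g o u₀ u₀ ≤ innerForm g o u u := by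
      refine Eventually.filter_mono inf_le_left ?_
      have h1 : Tendsto (fun u : EuclideanSpace ℝ (Fin n) => κ * ‖u‖ ^ 2) (cocompact _) atTop :=
        Tendsto.const_mul_atTop hκ ((tendsto_pow_atTop two_ne_zero).comp
          (tendsto_norm_cocompact_atTop))
      filter_upwards [h1.eventually_ge_atTop (innerForm g o u₀ u₀)] with u hu
      exact hu.trans (hκ' u)
    obtain ⟨w, hw, hmin⟩ := hNc.continuousOn.exists_isMinOn' isClosed_closure (subset_closure hu₀) hcoer
    exact ⟨w, hw, fun u hu => hmin hu⟩
  have hw0 : w ≠ 0 := by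
    rintro rfl
    have : (0 : EuclideanSpace ℝ (Fin n)) ∈ A := hAcl ⟨hwA, hΩ.zero_mem⟩
    exact this.2 h0
  have hwpos := innerForm_pos (g := g) o hw0
  -- Inside the open set `A`, shrinking `w` slightly would decrease its length.
  have hwA' : w ∉ A := by
    intro h
    have hc : Continuous fun t : ℝ => t • w := by fun_prop
    have h1 : ∀ᶠ t : ℝ in 𝓝[<] 1, t • w ∈ A :=
      nhdsWithin_le_nhds (hc.continuousAt.eventually (hAopen.mem_nhds (by simpa using h)))
    obtain ⟨t, ht1, ht2⟩ := (h1.and (Ioo_mem_nhdsLT (zero_lt_one (α := ℝ)))).exists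
    have h2 := hwmin _ (subset_closure ht1)
    simp only [map_smul, ContinuousLinearMap.smul_apply, smul_eq_mul] at h2
    have h3 : t * t < 1 := by nlinarith [ht2.1, ht2.2]
    nlinarith
  have hwS : w ∉ S := fun h => hwA' (hAcl ⟨hwA, h⟩)
  have hp : expMap g o w ∈ frontier Ω := hΩ.exp_mem_frontier hg (hAS hwA) hwS
  set p := expMap g o w with hpw
  obtain ⟨r, hr⟩ := exists_isDefiningFunction hΩ.isOpen hsmooth hp
  have hs : expMap g o w ∈ (extChartAt (𝓡 n) p).source := mem_extChartAt_source p
  have hG := isLocalMetric g p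
  have hy₀t : extChartAt (𝓡 n) p p ∈ (extChartAt (𝓡 n) p).target := mem_extChartAt_target p
  set X := radialVel g o p w with hX
  have hXX : metricForm g p (extChartAt (𝓡 n) p p) X X = innerForm g o w w :=
    metricForm_radialVel_self hg hs
  have hHX : 0 ≤ fderiv ℝ r (extChartAt (𝓡 n) p p) X := H p hp r hr w (hAS hwA) rfl
  have key : ∀ z, fderiv ℝ r (extChartAt (𝓡 n) p p) z < 0 →
      0 ≤ metricForm g p (extChartAt (𝓡 n) p p) X z := fun z hz =>
    metricForm_radialVel_nonneg_of_minimal hg hΩ hp hr diff_subset hAopen hAcl hwA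
      (fun u hu => hwmin u (subset_closure hu)) rfl hz
  obtain ⟨m, hm⟩ := exists_apply_neg hr.fderiv_ne
  -- The vector `-X` only satisfies `dr ≤ 0`; adding `ε m` with `dr m < 0` makes the inequality
  -- strict, and `ε` then tends to `0`.
  have hbound : ∀ ε : ℝ, 0 < ε → innerForm g o w w ≤
      ε * metricForm g p (extChartAt (𝓡 n) p p) X m := by
    intro ε hε
    have h1 := key (-X + ε • m) (by
      rw [map_add, map_neg, map_smul, smul_eq_mul]
      nlinarith)
    rw [map_add, map_neg, map_smul, smul_eq_mul, hXX] at h1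
    linarith
  have hlim : Tendsto (fun ε : ℝ => ε * metricForm g p (extChartAt (𝓡 n) p p) X m) (𝓝[>] 0)
      (𝓝 (0 * metricForm g p (extChartAt (𝓡 n) p p) X m)) :=
    (tendsto_id.mul_const _).mono_left nhdsWithin_le_nhds
  have := ge_of_tendsto hlim (by
    filter_upwards [self_mem_nhdsWithin] with ε hε using hbound ε hε)
  rw [zero_mul] at this
  linarith

theorem isStarshapedNhd_of_radiallyOutward : IsStarshapedNhd g o Ω := by
  refine ⟨S, hΩ.toIsNormalNhdVia, starConvex_zero_iff.2 fun u hu t ht0 ht1 => ?_⟩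
  exact subset_starPart hg hΩ hsmooth H hu t ⟨ht0, ht1⟩

end

end Starshaped

end

/-! ### From defining functions back to unit normals. -/

noncomputable section

namespace Starshaped

variable {n : ℕ} {M : Type*} [TopologicalSpace M] [ChartedSpace (EuclideanSpace ℝ (Fin n)) M]
  [IsManifold (𝓡 n) ∞ M] {g : Metric n M} {o p : M} {Ω : Set M}
  {S : Set (EuclideanSpace ℝ (Fin n))} {r : EuclideanSpace ℝ (Fin n) → ℝ}

section

variable [T2Space M] (hg : IsComplete g) (hΩ : IsRegularNormalNhdVia g o Ω S)
include hg hΩ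

theorem existsUnique_log (hp : p ∈ frontier Ω) (hr : IsDefiningFunction Ω p r) :
    ∃! v : EuclideanSpace ℝ (Fin n), v ∈ closure S ∧ expMap g o v = p := by
  obtain ⟨v, hv, hvp⟩ := hΩ.exists_log hg hp hr
  exact ⟨v, ⟨hv, hvp⟩, fun w hw => hΩ.injOn_closure hw.1 hv (hw.2.trans hvp.symm)⟩

/-- The terminal velocity of the radial geodesic that ends at the boundary point `p`. -/
theorem velocity_radial_eq (hp : p ∈ frontier Ω) (hr : IsDefiningFunction Ω p r)
    {v : EuclideanSpace ℝ (Fin n)} (hv : v ∈ closure S) (hvp : expMap g o v = p) :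
    velocityVec n (radial g o S p) 1 = radialVel g o p v := by
  have hex : ∃ u ∈ closure S, expMap g o u = p := hΩ.exists_log hg hp hr
  have hlog : logMap g o S p = v := hΩ.injOn_closure (Function.invFunOn_mem hex) hv
    ((Function.invFunOn_eq hex).trans hvp.symm)
  have hrad : radial g o S p = geod g o v := by
    funext t
    rw [radial, hlog, geod]
  rw [hrad, velocityVec_geod hg, one_smul, radialVel, hvp, chartDeriv_self]

/-- The boundary condition in terms of normals and in terms of defining functions. -/
theorem innerForm_normal_nonneg_iff (hp : p ∈ frontier Ω) (hr : IsDefiningFunction Ω p r)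
    {v : EuclideanSpace ℝ (Fin n)} (hv : v ∈ closure S) (hvp : expMap g o v = p)
    {ν : EuclideanSpace ℝ (Fin n)}
    (hν : IsOutwardUnitNormal g Ω p (show TangentSpace (𝓡 n) p from ν)) :
    0 ≤ innerForm g p ν (velocityVec n (radial g o S p) 1) ↔
      0 ≤ fderiv ℝ r (extChartAt (𝓡 n) p p) (radialVel g o p v) := by
  obtain ⟨-, c, hc, hcD⟩ := (hr.isOutwardUnitNormal_iff hg hp).1 hν
  rw [velocity_radial_eq hg hΩ hp hr hv hvp, hcD]
  exact (mul_nonneg_iff_of_pos_left hc).symm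

end

end Starshaped

end

/-- The vector `velocity (radial g o S p) 1` is a tangent vector at `radial g o S p 1 = p`. -/
theorem proposition2p6 {n : ℕ} (hn : 2 ≤ n)
    {M : Type*} [TopologicalSpace M] [T2Space M] [SecondCountableTopology M] [ConnectedSpace M]
    [ChartedSpace (EuclideanSpace ℝ (Fin n)) M] [IsManifold (𝓡 n) ∞ M]
    (g : Starshaped.Metric n M) (hg : Starshaped.IsComplete g)
    (o : M) (Ω : Set M) (S : Set (EuclideanSpace ℝ (Fin n)))
    (hΩ : Starshaped.IsRegularNormalNhdVia g o Ω S)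
    (hne : (frontier Ω).Nonempty) (hsmooth : Starshaped.HasSmoothBoundary n Ω) :
    (∀ p ∈ frontier Ω,
      (∃! v : EuclideanSpace ℝ (Fin n), v ∈ closure S ∧ Starshaped.expMap g o v = p) ∧
      (∃! ν : TangentSpace (𝓡 n) p, Starshaped.IsOutwardUnitNormal g Ω p ν)) ∧
    (Starshaped.IsStarshapedNhd g o Ω ↔
      ∀ p ∈ frontier Ω, ∀ ν : TangentSpace (𝓡 n) p, Starshaped.IsOutwardUnitNormal g Ω p ν →
        0 ≤ g.inner p ν (Starshaped.velocity (Starshaped.radial g o S p) 1)) := by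
  have hdef : ∀ p ∈ frontier Ω, ∃ r : EuclideanSpace ℝ (Fin n) → ℝ,
      Starshaped.IsDefiningFunction Ω p r :=
    fun p hp => Starshaped.exists_isDefiningFunction hΩ.isOpen hsmooth hp
  refine ⟨fun p hp => ?_, fun hstar p hp ν hν => ?_, fun H => ?_⟩
  · obtain ⟨r, hr⟩ := hdef p hp
    exact ⟨Starshaped.existsUnique_log hg hΩ hp hr, hr.existsUnique_isOutwardUnitNormal hg hp⟩
  · obtain ⟨r, hr⟩ := hdef p hp
    obtain ⟨v, hv, hvp⟩ := hΩ.exists_log hg hp hr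
    exact (Starshaped.innerForm_normal_nonneg_iff hg hΩ hp hr hv hvp hν).2
      (hΩ.fderiv_radialVel_nonneg hg (hΩ.starConvex hg hstar) hr hp hv hvp)
  · refine Starshaped.isStarshapedNhd_of_radiallyOutward hg hΩ hsmooth fun p hp r hr v hv hvp => ?_
    obtain ⟨ν, hν, -⟩ := hr.existsUnique_isOutwardUnitNormal hg hp
    exact (Starshaped.innerForm_normal_nonneg_iff hg hΩ hp hr hv hvp hν).1 (H p hp ν hν)
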